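/- Let $p\in(0,1)$, let $X,\xi$ be real random variables with $\mathbb P(X=0)<1$, $\xi\ge 0$ a.s., and $X,\xi\in L^\alpha(\mathbb P)$ for some $\alpha>1$, and put $m_1=\mathbb E\xi$. Let $(X_n)_{n\ge1}$ be distributed as $X$, and for $n\ge2$ let $\varepsilon_n\sim\mathrm{Bernoulli}(p)$, let $U[n]$ be uniform on $\{1,\dots,n-1\}$ and let $\xi_n$ be distributed as $\xi$, all these variables being mutually independent. The random walk with echoed steps is $\tilde S_n=\tilde X_1+\dots+\tilde X_n$, where $\tilde X_1=X_1$ and $$\tilde X_n=(1-\varepsilon_n)X_n+\varepsilon_n\xi_n\tilde X_{U[n]},\qquad n\ge2.$$ Consider the random recursive tree on $\{1,2,\dots\}$ with root $1$ in which $U[n]$ is the parent of $n\ge2$, and delete the edge between $n$ and $U[n]$ whenever $\varepsilon_n=0$. For $r=1$, and for $r\ge2$ with $\varepsilon_r=0$, let $T_r(n)$ be the set of vertices $i\le n$ lying in the component rooted at $r$; for $r\ge2$ with $\varepsilon_r=1$ put $T_r(n)=\emptyset$. Give the vertices the weights $\omega(1)=1$ and $\omega(n)=(1-\varepsilon_n)+\varepsilon_n\xi_n\,\omega(U[n])$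 for $n\ge2$, and let $\|T_r(n)\|=\sum_{i\in T_r(n)}\omega(i)$. Suppose that $pm_1>1$. Then for every $r\ge1$ the limit $$L_r^{(p,\xi)}=\lim_{n\to\infty}\frac{\|T_r(n)\|}{n^{pm_1}}$$ exists a.s. and is integrable; the sequence $(L_r^{(p,\xi)})_{r\ge1}$ is independent of $(X_r)_{r\ge1}$; the series $\sum_{r\ge1}X_rL_r^{(p,\xi)}$ is a.s. absolutely convergent and its sum is integrable; and $$\lim_{n\to\infty}\frac{\tilde S_n}{n^{pm_1}}=\sum_{r\ge1}X_rL_r^{(p,\xi)}\qquad\text{a.s.}$$ Furthermore, if $\mathbb E[\xi\log\xi]<m_1$ (with $0\log0=0$), the series is non-degenerate, that is, not a.s. equal to a constant; if $\mathbb E[\xi\log\xi]\ge m_1$, then $\sum_{r\ge1}X_rL_r^{(p,\xi)}=0$ a.s. -/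

import Mathlib

open MeasureTheory ProbabilityTheory Filter Topology

namespace RWES

variable {Ω : Type*}

/-- All the sources of randomness as one family of real random variables:
the spins `X_n` (`n ≥ 1`), the Bernoulli variables `ε_n`, the uniform samples `U[n]` and
the echo variables `ξ_n` (`n ≥ 2`). -/
def noise (X ε : ℕ → Ω → ℝ) (U : ℕ → Ω → ℕ) (ξ : ℕ → Ω → ℝ) : ℕ ⊕ ℕ ⊕ ℕ ⊕ ℕ → Ω → ℝ
  | .inl i => X (i + 1)
  | .inr (.inl i) => ε (i + 2)
  | .inr (.inr (.inl i)) => fun ω => (U (i + 2) ω : ℝ)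
  | .inr (.inr (.inr i)) => ξ (i + 2)

/-- The random input of a random walk with echoed steps with memory parameter `p`, spin law `νX`
and echo law `νξ`. Times start at `1`: only `X n` with `n ≥ 1` and `ε n`, `U n`, `ξ n` with
`n ≥ 2` are constrained (and used). -/
structure IsInput [MeasurableSpace Ω] (P : Measure Ω) (p : ℝ) (νX νξ : Measure ℝ)
    (X ε : ℕ → Ω → ℝ) (U : ℕ → Ω → ℕ) (ξ : ℕ → Ω → ℝ) : Prop where
  measurable_spin : ∀ n, 1 ≤ n → Measurable (X n)
  measurable_bernoulli : ∀ n, 2 ≤ n → Measurable (ε n)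
  measurable_sample : ∀ n, 2 ≤ n → Measurable (U n)
  measurable_echo : ∀ n, 2 ≤ n → Measurable (ξ n)
  law_spin : ∀ n, 1 ≤ n → P.map (X n) = νX
  law_bernoulli : ∀ n, 2 ≤ n →
    P {ω | ε n ω = 1} = ENNReal.ofReal p ∧ P {ω | ε n ω = 0} = ENNReal.ofReal (1 - p)
  /-- `U[n]` is uniform on `{1, …, n - 1}`. -/
  law_sample : ∀ n, 2 ≤ n → ∀ k ∈ Finset.Icc 1 (n - 1),
    P {ω | U n ω = k} = ENNReal.ofReal (1 / ((n : ℝ) - 1))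
  law_echo : ∀ n, 2 ≤ n → P.map (ξ n) = νξ
  indep : iIndepFun (noise X ε U ξ) P

/-- The increments of the random walk with echoed steps: `step 1 = X 1` and
`step n = (1 - ε n) * X n + ε n * ξ n * step (U n)` for `n ≥ 2`.
The values for `n = 0` and off the almost sure event `1 ≤ U n < n` are irrelevant. -/
noncomputable def step (X ε : ℕ → Ω → ℝ) (U : ℕ → Ω → ℕ) (ξ : ℕ → Ω → ℝ) (ω : Ω) : ℕ → ℝ
  | 0 => 0
  | 1 => X 1 ω
  | n + 2 => (1 - ε (n + 2) ω) * X (n + 2) ω + ε (n + 2) ω * ξ (n + 2) ω *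
      (if _h : U (n + 2) ω < n + 2 then step X ε U ξ ω (U (n + 2) ω) else 0)
  termination_by n => n

/-- The random walk with echoed steps at time `n`. -/
noncomputable def walk (X ε : ℕ → Ω → ℝ) (U : ℕ → Ω → ℕ) (ξ : ℕ → Ω → ℝ) (n : ℕ) (ω : Ω) : ℝ :=
  ∑ k ∈ Finset.Icc 1 n, step X ε U ξ ω k

/-- The weight of the vertex `n` of the percolated memory tree: `weight 1 = 1` and
`weight n = (1 - ε n) + ε n * ξ n * weight (U n)` for `n ≥ 2`. -/
noncomputable def weight (ε : ℕ → Ω → ℝ) (U : ℕ → Ω → ℕ) (ξ : ℕ → Ω → ℝ) (ω : Ω) : ℕ → ℝ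
  | 0 => 0
  | 1 => 1
  | n + 2 => (1 - ε (n + 2) ω) + ε (n + 2) ω * ξ (n + 2) ω *
      (if _h : U (n + 2) ω < n + 2 then weight ε U ξ ω (U (n + 2) ω) else 0)
  termination_by n => n

/-- The root of the component containing the vertex `n` in the memory tree (in which `U n` is the
parent of `n ≥ 2`) after removal of the edges `(n, U n)` with `ε n = 0`. The root of the memory
tree is the vertex `1`; the value at `n = 0` is irrelevant. -/
noncomputable def root (ε : ℕ → Ω → ℝ) (U : ℕ → Ω → ℕ) (ω : Ω) : ℕ → ℕ
  | 0 => 0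
  | 1 => 1
  | n + 2 => if ε (n + 2) ω = 0 then n + 2
      else if _h : U (n + 2) ω < n + 2 then root ε U ω (U (n + 2) ω) else 0
  termination_by n => n

/-- The vertices, up to time `n`, of the percolation component rooted at `r`. It is empty if
`r ≥ 2` and the edge from `r` to its parent has been kept, and if `n < r`. -/
noncomputable def subtree (ε : ℕ → Ω → ℝ) (U : ℕ → Ω → ℕ) (r n : ℕ) (ω : Ω) : Finset ℕ :=
  {i ∈ Finset.Icc 1 n | root ε U ω i = r}

/-- The total weight `‖T_r(n)‖` of the percolation component rooted at `r` at time `n`. -/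
noncomputable def subtreeWeight (ε : ℕ → Ω → ℝ) (U : ℕ → Ω → ℕ) (ξ : ℕ → Ω → ℝ)
    (r n : ℕ) (ω : Ω) : ℝ :=
  ∑ i ∈ subtree ε U r n ω, weight ε U ξ ω i

/-- The pointwise limit of `‖T_r(n)‖ / n ^ a` as `n → ∞` (an arbitrary value where the limit
does not exist). -/
noncomputable def subtreeLimit (ε : ℕ → Ω → ℝ) (U : ℕ → Ω → ℕ) (ξ : ℕ → Ω → ℝ)
    (a : ℝ) (r : ℕ) (ω : Ω) : ℝ :=
  limUnder atTop (fun n : ℕ => subtreeWeight ε U ξ r n ω / (n : ℝ) ^ a)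

/-- The random series `∑_{r ≥ 1} X_r L_r`. -/
noncomputable def limitSeries (X ε : ℕ → Ω → ℝ) (U : ℕ → Ω → ℕ) (ξ : ℕ → Ω → ℝ)
    (a : ℝ) (ω : Ω) : ℝ :=
  ∑' r : ℕ, X (r + 1) ω * subtreeLimit ε U ξ a (r + 1) ω

/-- A random variable is non-degenerate if it is not almost surely constant. -/
def NonDegenerate [MeasurableSpace Ω] (P : Measure Ω) (Y : Ω → ℝ) : Prop :=
  ¬ ∃ c : ℝ, ∀ᵐ ω ∂P, Y ω = c

end RWES

/-! Write a = p m₁, and let F_n be the information available at time n. Given F_n, the step n + 1 is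
a fresh spin with probability 1 - p, and otherwise a uniformly chosen earlier step times an
independent echo. Hence E[S_{n+1} | F_n] = (1 + a/n) S_n + (1 - p) E X, and the natural scale is
`growth a n`, the product of the factors 1 + a/k for k < n, which is of order n^a. On this scale a
spin created at time k has mean influence at most of order 1 / growth a k, and a > 1 makes these
influences summable.

For nonnegative spins the normalised walk is therefore an L¹-bounded submartingale and converges
(`exists_tendsto_walk`). Signed spins follow by linearity, and ‖T_r(n)‖ is the walk driven by the
spins 1_{n = r}. Removing the first R components from the walk amounts to erasing its first R spins.
By Fatou the limit of what remains has L¹ norm at most a constant times a tail of a convergent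
series, which identifies the limit with the random series (`walkLimit_eq_limitSeries`). Independence
holds because the components do not involve the spins.

The dichotomy compares s ↦ E ξ^{1+s} with s ↦ (1 + s) m₁: they agree at s = 0, where the slopes are
E[ξ log ξ] and m₁. If E[ξ log ξ] < m₁, then E ξ^q < q m₁ for some q in (1, 2]. The q-th moments of
single steps are then negligible against n^{qa}, so the normalised walk is bounded in L^q and
converges in L¹. Suppose the limit is constant. The covariance of S_n with an event of F_m is
multiplied by exactly 1 + a/n at each time n ≥ m, yet is o(n^a), so it vanishes and S_m is constant.
Constancy of S_1 and S_2 forces ξ = 1 a.s., which contradicts a > 1.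

If E[ξ log ξ] ≥ m₁, convexity gives E ξ^{1+q} > (1 + q) m₁. Kill every vertex whose weight exceeds K
growth a n, and normalise weights by this threshold. The mean of the sum of x over the surviving
vertices is nonincreasing; that of x (β^q - x^q) loses at least order 1/n times the mean of the sum
of x^{1+q}; that of -x log x gains only summable amounts. Persistent mass with a bounded logarithmic
moment would keep the sum of x^{1+q} bounded below, and the harmonic series would contradict the
finite total loss (`tendsto_zero_of_drift`). So the killed mass vanishes. On each path the component
weight is O(n^a), so for K large nothing is killed and the true limit is zero. -/

open scoped ENNReal

namespace RWES

variable {Ω : Type*}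

/-! ### The recursion with killing -/

/-- The recursion defining `step`, in which every new value is passed through `τ n`. -/
noncomputable def filteredStep (τ : ℕ → ℝ → ℝ) (Z ε : ℕ → Ω → ℝ) (U : ℕ → Ω → ℕ)
    (ξ : ℕ → Ω → ℝ) (ω : Ω) : ℕ → ℝ
  | 0 => 0
  | 1 => τ 1 (Z 1 ω)
  | n + 2 => τ (n + 2) ((1 - ε (n + 2) ω) * Z (n + 2) ω + ε (n + 2) ω * ξ (n + 2) ω *
      (if _h : U (n + 2) ω < n + 2 then filteredStep τ Z ε U ξ ω (U (n + 2) ω) else 0))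
  termination_by n => n

/-- The almost sure properties of the noise used in pathwise arguments. -/
def Regular (ε : ℕ → Ω → ℝ) (U : ℕ → Ω → ℕ) (ξ : ℕ → Ω → ℝ) (ω : Ω) : Prop :=
  ∀ n, 2 ≤ n → (ε n ω = 0 ∨ ε n ω = 1) ∧ 1 ≤ U n ω ∧ U n ω < n ∧ 0 ≤ ξ n ω

/-! ### Pathwise linearity and comparison of walks on the same tree. -/

section Pathwise

variable {τ : ℕ → ℝ → ℝ} {Z ε : ℕ → Ω → ℝ} {U : ℕ → Ω → ℕ} {ξ : ℕ → Ω → ℝ} {ω : Ω}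

theorem step_eq_filteredStep (n : ℕ) :
    step Z ε U ξ ω n = filteredStep (fun _ x => x) Z ε U ξ ω n := by
  induction n using Nat.strong_induction_on with
  | _ n ih =>
    match n with
    | 0 => simp [step, filteredStep]
    | 1 => simp [step, filteredStep]
    | n + 2 =>
      rw [step, filteredStep]
      by_cases h : U (n + 2) ω < n + 2
      · simp only [h, dite_true, ih _ h]
      · simp only [h, dite_false]

theorem filteredStep_one : filteredStep τ Z ε U ξ ω 1 = τ 1 (Z 1 ω) := by
  rw [filteredStep]

theorem filteredStep_of_eq_zero {n : ℕ} (hn : 2 ≤ n) (h0 : ε n ω = 0) :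
    filteredStep τ Z ε U ξ ω n = τ n (Z n ω) := by
  obtain ⟨k, rfl⟩ : ∃ k, n = k + 2 := ⟨n - 2, by omega⟩
  rw [filteredStep]
  simp [h0]

theorem filteredStep_of_eq_one {n : ℕ} (hn : 2 ≤ n) (h1 : ε n ω = 1) (hU : U n ω < n) :
    filteredStep τ Z ε U ξ ω n = τ n (ξ n ω * filteredStep τ Z ε U ξ ω (U n ω)) := by
  obtain ⟨k, rfl⟩ : ∃ k, n = k + 2 := ⟨n - 2, by omega⟩
  rw [filteredStep]
  simp [h1, hU]

theorem step_one : step Z ε U ξ ω 1 = Z 1 ω := by rw [step]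

theorem step_of_eq_zero {n : ℕ} (hn : 2 ≤ n) (h0 : ε n ω = 0) :
    step Z ε U ξ ω n = Z n ω := by
  rw [step_eq_filteredStep, filteredStep_of_eq_zero hn h0]

theorem step_of_eq_one {n : ℕ} (hn : 2 ≤ n) (h1 : ε n ω = 1) (hU : U n ω < n) :
    step Z ε U ξ ω n = ξ n ω * step Z ε U ξ ω (U n ω) := by
  simp only [step_eq_filteredStep]
  rw [filteredStep_of_eq_one hn h1 hU]

/-- Induction along the ancestral line of a vertex. -/
theorem Regular.induction (h : Regular ε U ξ ω) {motive : ℕ → Prop} (one : motive 1)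
    (zero : ∀ n, 2 ≤ n → ε n ω = 0 → motive n)
    (parent : ∀ n, 2 ≤ n → ε n ω = 1 → 1 ≤ U n ω → U n ω < n → 0 ≤ ξ n ω →
      motive (U n ω) → motive n) {n : ℕ} (hn : 1 ≤ n) : motive n := by
  induction n using Nat.strong_induction_on with
  | _ n ih =>
    rcases Nat.lt_or_ge n 2 with h2 | h2
    · obtain rfl : n = 1 := by omega
      exact one
    · obtain ⟨he, hU1, hU, hx⟩ := h n h2
      rcases he with h0 | h1
      · exact zero n h2 h0
      · exact parent n h2 h1 hU1 hU hx (ih _ hU hU1)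

theorem Regular.step_nonneg (h : Regular ε U ξ ω) (hZ : ∀ n, 1 ≤ n → 0 ≤ Z n ω) (n : ℕ) :
    0 ≤ step Z ε U ξ ω n := by
  rcases Nat.eq_zero_or_pos n with rfl | hn
  · simp [step]
  · refine h.induction (motive := fun n => 0 ≤ step Z ε U ξ ω n) ?_ ?_ ?_ hn
    · simpa [step_one] using hZ 1 le_rfl
    · intro n h2 h0
      rw [step_of_eq_zero h2 h0]
      exact hZ n (by omega)
    · intro n h2 h1 _ hU hx ih
      rw [step_of_eq_one h2 h1 hU]
      positivity

theorem Regular.walk_nonneg (h : Regular ε U ξ ω) (hZ : ∀ n, 1 ≤ n → 0 ≤ Z n ω) (n : ℕ) :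
    0 ≤ walk Z ε U ξ n ω :=
  Finset.sum_nonneg fun k _ => h.step_nonneg hZ k

theorem Regular.abs_step_le (h : Regular ε U ξ ω) {Z' : ℕ → Ω → ℝ}
    (hZ : ∀ n, 1 ≤ n → |Z n ω| ≤ Z' n ω) (n : ℕ) :
    |step Z ε U ξ ω n| ≤ step Z' ε U ξ ω n := by
  rcases Nat.eq_zero_or_pos n with rfl | hn
  · simp [step]
  · refine h.induction (motive := fun n => |step Z ε U ξ ω n| ≤ step Z' ε U ξ ω n) ?_ ?_ ?_ hn
    · simpa [step_one] using hZ 1 le_rfl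
    · intro n h2 h0
      rw [step_of_eq_zero h2 h0, step_of_eq_zero h2 h0]
      exact hZ n (by omega)
    · intro n h2 h1 _ hU hx ih
      rw [step_of_eq_one h2 h1 hU, step_of_eq_one h2 h1 hU, abs_mul, abs_of_nonneg hx]
      gcongr

theorem Regular.abs_walk_le (h : Regular ε U ξ ω) {Z' : ℕ → Ω → ℝ}
    (hZ : ∀ n, 1 ≤ n → |Z n ω| ≤ Z' n ω) (n : ℕ) :
    |walk Z ε U ξ n ω| ≤ walk Z' ε U ξ n ω :=
  (Finset.abs_sum_le_sum_abs _ _).trans (Finset.sum_le_sum fun k _ => h.abs_step_le hZ k)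

theorem Regular.step_sub (h : Regular ε U ξ ω) {Z' : ℕ → Ω → ℝ} (n : ℕ) :
    step (fun n ω => Z n ω - Z' n ω) ε U ξ ω n = step Z ε U ξ ω n - step Z' ε U ξ ω n := by
  rcases Nat.eq_zero_or_pos n with rfl | hn
  · simp [step]
  · refine h.induction (motive := fun n => step (fun n ω => Z n ω - Z' n ω) ε U ξ ω n
      = step Z ε U ξ ω n - step Z' ε U ξ ω n) ?_ ?_ ?_ hn
    · simp [step_one]
    · intro n h2 h0
      simp only [step_of_eq_zero h2 h0]
    · intro n h2 h1 _ hU hx ih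
      simp only [step_of_eq_one h2 h1 hU, ih, mul_sub]

theorem Regular.walk_sub (h : Regular ε U ξ ω) {Z' : ℕ → Ω → ℝ} (n : ℕ) :
    walk (fun n ω => Z n ω - Z' n ω) ε U ξ n ω = walk Z ε U ξ n ω - walk Z' ε U ξ n ω := by
  simp only [walk, h.step_sub, Finset.sum_sub_distrib]

/-- The spins that select the percolation component rooted at `r`. -/
def indicatorSpin (r n : ℕ) : ℝ := if n = r then 1 else 0

theorem indicatorSpin_nonneg (r n : ℕ) : 0 ≤ indicatorSpin r n := by
  unfold indicatorSpin; split_ifs <;> norm_num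

theorem weight_one : weight ε U ξ ω 1 = 1 := by rw [weight]

theorem weight_of_eq_zero {n : ℕ} (hn : 2 ≤ n) (h0 : ε n ω = 0) : weight ε U ξ ω n = 1 := by
  obtain ⟨k, rfl⟩ : ∃ k, n = k + 2 := ⟨n - 2, by omega⟩
  rw [weight]
  simp [h0]

theorem weight_of_eq_one {n : ℕ} (hn : 2 ≤ n) (h1 : ε n ω = 1) (hU : U n ω < n) :
    weight ε U ξ ω n = ξ n ω * weight ε U ξ ω (U n ω) := by
  obtain ⟨k, rfl⟩ : ∃ k, n = k + 2 := ⟨n - 2, by omega⟩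
  rw [weight]
  simp [h1, hU]

theorem root_of_eq_zero {n : ℕ} (hn : 2 ≤ n) (h0 : ε n ω = 0) : root ε U ω n = n := by
  obtain ⟨k, rfl⟩ : ∃ k, n = k + 2 := ⟨n - 2, by omega⟩
  rw [root]
  simp [h0]

theorem root_of_eq_one {n : ℕ} (hn : 2 ≤ n) (h1 : ε n ω = 1) (hU : U n ω < n) :
    root ε U ω n = root ε U ω (U n ω) := by
  obtain ⟨k, rfl⟩ : ∃ k, n = k + 2 := ⟨n - 2, by omega⟩
  rw [root]
  simp [h1, hU]

/-- Steps and weights obey the same recursion along kept edges, and both restart at a cut edge; only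
the starting value, a spin or 1, differs. -/
theorem Regular.step_eq_weight (h : Regular ε U ξ ω) {n : ℕ} (hn : 1 ≤ n) :
    step Z ε U ξ ω n = Z (root ε U ω n) ω * weight ε U ξ ω n := by
  refine h.induction
    (motive := fun n => step Z ε U ξ ω n = Z (root ε U ω n) ω * weight ε U ξ ω n) ?_ ?_ ?_ hn
  · simp [step_one, root, weight_one]
  · intro n h2 h0
    rw [step_of_eq_zero h2 h0, root_of_eq_zero h2 h0, weight_of_eq_zero h2 h0, mul_one]
  · intro n h2 h1 _ hU hx ih
    rw [step_of_eq_one h2 h1 hU, root_of_eq_one h2 h1 hU, weight_of_eq_one h2 h1 hU, ih]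
    ring

/-- This makes component weights a special case of the walk, so that one convergence theorem and one
moment bound serve both. -/
theorem Regular.subtreeWeight_eq (h : Regular ε U ξ ω) (r n : ℕ) :
    subtreeWeight ε U ξ r n ω = walk (fun n _ => indicatorSpin r n) ε U ξ n ω := by
  rw [subtreeWeight, subtree, Finset.sum_filter, walk]
  refine Finset.sum_congr rfl fun i hi => ?_
  rw [h.step_eq_weight (Finset.mem_Icc.1 hi).1, indicatorSpin]
  split_ifs <;> simp

theorem Regular.subtreeWeight_nonneg (h : Regular ε U ξ ω) (r n : ℕ) :
    0 ≤ subtreeWeight ε U ξ r n ω := by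
  rw [h.subtreeWeight_eq]
  exact h.walk_nonneg (fun n _ => indicatorSpin_nonneg r n) n

/-- The walk driven by spins vanishing outside a finite set, in terms of the components. -/
theorem Regular.sum_mul_subtreeWeight (h : Regular ε U ξ ω) (s : Finset ℕ) (n : ℕ) :
    ∑ r ∈ s, Z r ω * subtreeWeight ε U ξ r n ω
      = walk (fun n ω => if n ∈ s then Z n ω else 0) ε U ξ n ω := by
  simp only [subtreeWeight, subtree, Finset.sum_filter, walk, Finset.mul_sum]
  rw [Finset.sum_comm]
  refine Finset.sum_congr rfl fun i hi => ?_
  rw [h.step_eq_weight (Finset.mem_Icc.1 hi).1]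
  simp

end Pathwise

end RWES

namespace RWES

variable {Ω : Type*}

/-! ### Measurability and independence -/

/-- The `σ`-algebra generated by the noise with indices in `S`. -/
@[reducible]
def sigma (X ε : ℕ → Ω → ℝ) (U : ℕ → Ω → ℕ) (ξ : ℕ → Ω → ℝ) (S : Set (ℕ ⊕ ℕ ⊕ ℕ ⊕ ℕ)) :
    MeasurableSpace Ω :=
  ⨆ i ∈ S, MeasurableSpace.comap (noise X ε U ξ i) inferInstance

/-- The time at which a noise variable is revealed. -/
def time : ℕ ⊕ ℕ ⊕ ℕ ⊕ ℕ → ℕ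
  | .inl i => i + 1
  | .inr (.inl i) => i + 2
  | .inr (.inr (.inl i)) => i + 2
  | .inr (.inr (.inr i)) => i + 2

section Measurability

variable {X ε : ℕ → Ω → ℝ} {U : ℕ → Ω → ℕ} {ξ : ℕ → Ω → ℝ}

theorem sigma_mono {S T : Set (ℕ ⊕ ℕ ⊕ ℕ ⊕ ℕ)} (h : S ⊆ T) :
    sigma X ε U ξ S ≤ sigma X ε U ξ T :=
  biSup_mono h

theorem measurable_noise {S : Set (ℕ ⊕ ℕ ⊕ ℕ ⊕ ℕ)} {i : ℕ ⊕ ℕ ⊕ ℕ ⊕ ℕ} (hi : i ∈ S) :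
    Measurable[sigma X ε U ξ S] (noise X ε U ξ i) := by
  rw [measurable_iff_comap_le]
  exact le_biSup (fun i => MeasurableSpace.comap (noise X ε U ξ i) inferInstance) hi

theorem measurable_spin_sigma {S : Set (ℕ ⊕ ℕ ⊕ ℕ ⊕ ℕ)} {n : ℕ} (hn : 1 ≤ n)
    (hi : Sum.inl (n - 1) ∈ S) : Measurable[sigma X ε U ξ S] (X n) := by
  have := measurable_noise (X := X) (ε := ε) (U := U) (ξ := ξ) hi
  simpa [noise, Nat.sub_add_cancel hn] using this

theorem measurable_bernoulli_sigma {S : Set (ℕ ⊕ ℕ ⊕ ℕ ⊕ ℕ)} {n : ℕ} (hn : 2 ≤ n)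
    (hi : Sum.inr (Sum.inl (n - 2)) ∈ S) : Measurable[sigma X ε U ξ S] (ε n) := by
  have := measurable_noise (X := X) (ε := ε) (U := U) (ξ := ξ) hi
  simpa [noise, Nat.sub_add_cancel hn] using this

theorem measurable_echo_sigma {S : Set (ℕ ⊕ ℕ ⊕ ℕ ⊕ ℕ)} {n : ℕ} (hn : 2 ≤ n)
    (hi : Sum.inr (Sum.inr (Sum.inr (n - 2))) ∈ S) : Measurable[sigma X ε U ξ S] (ξ n) := by
  have := measurable_noise (X := X) (ε := ε) (U := U) (ξ := ξ) hi
  simpa [noise, Nat.sub_add_cancel hn] using this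

theorem measurableSet_sample_sigma {S : Set (ℕ ⊕ ℕ ⊕ ℕ ⊕ ℕ)} {n : ℕ} (hn : 2 ≤ n)
    (hi : Sum.inr (Sum.inr (Sum.inl (n - 2))) ∈ S) (k : ℕ) :
    MeasurableSet[sigma X ε U ξ S] {ω | U n ω = k} := by
  have h := measurable_noise (X := X) (ε := ε) (U := U) (ξ := ξ) hi
  have h' := h (measurableSet_singleton (k : ℝ))
  convert h' using 1
  ext ω
  simp [noise, Nat.sub_add_cancel hn]

/-- The σ-algebra is left arbitrary because two are needed: the history up to a given time, and the
one generated by all the noise except the spins. -/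
theorem measurable_filteredStep_of {mΩ : MeasurableSpace Ω} {τ : ℕ → ℝ → ℝ} {Z : ℕ → Ω → ℝ}
    (hτ : ∀ n, Measurable (τ n)) {N : ℕ} (hZ : ∀ n, 1 ≤ n → n ≤ N → Measurable (Z n))
    (hε : ∀ n, 2 ≤ n → n ≤ N → Measurable (ε n))
    (hU : ∀ n, 2 ≤ n → n ≤ N → ∀ k : ℕ, MeasurableSet {ω | U n ω = k})
    (hξ : ∀ n, 2 ≤ n → n ≤ N → Measurable (ξ n)) {n : ℕ} (hn : n ≤ N) :
    Measurable (fun ω => filteredStep τ Z ε U ξ ω n) := by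
  induction n using Nat.strong_induction_on with
  | _ n ih =>
    match n with
    | 0 => simp [filteredStep]
    | 1 =>
      simp only [filteredStep]
      exact (hτ 1).comp (hZ 1 le_rfl hn)
    | n + 2 =>
      simp only [filteredStep]
      -- The parent is a random index; a finite sum over its possible values reduces the claim to
      -- deterministic indices.
      have key : (fun ω => (if _h : U (n + 2) ω < n + 2 then
          filteredStep τ Z ε U ξ ω (U (n + 2) ω) else 0)) = fun ω => ∑ k ∈ Finset.range (n + 2),
            {ω | U (n + 2) ω = k}.indicator (fun ω => filteredStep τ Z ε U ξ ω k) ω := by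
        funext ω
        by_cases h : U (n + 2) ω < n + 2
        · rw [dif_pos h, Finset.sum_eq_single (U (n + 2) ω)]
          · simp
          · intro b _ hb
            simp [hb.symm]
          · simp [h]
        · rw [dif_neg h, Finset.sum_eq_zero]
          intro k hk
          have : U (n + 2) ω ≠ k := by
            have := Finset.mem_range.1 hk
            omega
          simp [this]
      have hmeas : Measurable (fun ω => (if _h : U (n + 2) ω < n + 2 then
          filteredStep τ Z ε U ξ ω (U (n + 2) ω) else 0)) := by
        rw [key]
        refine Finset.measurable_sum _ fun k hk => ?_
        have hk' := Finset.mem_range.1 hk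
        exact (ih k hk' (by omega)).indicator (hU _ (by omega) hn k)
      have h1 := hε (n + 2) (by omega) hn
      have h2 := hξ (n + 2) (by omega) hn
      have h3 := hZ (n + 2) (by omega) hn
      exact (hτ _).comp ((((measurable_const.sub h1).mul h3)).add ((h1.mul h2).mul hmeas))

end Measurability

variable [MeasurableSpace Ω] {P : Measure Ω} {p : ℝ} {νX νξ : Measure ℝ}
  {X ε : ℕ → Ω → ℝ} {U : ℕ → Ω → ℕ} {ξ : ℕ → Ω → ℝ}

namespace IsInput

theorem measurable_noise_ambient (hin : IsInput P p νX νξ X ε U ξ) (i : ℕ ⊕ ℕ ⊕ ℕ ⊕ ℕ) :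
    Measurable (noise X ε U ξ i) := by
  rcases i with i | i | i | i
  · exact hin.measurable_spin _ (by omega)
  · exact hin.measurable_bernoulli _ (by omega)
  · exact measurable_from_top.comp (hin.measurable_sample (i + 2) (by omega))
  · exact hin.measurable_echo _ (by omega)

theorem sigma_le (hin : IsInput P p νX νξ X ε U ξ) (S : Set (ℕ ⊕ ℕ ⊕ ℕ ⊕ ℕ)) :
    sigma X ε U ξ S ≤ ‹MeasurableSpace Ω› :=
  iSup₂_le fun i _ => (hin.measurable_noise_ambient i).comap_le

theorem indep_sigma (hin : IsInput P p νX νξ X ε U ξ) {S T : Set (ℕ ⊕ ℕ ⊕ ℕ ⊕ ℕ)}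
    (h : Disjoint S T) : Indep (sigma X ε U ξ S) (sigma X ε U ξ T) P :=
  indep_iSup_of_disjoint (fun i => (hin.measurable_noise_ambient i).comap_le) hin.indep h

/-- The information available at time `n`. -/
def history (hin : IsInput P p νX νξ X ε U ξ) : Filtration ℕ ‹MeasurableSpace Ω› where
  seq n := sigma X ε U ξ {i | time i ≤ n}
  mono' _ _ h := sigma_mono fun _ hi => le_trans (α := ℕ) hi h
  le' _ := hin.sigma_le _

theorem measurable_filteredStep (hin : IsInput P p νX νξ X ε U ξ) {τ : ℕ → ℝ → ℝ}
    (hτ : ∀ n, Measurable (τ n)) {g : ℕ → ℝ → ℝ} (hg : ∀ n, Measurable (g n)) {n N : ℕ}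
    (hn : n ≤ N) : Measurable[hin.history N]
      (fun ω => filteredStep τ (fun n ω => g n (X n ω)) ε U ξ ω n) := by
  refine @measurable_filteredStep_of Ω ε U ξ (hin.history N) τ _ hτ N ?_ ?_ ?_ ?_ n hn
  · intro n h1 hN
    exact (hg n).comp (measurable_spin_sigma h1 (by simp [time]; omega))
  · intro n h1 hN
    exact measurable_bernoulli_sigma h1 (by simp [time]; omega)
  · intro n h1 hN k
    exact measurableSet_sample_sigma h1 (by simp [time]; omega) k
  · intro n h1 hN
    exact measurable_echo_sigma h1 (by simp [time]; omega)

theorem measurable_step (hin : IsInput P p νX νξ X ε U ξ) {g : ℕ → ℝ → ℝ}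
    (hg : ∀ n, Measurable (g n)) {n N : ℕ} (hn : n ≤ N) : Measurable[hin.history N]
      (fun ω => step (fun n ω => g n (X n ω)) ε U ξ ω n) := by
  simp only [step_eq_filteredStep]
  exact hin.measurable_filteredStep (fun _ => measurable_id) hg hn

theorem measurable_walk (hin : IsInput P p νX νξ X ε U ξ) {g : ℕ → ℝ → ℝ}
    (hg : ∀ n, Measurable (g n)) {n N : ℕ} (hn : n ≤ N) : Measurable[hin.history N]
      (walk (fun n ω => g n (X n ω)) ε U ξ n) := by
  unfold walk
  exact Finset.measurable_sum _ fun k hk =>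
    hin.measurable_step hg ((Finset.mem_Icc.1 hk).2.trans hn)

/-- Expectation of a function of two independent variables. -/
theorem lintegral_comp_pair [IsProbabilityMeasure P] (hin : IsInput P p νX νξ X ε U ξ)
    {S T : Set (ℕ ⊕ ℕ ⊕ ℕ ⊕ ℕ)} (h : Disjoint S T) {E : Type*} [MeasurableSpace E]
    {V : Ω → E} (hV : Measurable[sigma X ε U ξ S] V) {ζ : Ω → ℝ}
    (hζ : Measurable[sigma X ε U ξ T] ζ) {F : E × ℝ → ℝ≥0∞} (hF : Measurable F) :
    ∫⁻ ω, F (V ω, ζ ω) ∂P = ∫⁻ ω, ∫⁻ y, F (V ω, y) ∂(P.map ζ) ∂P := by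
  have hV' : Measurable V := hV.mono (hin.sigma_le S) le_rfl
  have hζ' : Measurable ζ := hζ.mono (hin.sigma_le T) le_rfl
  have hind : IndepFun V ζ P :=
    indep_of_indep_of_le_left (indep_of_indep_of_le_right (hin.indep_sigma h) hζ.comap_le)
      hV.comap_le
  have := Measure.isProbabilityMeasure_map (μ := P) hζ'.aemeasurable
  have := Measure.isProbabilityMeasure_map (μ := P) hV'.aemeasurable
  rw [← lintegral_map (f := F) (g := fun ω => (V ω, ζ ω)) hF (hV'.prodMk hζ'),
    (indepFun_iff_map_prod_eq_prod_map_map hV'.aemeasurable hζ'.aemeasurable).1 hind,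
    lintegral_prod _ hF.aemeasurable, lintegral_map hF.lintegral_prod_right' hV']

theorem setLIntegral_eq_mul (hin : IsInput P p νX νξ X ε U ξ)
    {S T : Set (ℕ ⊕ ℕ ⊕ ℕ ⊕ ℕ)} (h : Disjoint S T) {A : Set Ω}
    (hA : MeasurableSet[sigma X ε U ξ T] A) {F : Ω → ℝ≥0∞} (hF : Measurable[sigma X ε U ξ S] F) :
    ∫⁻ ω in A, F ω ∂P = P A * ∫⁻ ω, F ω ∂P := by
  have hA' := hin.sigma_le T _ hA
  have := lintegral_mul_eq_lintegral_mul_lintegral_of_independent_measurableSpace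
    (hin.sigma_le T) (hin.sigma_le S) (hin.indep_sigma h.symm)
    ((measurable_const (a := (1 : ℝ≥0∞))).indicator hA) hF
  rw [lintegral_indicator_const hA', one_mul] at this
  rw [← lintegral_indicator hA', ← this]
  refine lintegral_congr fun ω => ?_
  by_cases hω : ω ∈ A <;> simp [hω]

theorem measure_bernoulli_sample (hin : IsInput P p νX νξ X ε U ξ) {n k : ℕ} (hk : 1 ≤ k)
    (hkn : k ≤ n) : P {ω | ε (n + 1) ω = 1 ∧ U (n + 1) ω = k} = ENNReal.ofReal (p / n) := by
  have hn : 2 ≤ n + 1 := by omega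
  have hind : Indep (sigma X ε U ξ {Sum.inr (Sum.inl (n + 1 - 2))})
      (sigma X ε U ξ {Sum.inr (Sum.inr (Sum.inl (n + 1 - 2)))}) P := hin.indep_sigma (by simp)
  have h1 : MeasurableSet[sigma X ε U ξ {Sum.inr (Sum.inl (n + 1 - 2))}] {ω | ε (n + 1) ω = 1} :=
    (measurable_bernoulli_sigma hn (by simp)) (measurableSet_singleton 1)
  have h2 := measurableSet_sample_sigma (X := X) (ε := ε) (U := U) (ξ := ξ)
    (S := {Sum.inr (Sum.inr (Sum.inl (n + 1 - 2)))}) hn rfl k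
  have := (Indep_iff _ _ P).1 hind _ _ h1 h2
  have hU := hin.law_sample (n + 1) hn k (by simp; omega)
  rw [Set.ofPred_and, this, (hin.law_bernoulli _ hn).1, hU, ← ENNReal.ofReal_mul']
  · congr 1
    push_cast
    ring
  · push_cast
    simp

/-- The laws of `ε n` and `U n` are given only through point masses. These add up to one, so the
remaining values form a null set. -/
theorem ae_regular [IsProbabilityMeasure P] (hp0 : 0 < p) (hp1 : p < 1)
    (hin : IsInput P p νX νξ X ε U ξ) (hξ : ∀ᵐ x ∂νξ, 0 ≤ x) :
    ∀ᵐ ω ∂P, Regular ε U ξ ω := by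
  refine ae_all_iff.2 fun n => ?_
  by_cases hn : 2 ≤ n
  swap
  · exact ae_of_all _ fun ω h => absurd h hn
  have hε : ∀ᵐ ω ∂P, ε n ω = 0 ∨ ε n ω = 1 := by
    have hm := hin.measurable_bernoulli n hn
    have hm0 : MeasurableSet {ω | ε n ω = 0} := hm (measurableSet_singleton 0)
    have hm1 : MeasurableSet {ω | ε n ω = 1} := hm (measurableSet_singleton 1)
    refine (prob_compl_eq_zero_iff (hm0.union hm1)).2 ?_
    rw [measure_union _ hm1, (hin.law_bernoulli n hn).1, (hin.law_bernoulli n hn).2,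
      ← ENNReal.ofReal_add (by linarith) hp0.le]
    · simp
    · rw [Set.disjoint_left]
      intro ω h0 h1
      simp only [Set.mem_ofPred_eq] at h0 h1
      rw [h0] at h1
      norm_num at h1
  have hU : ∀ᵐ ω ∂P, U n ω ∈ Finset.Icc 1 (n - 1) := by
    have hm := hin.measurable_sample n hn
    have hms : ∀ k, MeasurableSet {ω | U n ω = k} := fun k => hm (measurableSet_singleton k)
    have hset : {ω | U n ω ∈ Finset.Icc 1 (n - 1)}
        = ⋃ k ∈ Finset.Icc 1 (n - 1), {ω | U n ω = k} := by
      ext ω; simp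
    refine (prob_compl_eq_zero_iff (s := {ω | U n ω ∈ Finset.Icc 1 (n - 1)})
      (hm (Set.to_countable _).measurableSet)).2 ?_
    rw [hset, measure_biUnion_finset _ fun k _ => hms k, Finset.sum_congr rfl
      (hin.law_sample n hn), Finset.sum_const, Nat.card_Icc, nsmul_eq_mul]
    · have : ((n - 1 + 1 - 1 : ℕ) : ℝ≥0∞) = ENNReal.ofReal ((n : ℝ) - 1) := by
        rw [show n - 1 + 1 - 1 = n - 1 by omega, ← ENNReal.ofReal_natCast,
          Nat.cast_sub (by omega)]
        simp
      have h1 : (0 : ℝ) < (n : ℝ) - 1 := by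
        have : (2 : ℝ) ≤ n := by exact_mod_cast hn
        linarith
      rw [this, ← ENNReal.ofReal_mul h1.le, mul_one_div_cancel h1.ne', ENNReal.ofReal_one]
    · intro k _ l _ hkl
      rw [Function.onFun, Set.disjoint_left]
      intro ω h0 h1
      exact hkl (h0.symm.trans h1)
  have hx : ∀ᵐ ω ∂P, 0 ≤ ξ n ω := by
    rw [← hin.law_echo n hn] at hξ
    exact ae_of_ae_map (hin.measurable_echo n hn).aemeasurable hξ
  filter_upwards [hε, hU, hx] with ω h1 h2 h3 _
  rw [Finset.mem_Icc] at h2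
  exact ⟨h1, h2.1, by omega, h3⟩

/-- The one-step evolution of the recursion. -/
theorem lintegral_filteredStep_succ [IsProbabilityMeasure P] (hp0 : 0 < p) (hp1 : p < 1)
    (hin : IsInput P p νX νξ X ε U ξ) (hξ : ∀ᵐ x ∂νξ, 0 ≤ x) {τ : ℕ → ℝ → ℝ}
    (hτ : ∀ n, Measurable (τ n)) {g : ℕ → ℝ → ℝ} (hg : ∀ n, Measurable (g n)) {n : ℕ}
    (hn : 1 ≤ n) {E : Type*} [MeasurableSpace E] {V : Ω → E} (hV : Measurable[hin.history n] V)
    {F : E × ℝ → ℝ≥0∞} (hF : Measurable F) :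
    ∫⁻ ω, F (V ω, filteredStep τ (fun n ω => g n (X n ω)) ε U ξ ω (n + 1)) ∂P =
      ENNReal.ofReal (1 - p) * ∫⁻ ω, ∫⁻ x, F (V ω, τ (n + 1) (g (n + 1) x)) ∂νX ∂P +
      ENNReal.ofReal (p / n) * ∑ k ∈ Finset.Icc 1 n, ∫⁻ ω, ∫⁻ y,
        F (V ω, τ (n + 1) (y * filteredStep τ (fun n ω => g n (X n ω)) ε U ξ ω k)) ∂νξ ∂P := by
  have h2 : 2 ≤ n + 1 := by omega
  -- Almost surely exactly one of n + 1 disjoint events occurs: a cut edge, or a kept edge to one of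
  -- the vertices k ≤ n.
  have hdecomp : ∀ᵐ ω ∂P, F (V ω, filteredStep τ (fun n ω => g n (X n ω)) ε U ξ ω (n + 1)) =
      {ω | ε (n + 1) ω = 0}.indicator (fun ω => F (V ω, τ (n + 1) (g (n + 1) (X (n + 1) ω)))) ω +
      ∑ k ∈ Finset.Icc 1 n, {ω | ε (n + 1) ω = 1 ∧ U (n + 1) ω = k}.indicator (fun ω =>
        F (V ω, τ (n + 1)
          (ξ (n + 1) ω * filteredStep τ (fun n ω => g n (X n ω)) ε U ξ ω k))) ω := by
    filter_upwards [hin.ae_regular hp0 hp1 hξ] with ω hω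
    obtain ⟨hε, hU1, hU, -⟩ := hω (n + 1) h2
    rcases hε with h0 | h1
    · rw [filteredStep_of_eq_zero h2 h0, Finset.sum_eq_zero, add_zero]
      · simp [h0]
      · intro k _
        simp [h0]
    · rw [filteredStep_of_eq_one h2 h1 hU, Finset.sum_eq_single (U (n + 1) ω)]
      · simp [h1]
      · intro k _ hk
        simp [hk.symm]
      · intro hk
        simp at hk
        omega
  have hV' : Measurable V := hV.mono (hin.sigma_le _) le_rfl
  have hYm : ∀ k ∈ Finset.Icc 1 n, Measurable[hin.history n]
      (fun ω => filteredStep τ (fun n ω => g n (X n ω)) ε U ξ ω k) := fun k hk =>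
    hin.measurable_filteredStep hτ hg (Finset.mem_Icc.1 hk).2
  have hYm' : ∀ k ∈ Finset.Icc 1 n, Measurable
      (fun ω => filteredStep τ (fun n ω => g n (X n ω)) ε U ξ ω k) := fun k hk =>
    (hYm k hk).mono (hin.sigma_le _) le_rfl
  have hm0 : MeasurableSet {ω | ε (n + 1) ω = 0} :=
    hin.measurable_bernoulli _ h2 (measurableSet_singleton 0)
  have hm1 : ∀ k, MeasurableSet {ω | ε (n + 1) ω = 1 ∧ U (n + 1) ω = k} := fun k =>
    (hin.measurable_bernoulli _ h2 (measurableSet_singleton 1)).inter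
      (hin.measurable_sample _ h2 (measurableSet_singleton k))
  rw [lintegral_congr_ae hdecomp, lintegral_add_left, lintegral_finsetSum', Finset.mul_sum]
  rotate_left
  · intro k hk
    exact ((hF.comp (hV'.prodMk ((hτ _).comp ((hin.measurable_echo _ h2).mul
      (hYm' k hk))))).indicator (hm1 k)).aemeasurable
  · exact (hF.comp (hV'.prodMk ((hτ _).comp ((hg _).comp
      (hin.measurable_spin _ (by omega)))))).indicator hm0
  congr 1
  · rw [lintegral_indicator hm0, hin.setLIntegral_eq_mul
      (S := {i | time i ≤ n} ∪ {Sum.inl (n + 1 - 1)}) (T := {Sum.inr (Sum.inl (n + 1 - 2))}),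
      (hin.law_bernoulli _ h2).2]
    · congr 1
      rw [hin.lintegral_comp_pair (S := {i | time i ≤ n}) (T := {Sum.inl (n + 1 - 1)})
        (F := fun z => F (z.1, τ (n + 1) (g (n + 1) z.2))) _ hV
        (measurable_spin_sigma (n := n + 1) (by omega) (by simp))]
      · rw [hin.law_spin _ (by omega)]
      · exact hF.comp (measurable_fst.prodMk ((hτ _).comp ((hg _).comp measurable_snd)))
      · simp [time]
    · simp [time]; omega
    · exact (measurable_bernoulli_sigma h2 (by simp)) (measurableSet_singleton 0)
    · exact hF.comp ((hV.mono (sigma_mono Set.subset_union_left) le_rfl).prodMk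
        ((hτ _).comp ((hg _).comp (measurable_spin_sigma (by omega) (by simp)))))
  · refine Finset.sum_congr rfl fun k hk => ?_
    -- The event concerns only `ε` and `U` at time n + 1, while the integrand uses the past and the
    -- new echo. Independence first splits off p / n, then integrates out the echo.
    rw [lintegral_indicator (hm1 k), hin.setLIntegral_eq_mul
      (S := {i | time i ≤ n} ∪ {Sum.inr (Sum.inr (Sum.inr (n + 1 - 2)))})
      (T := {Sum.inr (Sum.inl (n + 1 - 2)), Sum.inr (Sum.inr (Sum.inl (n + 1 - 2)))}),
      hin.measure_bernoulli_sample (Finset.mem_Icc.1 hk).1 (Finset.mem_Icc.1 hk).2]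
    · congr 1
      rw [hin.lintegral_comp_pair (S := {i | time i ≤ n})
        (T := {Sum.inr (Sum.inr (Sum.inr (n + 1 - 2)))})
        (F := fun z : (E × ℝ) × ℝ => F (z.1.1, τ (n + 1) (z.2 * z.1.2))) _
        (hV.prodMk (hYm k hk)) (measurable_echo_sigma (n := n + 1) h2 (by simp))]
      · rw [hin.law_echo _ h2]
      · exact hF.comp ((measurable_fst.comp measurable_fst).prodMk ((hτ _).comp
          (measurable_snd.mul (measurable_snd.comp measurable_fst))))
      · simp [time]; omega
    · simp [time]; omega
    · exact MeasurableSet.inter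
        ((measurable_bernoulli_sigma h2 (by simp)) (measurableSet_singleton 1))
        (measurableSet_sample_sigma h2 (by simp) k)
    · exact hF.comp ((hV.mono (sigma_mono Set.subset_union_left) le_rfl).prodMk ((hτ _).comp
        ((measurable_echo_sigma h2 (by simp)).mul
          ((hYm k hk).mono (sigma_mono Set.subset_union_left) le_rfl))))

end IsInput

end RWES

namespace RWES

/-! ### The growth sequence -/

/-- The product `∏_{k < n} (1 + κ / k)`, which grows like `n ^ κ`. -/
noncomputable def growth (κ : ℝ) (n : ℕ) : ℝ := ∏ k ∈ Finset.Ico 1 n, (1 + κ / k)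

section Growth

variable {κ : ℝ}

theorem growth_one : growth κ 1 = 1 := by simp [growth]

theorem growth_zero : growth κ 0 = 1 := by simp [growth]

theorem growth_succ {n : ℕ} (hn : 1 ≤ n) : growth κ (n + 1) = growth κ n * (1 + κ / n) := by
  rw [growth, Finset.prod_Ico_succ_top hn, growth]

theorem growth_pos (hκ : 0 ≤ κ) (n : ℕ) : 0 < growth κ n :=
  Finset.prod_pos fun k _ => by positivity

theorem growth_le_succ (hκ : 0 ≤ κ) (n : ℕ) : growth κ n ≤ growth κ (n + 1) := by
  rcases Nat.eq_zero_or_pos n with rfl | hn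
  · rw [growth_zero, growth_one]
  · rw [growth_succ hn]
    refine le_mul_of_one_le_right (growth_pos hκ n).le ?_
    have : 0 ≤ κ / n := by positivity
    linarith

theorem growth_mono (hκ : 0 ≤ κ) : Monotone (growth κ) :=
  monotone_nat_of_le_succ (growth_le_succ hκ)

/-- After multiplication by n! and κ the product becomes the denominator of Euler's sequence for
Γ(κ). This gives the exact constant 1 / Γ(κ + 1) in the asymptotics. -/
theorem growth_succ_eq_gammaSeq (hκ : 0 < κ) {n : ℕ} (hn : 1 ≤ n) :
    growth κ (n + 1) / (n : ℝ) ^ κ = (κ * Real.GammaSeq κ n)⁻¹ := by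
  have hprod : growth κ (n + 1) * (n.factorial : ℝ) * κ
      = ∏ j ∈ Finset.range (n + 1), (κ + j) := by
    clear hn
    induction n with
    | zero => simp [growth_one]
    | succ n ih =>
      rw [Finset.prod_range_succ, ← ih, growth_succ (by omega), Nat.factorial_succ]
      push_cast
      have : (n : ℝ) + 1 ≠ 0 := by positivity
      field_simp
      ring
  have hpos : (0 : ℝ) < (n : ℝ) ^ κ := by positivity
  have hf : (n.factorial : ℝ) ≠ 0 := by positivity
  have hg := (growth_pos hκ.le (n + 1)).ne'
  rw [Real.GammaSeq, ← hprod]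
  field_simp

theorem tendsto_growth_div (hκ : 0 < κ) :
    Tendsto (fun n : ℕ => growth κ n / (n : ℝ) ^ κ) atTop (𝓝 (Real.Gamma (κ + 1))⁻¹) := by
  have h1 : Tendsto (fun n : ℕ => (κ * Real.GammaSeq κ n)⁻¹) atTop
      (𝓝 (Real.Gamma (κ + 1))⁻¹) := by
    rw [Real.Gamma_add_one hκ.ne']
    exact ((Real.GammaSeq_tendsto_Gamma κ).const_mul κ).inv₀
      (mul_pos hκ (Real.Gamma_pos_of_pos hκ)).ne'
  have h2 : Tendsto (fun n : ℕ => 1 + κ / (n : ℝ)) atTop (𝓝 1) := by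
    simpa using (tendsto_const_div_atTop_nhds_zero_nat κ).const_add 1
  have h3 := h1.div h2 one_ne_zero
  rw [div_one] at h3
  refine h3.congr' ?_
  filter_upwards [eventually_ge_atTop 1] with n hn
  rw [Pi.div_apply, ← growth_succ_eq_gammaSeq hκ hn, growth_succ hn]
  have : (1 + κ / (n : ℝ)) ≠ 0 := by positivity
  field_simp

theorem exists_growth_le (hκ : 0 < κ) :
    ∃ C, 0 < C ∧ ∀ n : ℕ, 1 ≤ n → growth κ n ≤ C * (n : ℝ) ^ κ := by
  obtain ⟨C, hC⟩ := (tendsto_growth_div hκ).bddAbove_range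
  refine ⟨max C 1, by positivity, fun n hn => ?_⟩
  have h := hC ⟨n, rfl⟩
  have hpos : (0 : ℝ) < (n : ℝ) ^ κ := by positivity
  rw [div_le_iff₀ hpos] at h
  exact h.trans (by gcongr; exact le_max_left _ _)

theorem exists_le_growth (hκ : 0 < κ) :
    ∃ C, 0 < C ∧ ∀ n : ℕ, 1 ≤ n → (n : ℝ) ^ κ ≤ C * growth κ n := by
  obtain ⟨C, hC⟩ := ((tendsto_growth_div hκ).inv₀
    (inv_pos.2 (Real.Gamma_pos_of_pos (by linarith))).ne').bddAbove_range
  refine ⟨max C 1, by positivity, fun n hn => ?_⟩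
  have h := hC ⟨n, rfl⟩
  have hg := growth_pos hκ.le n
  simp only [inv_div] at h
  rw [div_le_iff₀ hg] at h
  exact h.trans (by gcongr; exact le_max_left _ _)

/-- Applied with κ = p m₁, this is where supercriticality acts: the influences of successive spins
on the normalised walk are summable. -/
theorem summable_inv_growth (hκ : 1 < κ) : Summable fun n : ℕ => (growth κ n)⁻¹ := by
  obtain ⟨C, hC0, hC⟩ := exists_le_growth (by linarith : 0 < κ)
  refine Summable.of_norm_bounded_eventually_nat (g := fun n : ℕ => C * ((n : ℝ) ^ κ)⁻¹)
    ((Real.summable_nat_rpow_inv.2 hκ).mul_left C) ?_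
  filter_upwards [eventually_ge_atTop 1] with n hn
  have hg := growth_pos (by linarith : 0 ≤ κ) n
  have hpos : (0 : ℝ) < (n : ℝ) ^ κ := by positivity
  rw [Real.norm_of_nonneg (by positivity), ← div_eq_mul_inv, inv_le_comm₀ hg (by positivity),
    inv_div, div_le_iff₀ hC0, mul_comm]
  exact hC n hn

/-- Discrete Gronwall: v n / growth κ n rises by at most d n / growth κ (n + 1) per step. Extended
values of v allow its use on moments not yet known to be finite. -/
theorem growth_bound (hκ : 0 ≤ κ) {v : ℕ → ℝ≥0∞} (hv : v 1 ≠ ⊤) {d : ℕ → ℝ}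
    (hd : ∀ n, 0 ≤ d n) (hsum : Summable fun n => d n / growth κ (n + 1))
    (hrec : ∀ n, 1 ≤ n → v (n + 1) ≤ ENNReal.ofReal (1 + κ / n) * v n + ENNReal.ofReal (d n)) :
    ∃ C, 0 ≤ C ∧ ∀ n, 1 ≤ n → v n ≤ ENNReal.ofReal (C * growth κ n) := by
  have hnn : ∀ n, 0 ≤ d n / growth κ (n + 1) := fun n => div_nonneg (hd n) (growth_pos hκ _).le
  have key : ∀ n, 1 ≤ n → v n ≤ ENNReal.ofReal
      (((v 1).toReal + ∑ k ∈ Finset.range n, d k / growth κ (k + 1)) * growth κ n) := by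
    intro n hn
    induction n, hn using Nat.le_induction with
    | base =>
      rw [growth_one, mul_one]
      calc v 1 = ENNReal.ofReal (v 1).toReal := (ENNReal.ofReal_toReal hv).symm
        _ ≤ _ := ENNReal.ofReal_le_ofReal (le_add_of_nonneg_right
            (Finset.sum_nonneg fun k _ => hnn k))
    | succ n hn ih =>
      refine (hrec n hn).trans ?_
      have hs := Finset.sum_nonneg fun k (_ : k ∈ Finset.range n) => hnn k
      have hg := growth_pos hκ n
      refine (add_le_add_left (mul_le_mul_right ih _) _).trans ?_
      rw [← ENNReal.ofReal_mul (by positivity), ← ENNReal.ofReal_add (by positivity) (hd n)]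
      refine ENNReal.ofReal_le_ofReal (le_of_eq ?_)
      rw [Finset.sum_range_succ, ← add_assoc, add_mul _ _ (growth κ (n + 1)),
        div_mul_cancel₀ _ (growth_pos hκ _).ne', growth_succ hn]
      ring
  refine ⟨(v 1).toReal + ∑' k, d k / growth κ (k + 1),
    add_nonneg ENNReal.toReal_nonneg (tsum_nonneg hnn), fun n hn => (key n hn).trans ?_⟩
  refine ENNReal.ofReal_le_ofReal (mul_le_mul_of_nonneg_right ?_ (growth_pos hκ n).le)
  exact add_le_add_right (hsum.sum_le_tsum _ fun k _ => hnn k) _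

end Growth

end RWES

namespace RWES

/-! ### First moments -/

variable {Ω : Type*} [MeasurableSpace Ω]

/-- The standing assumptions on the model. -/
structure Model (P : Measure Ω) (p : ℝ) (νX νξ : Measure ℝ)
    (X ε : ℕ → Ω → ℝ) (U : ℕ → Ω → ℕ) (ξ : ℕ → Ω → ℝ) : Prop extends
    IsInput P p νX νξ X ε U ξ where
  p_pos : 0 < p
  p_lt_one : p < 1
  echo_nonneg : ∀ᵐ x ∂νξ, 0 ≤ x
  echo_integrable : Integrable (fun x : ℝ => x) νξ
  spin_integrable : Integrable (fun x : ℝ => x) νX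
  super : 1 < p * ∫ x, x ∂νξ

set_option linter.unusedSectionVars false

variable {P : Measure Ω} [IsProbabilityMeasure P] {p : ℝ} {νX νξ : Measure ℝ}
  {X ε : ℕ → Ω → ℝ} {U : ℕ → Ω → ℕ} {ξ : ℕ → Ω → ℝ}

namespace Model

theorem regular (M : Model P p νX νξ X ε U ξ) : ∀ᵐ ω ∂P, Regular ε U ξ ω :=
  M.ae_regular M.p_pos M.p_lt_one M.echo_nonneg

theorem exponent_nonneg (M : Model P p νX νξ X ε U ξ) : 0 ≤ p * ∫ x, x ∂νξ := by
  linarith [M.super]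

theorem isProbabilityMeasure_spin (M : Model P p νX νξ X ε U ξ) : IsProbabilityMeasure νX := by
  rw [← M.law_spin 1 le_rfl]
  exact Measure.isProbabilityMeasure_map (M.measurable_spin 1 le_rfl).aemeasurable

theorem isProbabilityMeasure_echo (M : Model P p νX νξ X ε U ξ) : IsProbabilityMeasure νξ := by
  rw [← M.law_echo 2 le_rfl]
  exact Measure.isProbabilityMeasure_map (M.measurable_echo 2 le_rfl).aemeasurable

theorem lintegral_echo (M : Model P p νX νξ X ε U ξ) :
    ∫⁻ x, ENNReal.ofReal x ∂νξ = ENNReal.ofReal (∫ x, x ∂νξ) :=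
  (ofReal_integral_eq_lintegral_ofReal M.echo_integrable M.echo_nonneg).symm

theorem measurable_walk_ambient (M : Model P p νX νξ X ε U ξ) {g : ℕ → ℝ → ℝ}
    (hg : ∀ n, Measurable (g n)) (n : ℕ) : Measurable (walk (fun n ω => g n (X n ω)) ε U ξ n) :=
  (M.measurable_walk hg le_rfl).mono (M.sigma_le _) le_rfl

theorem measurable_step_ambient (M : Model P p νX νξ X ε U ξ) {g : ℕ → ℝ → ℝ}
    (hg : ∀ n, Measurable (g n)) (n : ℕ) :
    Measurable (fun ω => step (fun n ω => g n (X n ω)) ε U ξ ω n) :=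
  (M.measurable_step hg le_rfl).mono (M.sigma_le _) le_rfl

/-- A conditional expectation in weak form, with a weight V known at time n. The choices used later
are V = 1 for means, an indicator for the submartingale property, and a power of the walk for higher
moments. -/
theorem lintegral_mul_step_succ (M : Model P p νX νξ X ε U ξ) {g : ℕ → ℝ → ℝ}
    (hg : ∀ n, Measurable (g n)) (hg0 : ∀ n x, 0 ≤ g n x) {n : ℕ} (hn : 1 ≤ n) {V : Ω → ℝ≥0∞}
    (hV : Measurable[M.history n] V) :
    ∫⁻ ω, V ω * ENNReal.ofReal (step (fun n ω => g n (X n ω)) ε U ξ ω (n + 1)) ∂P =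
      ENNReal.ofReal (1 - p) * ((∫⁻ ω, V ω ∂P) * ∫⁻ x, ENNReal.ofReal (g (n + 1) x) ∂νX) +
      ENNReal.ofReal (p * (∫ x, x ∂νξ) / n) *
        ∫⁻ ω, V ω * ENNReal.ofReal (walk (fun n ω => g n (X n ω)) ε U ξ n ω) ∂P := by
  have hV' : Measurable V := hV.mono (M.sigma_le _) le_rfl
  have hF : Measurable (fun z : ℝ≥0∞ × ℝ => z.1 * ENNReal.ofReal z.2) := by fun_prop
  have h := M.lintegral_filteredStep_succ M.p_pos M.p_lt_one M.echo_nonneg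
    (τ := fun _ x => x) (fun _ => measurable_id) hg hn hV hF
  simp only [← step_eq_filteredStep] at h
  rw [h]
  congr 1
  · congr 1
    rw [← lintegral_mul_const _ hV']
    refine lintegral_congr fun ω => ?_
    exact lintegral_const_mul _ (hg _).ennreal_ofReal
  · have hp := M.p_pos
    have hYm := M.measurable_step_ambient hg
    rw [show p * (∫ x, x ∂νξ) / n = p / n * ∫ x, x ∂νξ by ring,
      ENNReal.ofReal_mul (by positivity), mul_assoc]
    congr 1
    have h1 : ∀ᵐ ω ∂P, V ω * ENNReal.ofReal (walk (fun n ω => g n (X n ω)) ε U ξ n ω) =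
        ∑ k ∈ Finset.Icc 1 n,
          V ω * ENNReal.ofReal (step (fun n ω => g n (X n ω)) ε U ξ ω k) := by
      filter_upwards [M.regular] with ω hω
      rw [walk, ENNReal.ofReal_sum_of_nonneg fun k _ => hω.step_nonneg (fun n _ => hg0 n _) k,
        Finset.mul_sum]
    have hm : ∀ k, Measurable fun ω =>
        V ω * ENNReal.ofReal (step (fun n ω => g n (X n ω)) ε U ξ ω k) := fun k =>
      hV'.mul (hYm k).ennreal_ofReal
    rw [lintegral_congr_ae h1, lintegral_finsetSum _ fun k _ => hm k, Finset.mul_sum]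
    refine Finset.sum_congr rfl fun k _ => ?_
    rw [← lintegral_const_mul _ (hm k)]
    refine lintegral_congr_ae ?_
    filter_upwards [M.regular] with ω hω
    have hY := hω.step_nonneg (Z := fun n ω => g n (X n ω)) (fun n _ => hg0 n _) k
    simp only [ENNReal.ofReal_mul' hY]
    rw [lintegral_const_mul _ (by fun_prop), lintegral_mul_const _ (by fun_prop),
      M.lintegral_echo]
    ring

theorem lintegral_mul_walk_succ (M : Model P p νX νξ X ε U ξ) {g : ℕ → ℝ → ℝ}
    (hg : ∀ n, Measurable (g n)) (hg0 : ∀ n x, 0 ≤ g n x) {n : ℕ} (hn : 1 ≤ n) {V : Ω → ℝ≥0∞}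
    (hV : Measurable[M.history n] V) :
    ∫⁻ ω, V ω * ENNReal.ofReal (walk (fun n ω => g n (X n ω)) ε U ξ (n + 1) ω) ∂P =
      ENNReal.ofReal (1 - p) * ((∫⁻ ω, V ω ∂P) * ∫⁻ x, ENNReal.ofReal (g (n + 1) x) ∂νX) +
      ENNReal.ofReal (1 + p * (∫ x, x ∂νξ) / n) *
        ∫⁻ ω, V ω * ENNReal.ofReal (walk (fun n ω => g n (X n ω)) ε U ξ n ω) ∂P := by
  have hV' : Measurable V := hV.mono (M.sigma_le _) le_rfl
  have h1 : ∀ᵐ ω ∂P, V ω * ENNReal.ofReal (walk (fun n ω => g n (X n ω)) ε U ξ (n + 1) ω) =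
      V ω * ENNReal.ofReal (walk (fun n ω => g n (X n ω)) ε U ξ n ω) +
      V ω * ENNReal.ofReal (step (fun n ω => g n (X n ω)) ε U ξ ω (n + 1)) := by
    filter_upwards [M.regular] with ω hω
    rw [walk, Finset.sum_Icc_succ_top (by omega), ENNReal.ofReal_add, mul_add, walk]
    · exact hω.walk_nonneg (Z := fun n ω => g n (X n ω)) (fun n _ => hg0 n _) n
    · exact hω.step_nonneg (Z := fun n ω => g n (X n ω)) (fun n _ => hg0 n _) _
  have ha := M.exponent_nonneg
  have hm : Measurable fun ω =>
      V ω * ENNReal.ofReal (walk (fun n ω => g n (X n ω)) ε U ξ n ω) :=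
    hV'.mul (M.measurable_walk_ambient hg n).ennreal_ofReal
  rw [lintegral_congr_ae h1, lintegral_add_left hm,
    M.lintegral_mul_step_succ hg hg0 hn hV, ENNReal.ofReal_add zero_le_one (by positivity),
    ENNReal.ofReal_one]
  ring

/-- A spin created at time k is amplified in mean by growth n / growth k up to time n; its creation
probability is bounded by 1. -/
theorem lintegral_walk_le (M : Model P p νX νξ X ε U ξ) {g : ℕ → ℝ → ℝ}
    (hg : ∀ n, Measurable (g n)) (hg0 : ∀ n x, 0 ≤ g n x) {z : ℕ → ℝ} (hz0 : ∀ n, 0 ≤ z n)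
    (hz : ∀ n, ∫⁻ x, ENNReal.ofReal (g n x) ∂νX ≤ ENNReal.ofReal (z n)) (n : ℕ) :
    ∫⁻ ω, ENNReal.ofReal (walk (fun n ω => g n (X n ω)) ε U ξ n ω) ∂P ≤
      ENNReal.ofReal (growth (p * ∫ x, x ∂νξ) n *
        ∑ k ∈ Finset.Icc 1 n, z k / growth (p * ∫ x, x ∂νξ) k) := by
  have ha := M.exponent_nonneg
  rcases Nat.eq_zero_or_pos n with rfl | hn
  · simp [walk]
  induction n, hn using Nat.le_induction with
  | base =>
    simp only [walk, Finset.Icc_self, Finset.sum_singleton, step_one, growth_one, div_one, one_mul]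
    refine le_trans (le_of_eq ?_) (hz 1)
    rw [← M.law_spin 1 le_rfl, lintegral_map (hg 1).ennreal_ofReal (M.measurable_spin 1 le_rfl)]
  | succ n hn ih =>
    have h := M.lintegral_mul_walk_succ hg hg0 hn (V := fun _ => 1) measurable_const
    simp only [one_mul, lintegral_const, measure_univ] at h
    have hG := growth_pos ha n
    have hG' := growth_pos ha (n + 1)
    have hS : 0 ≤ ∑ k ∈ Finset.Icc 1 n, z k / growth (p * ∫ x, x ∂νξ) k :=
      Finset.sum_nonneg fun k _ => div_nonneg (hz0 k) (growth_pos ha k).le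
    rw [h]
    calc _ ≤ ENNReal.ofReal 1 * ENNReal.ofReal (z (n + 1)) +
          ENNReal.ofReal (1 + p * (∫ x, x ∂νξ) / n) * ENNReal.ofReal
            (growth (p * ∫ x, x ∂νξ) n *
              ∑ k ∈ Finset.Icc 1 n, z k / growth (p * ∫ x, x ∂νξ) k) := by
          gcongr
          · linarith [M.p_pos]
          · exact hz _
      _ = _ := by
          rw [ENNReal.ofReal_one, one_mul, ← ENNReal.ofReal_mul (by positivity),
            ← ENNReal.ofReal_add (hz0 _) (by positivity),
            Finset.sum_Icc_succ_top (by omega), mul_add, mul_div_cancel₀ _ hG'.ne',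
            growth_succ hn]
          congr 1
          ring

/-- The sum `∑ 1 / growth k` over all positive `k`. -/
theorem sum_div_growth_le (M : Model P p νX νξ X ε U ξ) {c : ℝ} (hc : 0 ≤ c) (n : ℕ) :
    ∑ k ∈ Finset.Icc 1 n, c / growth (p * ∫ x, x ∂νξ) k
      ≤ c * ∑' k, (growth (p * ∫ x, x ∂νξ) k)⁻¹ := by
  simp only [div_eq_mul_inv, ← Finset.mul_sum]
  refine mul_le_mul_of_nonneg_left ?_ hc
  exact (summable_inv_growth M.super).sum_le_tsum _ fun k _ =>
    (inv_pos.2 (growth_pos M.exponent_nonneg k)).le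

/-- Spins with uniformly bounded mean. -/
theorem lintegral_walk_le_const (M : Model P p νX νξ X ε U ξ) {g : ℕ → ℝ → ℝ}
    (hg : ∀ n, Measurable (g n)) (hg0 : ∀ n x, 0 ≤ g n x) {c : ℝ} (hc : 0 ≤ c)
    (hz : ∀ n, ∫⁻ x, ENNReal.ofReal (g n x) ∂νX ≤ ENNReal.ofReal c) (n : ℕ) :
    ∫⁻ ω, ENNReal.ofReal (walk (fun n ω => g n (X n ω)) ε U ξ n ω) ∂P ≤
      ENNReal.ofReal (growth (p * ∫ x, x ∂νξ) n *
        (c * ∑' k, (growth (p * ∫ x, x ∂νξ) k)⁻¹)) := by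
  refine (M.lintegral_walk_le hg hg0 (fun _ => hc) hz n).trans ?_
  refine ENNReal.ofReal_le_ofReal (mul_le_mul_of_nonneg_left (M.sum_div_growth_le hc n)
    (growth_pos M.exponent_nonneg n).le)

theorem integrable_walk (M : Model P p νX νξ X ε U ξ) {g : ℕ → ℝ → ℝ}
    (hg : ∀ n, Measurable (g n)) (hg0 : ∀ n x, 0 ≤ g n x) {c : ℝ} (hc : 0 ≤ c)
    (hz : ∀ n, ∫⁻ x, ENNReal.ofReal (g n x) ∂νX ≤ ENNReal.ofReal c) (n : ℕ) :
    Integrable (walk (fun n ω => g n (X n ω)) ε U ξ n) P := by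
  refine ⟨(M.measurable_walk_ambient hg n).aestronglyMeasurable, ?_⟩
  rw [hasFiniteIntegral_iff_ofReal]
  · exact (M.lintegral_walk_le_const hg hg0 hc hz n).trans_lt ENNReal.ofReal_lt_top
  · filter_upwards [M.regular] with ω hω
    exact hω.walk_nonneg (fun n _ => hg0 n _) n

theorem setIntegral_walk_succ (M : Model P p νX νξ X ε U ξ) {g : ℕ → ℝ → ℝ}
    (hg : ∀ n, Measurable (g n)) (hg0 : ∀ n x, 0 ≤ g n x) {c : ℝ} (hc : 0 ≤ c)
    (hz : ∀ n, ∫⁻ x, ENNReal.ofReal (g n x) ∂νX ≤ ENNReal.ofReal c) {n : ℕ} (hn : 1 ≤ n)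
    {s : Set Ω} (hs : MeasurableSet[M.history n] s) :
    ∫ ω in s, walk (fun n ω => g n (X n ω)) ε U ξ (n + 1) ω ∂P =
      (1 + p * (∫ x, x ∂νξ) / n) * ∫ ω in s, walk (fun n ω => g n (X n ω)) ε U ξ n ω ∂P +
      (1 - p) * P.real s * ∫ x, g (n + 1) x ∂νX := by
  have hs' : MeasurableSet s := M.sigma_le _ _ hs
  have key : ∀ n, ∫ ω in s, walk (fun n ω => g n (X n ω)) ε U ξ n ω ∂P =
      (∫⁻ ω, s.indicator 1 ω *
        ENNReal.ofReal (walk (fun n ω => g n (X n ω)) ε U ξ n ω) ∂P).toReal := by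
    intro n
    rw [integral_eq_lintegral_of_nonneg_ae, ← lintegral_indicator hs']
    · congr 1
      refine lintegral_congr fun ω => ?_
      by_cases hω : ω ∈ s <;> simp [hω]
    · refine ae_restrict_of_ae ?_
      filter_upwards [M.regular] with ω hω
      exact hω.walk_nonneg (fun n _ => hg0 n _) n
    · exact (M.measurable_walk_ambient hg n).aestronglyMeasurable
  have hfin : ∫⁻ ω, s.indicator 1 ω *
      ENNReal.ofReal (walk (fun n ω => g n (X n ω)) ε U ξ n ω) ∂P ≠ ⊤ := by
    refine ne_top_of_le_ne_top (ENNReal.ofReal_ne_top) (le_trans (lintegral_mono fun ω => ?_)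
      (M.lintegral_walk_le_const hg hg0 hc hz n))
    by_cases hω : ω ∈ s <;> simp [hω]
  have hV : Measurable[M.history n] (s.indicator (1 : Ω → ℝ≥0∞)) :=
    (measurable_const (a := (1 : ℝ≥0∞))).indicator hs
  have hz' := ne_top_of_le_ne_top ENNReal.ofReal_ne_top (hz (n + 1))
  have ha := M.exponent_nonneg
  have hp := M.p_lt_one
  rw [key, key, M.lintegral_mul_walk_succ hg hg0 hn hV,
    lintegral_indicator_one hs', ENNReal.toReal_add, ENNReal.toReal_mul, ENNReal.toReal_mul,
    ENNReal.toReal_mul, ENNReal.toReal_ofReal (by linarith), ENNReal.toReal_ofReal (by positivity),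
    integral_eq_lintegral_of_nonneg_ae (ae_of_all _ (hg0 _)) (hg _).aestronglyMeasurable,
    measureReal_def]
  · ring
  · exact ENNReal.mul_ne_top ENNReal.ofReal_ne_top
      (ENNReal.mul_ne_top (measure_ne_top _ _) hz')
  · exact ENNReal.mul_ne_top ENNReal.ofReal_ne_top hfin

/-- Almost sure convergence of the normalised walk with nonnegative spins. -/
theorem exists_tendsto_walk (M : Model P p νX νξ X ε U ξ) {g : ℕ → ℝ → ℝ}
    (hg : ∀ n, Measurable (g n)) (hg0 : ∀ n x, 0 ≤ g n x) {c : ℝ} (hc : 0 ≤ c)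
    (hz : ∀ n, ∫⁻ x, ENNReal.ofReal (g n x) ∂νX ≤ ENNReal.ofReal c) :
    ∀ᵐ ω ∂P, ∃ l, Tendsto (fun n : ℕ => walk (fun n ω => g n (X n ω)) ε U ξ n ω /
      (n : ℝ) ^ (p * ∫ x, x ∂νξ)) atTop (𝓝 l) := by
  set a := p * ∫ x, x ∂νξ with ha_def
  have ha : 0 ≤ a := M.exponent_nonneg
  have hsup : 1 < a := M.super
  set D : ℕ → Ω → ℝ := fun n ω => walk (fun n ω => g n (X n ω)) ε U ξ n ω / growth a n with hD
  have hDint : ∀ n, Integrable (D n) P := fun n => (M.integrable_walk hg hg0 hc hz n).div_const _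
  have hsub : Submartingale D M.history P := by
    refine submartingale_of_setIntegral_le_succ ?_ hDint ?_
    · intro n
      have h : Measurable[M.history n] (D n) := (M.measurable_walk hg le_rfl).div_const _
      exact h.stronglyMeasurable
    · intro n s hs
      simp only [hD, integral_div]
      -- The recursion starts at time 1. At time 0 the walk is an empty sum, and nonnegativity of
      -- the first spin is enough.
      rcases Nat.eq_zero_or_pos n with rfl | hn
      · simp only [walk, zero_add, Finset.Icc_self, Finset.sum_singleton, growth_one, growth_zero,
          div_one, step_one]
        simp only [show Finset.Icc 1 0 = ∅ from rfl, Finset.sum_empty, integral_zero]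
        exact integral_nonneg fun ω => hg0 1 _
      · rw [M.setIntegral_walk_succ hg hg0 hc hz hn hs, growth_succ hn]
        have hG := growth_pos ha n
        have hr : 0 < 1 + a / n := by positivity
        have h1 : 0 ≤ (1 - p) * P.real s * ∫ x, g (n + 1) x ∂νX := by
          have := M.p_lt_one
          have h2 : 0 ≤ ∫ x, g (n + 1) x ∂νX := integral_nonneg (hg0 _)
          have h3 : 0 ≤ 1 - p := by linarith
          positivity
        rw [← ha_def, div_le_div_iff₀ hG (by positivity)]
        nlinarith [mul_nonneg h1 hG.le]
  obtain ⟨R, hR⟩ : ∃ R : NNReal, ∀ n, eLpNorm (D n) 1 P ≤ R := by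
    refine ⟨(c * ∑' k, (growth a k)⁻¹).toNNReal, fun n => ?_⟩
    have hG := growth_pos ha n
    have hn0 : 0 ≤ᵐ[P] D n := by
      filter_upwards [M.regular] with ω hω
      exact div_nonneg (hω.walk_nonneg (fun n _ => hg0 n _) n) hG.le
    have h1 : ∀ ω, ENNReal.ofReal (D n ω) = ENNReal.ofReal (growth a n)⁻¹ *
        ENNReal.ofReal (walk (fun n ω => g n (X n ω)) ε U ξ n ω) := by
      intro ω
      rw [← ENNReal.ofReal_mul (by positivity), hD]
      congr 1
      ring
    rw [eLpNorm_one_eq_lintegral_enorm, lintegral_congr_ae (g := fun ω => ENNReal.ofReal (D n ω))]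
    · simp only [h1]
      rw [lintegral_const_mul _ (M.measurable_walk_ambient hg n).ennreal_ofReal]
      refine (mul_le_mul_right (M.lintegral_walk_le_const hg hg0 hc hz n) _).trans ?_
      rw [← ENNReal.ofReal_mul (by positivity), ← ha_def, inv_mul_cancel_left₀ hG.ne']
      rfl
    · filter_upwards [hn0] with ω hω
      exact Real.enorm_of_nonneg hω
  filter_upwards [hsub.ae_tendsto_limitProcess hR] with ω hω
  refine ⟨_, ((hω.mul (tendsto_growth_div (by linarith : 0 < a))).congr fun n => ?_)⟩
  have hG := (growth_pos ha n).ne'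
  simp only [hD]
  field_simp

end Model

end RWES

namespace RWES

/-! ### Existence of the limits -/

variable {Ω : Type*} [MeasurableSpace Ω]

set_option linter.unusedSectionVars false

variable {P : Measure Ω} [IsProbabilityMeasure P] {p : ℝ} {νX νξ : Measure ℝ}
  {X ε : ℕ → Ω → ℝ} {U : ℕ → Ω → ℕ} {ξ : ℕ → Ω → ℝ}

namespace Model

theorem lintegral_indicatorSpin_le (M : Model P p νX νξ X ε U ξ) (r n : ℕ) :
    ∫⁻ _, ENNReal.ofReal (indicatorSpin r n) ∂νX ≤ ENNReal.ofReal (indicatorSpin r n) := by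
  have := M.isProbabilityMeasure_spin
  simp

theorem indicatorSpin_le_one (r n : ℕ) : indicatorSpin r n ≤ 1 := by
  unfold indicatorSpin; split_ifs <;> norm_num

theorem lintegral_abs_spin (M : Model P p νX νξ X ε U ξ) :
    ∫⁻ x, ENNReal.ofReal |x| ∂νX = ENNReal.ofReal (∫ x, |x| ∂νX) :=
  (ofReal_integral_eq_lintegral_ofReal M.spin_integrable.abs (ae_of_all _ fun x => abs_nonneg x)).symm

theorem lintegral_le_abs_spin (M : Model P p νX νξ X ε U ξ) {g : ℝ → ℝ} (hg : ∀ x, g x ≤ |x|) :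
    ∫⁻ x, ENNReal.ofReal (g x) ∂νX ≤ ENNReal.ofReal (∫ x, |x| ∂νX) := by
  rw [← M.lintegral_abs_spin]
  exact lintegral_mono fun x => ENNReal.ofReal_le_ofReal (hg x)

theorem mean_abs_nonneg : 0 ≤ ∫ x, |x| ∂νX := integral_nonneg fun x => abs_nonneg x

theorem tendsto_subtreeWeight (M : Model P p νX νξ X ε U ξ) (r : ℕ) :
    ∀ᵐ ω ∂P, Tendsto (fun n : ℕ => subtreeWeight ε U ξ r n ω / (n : ℝ) ^ (p * ∫ x, x ∂νξ))
      atTop (𝓝 (subtreeLimit ε U ξ (p * ∫ x, x ∂νξ) r ω)) := by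
  filter_upwards [M.regular, M.exists_tendsto_walk (g := fun n _ => indicatorSpin r n)
    (fun _ => measurable_const) (fun n _ => indicatorSpin_nonneg r n) zero_le_one
    (fun n => (M.lintegral_indicatorSpin_le r n).trans
      (ENNReal.ofReal_le_ofReal (indicatorSpin_le_one r n)))] with ω hω hlim
  refine tendsto_nhds_limUnder ?_
  simpa only [hω.subtreeWeight_eq] using hlim

theorem subtreeLimit_nonneg (M : Model P p νX νξ X ε U ξ) (r : ℕ) :
    ∀ᵐ ω ∂P, 0 ≤ subtreeLimit ε U ξ (p * ∫ x, x ∂νξ) r ω := by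
  filter_upwards [M.regular, M.tendsto_subtreeWeight r] with ω hω hlim
  exact ge_of_tendsto' hlim fun n => div_nonneg (hω.subtreeWeight_nonneg r n) (by positivity)

theorem aestronglyMeasurable_subtreeWeight (M : Model P p νX νξ X ε U ξ) (r n : ℕ) :
    AEStronglyMeasurable (subtreeWeight ε U ξ r n) P := by
  refine (M.measurable_walk_ambient (g := fun n _ => indicatorSpin r n)
    (fun _ => measurable_const) n).aestronglyMeasurable.congr ?_
  filter_upwards [M.regular] with ω hω
  rw [hω.subtreeWeight_eq]

theorem aestronglyMeasurable_subtreeLimit (M : Model P p νX νξ X ε U ξ) (r : ℕ) :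
    AEStronglyMeasurable (subtreeLimit ε U ξ (p * ∫ x, x ∂νξ) r) P :=
  aestronglyMeasurable_of_tendsto_ae atTop
    (fun n => (M.aestronglyMeasurable_subtreeWeight r n).mul_const ((n : ℝ) ^ (p * ∫ x, x ∂νξ))⁻¹)
    (by simpa only [div_eq_mul_inv] using M.tendsto_subtreeWeight r)

theorem measurable_spin_succ (M : Model P p νX νξ X ε U ξ) (r : ℕ) :
    Measurable (X (r + 1)) := M.measurable_spin _ (by omega)

/-- Fatou's lemma for a sequence dominated by a walk with nonnegative spins. -/
theorem exists_lintegral_limit_le (M : Model P p νX νξ X ε U ξ) :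
    ∃ C : ℝ, 0 < C ∧ ∀ (g : ℕ → ℝ → ℝ) (z : ℕ → ℝ) (B : ℝ) (f : ℕ → Ω → ℝ) (F : Ω → ℝ),
      (∀ n, Measurable (g n)) → (∀ n x, 0 ≤ g n x) → (∀ n, 0 ≤ z n) →
      (∀ n, ∫⁻ x, ENNReal.ofReal (g n x) ∂νX ≤ ENNReal.ofReal (z n)) →
      (∀ n, ∑ k ∈ Finset.Icc 1 n, z k / growth (p * ∫ x, x ∂νξ) k ≤ B) →
      (∀ n, AEStronglyMeasurable (f n) P) →
      (∀ᵐ ω ∂P, ∀ n, |f n ω| ≤ walk (fun n ω => g n (X n ω)) ε U ξ n ω) →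
      (∀ᵐ ω ∂P, Tendsto (fun n : ℕ => f n ω / (n : ℝ) ^ (p * ∫ x, x ∂νξ)) atTop (𝓝 (F ω))) →
      eLpNorm F 1 P ≤ ENNReal.ofReal (C * B) := by
  have ha : 0 < p * ∫ x, x ∂νξ := by linarith [M.super]
  -- The constant depends only on a, so that it stays fixed when the bound B is later sent to zero.
  obtain ⟨C, hC0, hC⟩ := exists_growth_le ha
  refine ⟨C, hC0, fun g z B f F hg hg0 hz0 hz hB hf hfg hF => ?_⟩
  have hmeas : ∀ n : ℕ, AEStronglyMeasurable
      (fun ω => f n ω / (n : ℝ) ^ (p * ∫ x, x ∂νξ)) P := fun n => by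
    simpa only [div_eq_mul_inv] using (hf n).mul_const _
  refine (Lp.eLpNorm_lim_le_liminf_eLpNorm hmeas F hF).trans ?_
  refine liminf_le_of_frequently_le' ?_
  refine Eventually.frequently ?_
  filter_upwards [eventually_ge_atTop 1] with n hn
  have hpos : (0 : ℝ) < (n : ℝ) ^ (p * ∫ x, x ∂νξ) := by positivity
  rw [eLpNorm_one_eq_lintegral_enorm]
  have hB0 : 0 ≤ B := le_trans (by simp) (hB 0)
  calc ∫⁻ ω, ‖f n ω / (n : ℝ) ^ (p * ∫ x, x ∂νξ)‖ₑ ∂P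
      ≤ ∫⁻ ω, ENNReal.ofReal ((n : ℝ) ^ (p * ∫ x, x ∂νξ))⁻¹ *
          ENNReal.ofReal (walk (fun n ω => g n (X n ω)) ε U ξ n ω) ∂P := by
        refine lintegral_mono_ae ?_
        filter_upwards [hfg] with ω hω
        rw [← ENNReal.ofReal_mul (by positivity), ← ofReal_norm, Real.norm_eq_abs, abs_div,
          abs_of_pos hpos, div_eq_inv_mul]
        exact ENNReal.ofReal_le_ofReal (mul_le_mul_of_nonneg_left (hω n) (by positivity))
    _ ≤ ENNReal.ofReal ((n : ℝ) ^ (p * ∫ x, x ∂νξ))⁻¹ * ENNReal.ofReal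
          (growth (p * ∫ x, x ∂νξ) n * B) := by
        rw [lintegral_const_mul _ (M.measurable_walk_ambient hg n).ennreal_ofReal]
        refine mul_le_mul_right ((M.lintegral_walk_le hg hg0 hz0 hz n).trans ?_) _
        exact ENNReal.ofReal_le_ofReal (mul_le_mul_of_nonneg_left (hB n) (growth_pos ha.le n).le)
    _ ≤ _ := by
        rw [← ENNReal.ofReal_mul (by positivity)]
        refine ENNReal.ofReal_le_ofReal ?_
        rw [← mul_assoc]
        refine mul_le_mul_of_nonneg_right ?_ hB0
        rw [inv_mul_le_iff₀ hpos, mul_comm _ C]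
        exact hC n hn

theorem integrable_of_eLpNorm_le {F : Ω → ℝ} (hF : AEStronglyMeasurable F P) {c : ℝ}
    (h : eLpNorm F 1 P ≤ ENNReal.ofReal c) : Integrable F P :=
  memLp_one_iff_integrable.1 ⟨hF, h.trans_lt ENNReal.ofReal_lt_top⟩

theorem integrable_subtreeLimit (M : Model P p νX νξ X ε U ξ) (r : ℕ) :
    Integrable (subtreeLimit ε U ξ (p * ∫ x, x ∂νξ) r) P := by
  obtain ⟨C, -, hC⟩ := M.exists_lintegral_limit_le
  refine integrable_of_eLpNorm_le (M.aestronglyMeasurable_subtreeLimit r)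
    (hC (fun n _ => indicatorSpin r n) (fun _ => 1) _ (subtreeWeight ε U ξ r) _
      (fun _ => measurable_const) (fun n _ => indicatorSpin_nonneg r n) (fun _ => zero_le_one)
      (fun n => (M.lintegral_indicatorSpin_le r n).trans
        (ENNReal.ofReal_le_ofReal (indicatorSpin_le_one r n)))
      (M.sum_div_growth_le zero_le_one) (M.aestronglyMeasurable_subtreeWeight r) ?_
      (M.tendsto_subtreeWeight r))
  filter_upwards [M.regular] with ω hω n
  rw [abs_of_nonneg (hω.subtreeWeight_nonneg r n), hω.subtreeWeight_eq]

/-- The family of limits is independent of the spins. -/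
theorem indepFun_subtreeLimit (M : Model P p νX νξ X ε U ξ) :
    IndepFun (fun ω (r : ℕ) => subtreeLimit ε U ξ (p * ∫ x, x ∂νξ) (r + 1) ω)
      (fun ω (r : ℕ) => X (r + 1) ω) P := by
  -- All the noise except the spins, which are the left summands.
  set S : Set (ℕ ⊕ ℕ ⊕ ℕ ⊕ ℕ) := {i | i.isRight}
  have hstep : ∀ r n, Measurable[sigma X ε U ξ S]
      (fun ω => step (fun n _ => indicatorSpin r n) ε U ξ ω n) := by
    intro r n
    simp only [step_eq_filteredStep]
    refine @measurable_filteredStep_of Ω ε U ξ (sigma X ε U ξ S) _ _ (fun _ => measurable_id) n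
      (fun _ _ _ => measurable_const) ?_ ?_ ?_ n le_rfl
    · exact fun k hk _ => measurable_bernoulli_sigma hk (by simp [S])
    · exact fun k hk _ => measurableSet_sample_sigma hk (by simp [S])
    · exact fun k hk _ => measurable_echo_sigma hk (by simp [S])
  -- Measurability is proved for the limits of the indicator walks, which are measurable for the
  -- spin-free σ-algebra; they agree with the subtree limits only almost surely.
  have hlim : Measurable[sigma X ε U ξ S] (fun ω (r : ℕ) => limUnder atTop (fun n : ℕ =>
      walk (fun n _ => indicatorSpin (r + 1) n) ε U ξ n ω / (n : ℝ) ^ (p * ∫ x, x ∂νξ))) := by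
    refine @measurable_pi_lambda Ω ℕ (fun _ => ℝ) (sigma X ε U ξ S) _ _ fun r => ?_
    refine StronglyMeasurable.measurable (@StronglyMeasurable.limUnder _ _ _
      (sigma X ε U ξ S) _ _ _ _ _ _ _ fun n => ?_)
    have h : Measurable[sigma X ε U ξ S]
        (walk (fun n _ => indicatorSpin (r + 1) n) ε U ξ n) :=
      Finset.measurable_sum _ fun k _ => hstep (r + 1) k
    exact (h.div_const _).stronglyMeasurable
  have hX : Measurable[sigma X ε U ξ Sᶜ] (fun ω (r : ℕ) => X (r + 1) ω) :=
    @measurable_pi_lambda Ω ℕ (fun _ => ℝ) (sigma X ε U ξ Sᶜ) _ _ fun r =>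
      measurable_spin_sigma (by omega) (by simp [S])
  have hind := indep_of_indep_of_le_left (indep_of_indep_of_le_right
    (M.indep_sigma (disjoint_compl_right (a := S))) hX.comap_le) hlim.comap_le
  refine IndepFun.congr (hind : IndepFun _ _ P) ?_ (ae_eq_refl _)
  filter_upwards [M.regular] with ω hω
  funext r
  simp only [subtreeLimit, hω.subtreeWeight_eq]

/-- The submartingale argument needs nonnegative spins, so positive and negative parts are treated
separately and recombined by linearity. -/
theorem exists_tendsto_walk_spin (M : Model P p νX νξ X ε U ξ) :
    ∀ᵐ ω ∂P, ∃ l, Tendsto (fun n : ℕ => walk X ε U ξ n ω / (n : ℝ) ^ (p * ∫ x, x ∂νξ))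
      atTop (𝓝 l) := by
  have h1 := M.exists_tendsto_walk (g := fun _ x => max x 0)
    (fun _ => measurable_id.max measurable_const) (fun _ x => le_max_right _ _) mean_abs_nonneg
    (fun _ => M.lintegral_le_abs_spin fun x => max_le (le_abs_self x) (abs_nonneg x))
  have h2 := M.exists_tendsto_walk (g := fun _ x => max (-x) 0)
    (fun _ => measurable_id.neg.max measurable_const) (fun _ x => le_max_right _ _) mean_abs_nonneg
    (fun _ => M.lintegral_le_abs_spin fun x => max_le (neg_le_abs x) (abs_nonneg x))
  filter_upwards [M.regular, h1, h2] with ω hω ⟨l1, hl1⟩ ⟨l2, hl2⟩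
  refine ⟨l1 - l2, (hl1.sub hl2).congr fun n => ?_⟩
  have : X = fun n ω => max (X n ω) 0 - max (-X n ω) 0 := by
    funext n ω
    exact (max_zero_sub_max_neg_zero_eq_self _).symm
  conv_rhs => rw [this, hω.walk_sub]
  ring

/-- The limit of the normalised walk. -/
noncomputable def walkLimit (X ε : ℕ → Ω → ℝ) (U : ℕ → Ω → ℕ) (ξ : ℕ → Ω → ℝ) (a : ℝ)
    (ω : Ω) : ℝ :=
  limUnder atTop (fun n : ℕ => walk X ε U ξ n ω / (n : ℝ) ^ a)

theorem tendsto_walk_walkLimit (M : Model P p νX νξ X ε U ξ) :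
    ∀ᵐ ω ∂P, Tendsto (fun n : ℕ => walk X ε U ξ n ω / (n : ℝ) ^ (p * ∫ x, x ∂νξ))
      atTop (𝓝 (walkLimit X ε U ξ (p * ∫ x, x ∂νξ) ω)) := by
  filter_upwards [M.exists_tendsto_walk_spin] with ω hω
  exact tendsto_nhds_limUnder hω

theorem measurable_walk_spin (M : Model P p νX νξ X ε U ξ) (n : ℕ) :
    Measurable (walk X ε U ξ n) :=
  M.measurable_walk_ambient (g := fun _ x => x) (fun _ => measurable_id) n

theorem aestronglyMeasurable_walkLimit (M : Model P p νX νξ X ε U ξ) :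
    AEStronglyMeasurable (walkLimit X ε U ξ (p * ∫ x, x ∂νξ)) P :=
  aestronglyMeasurable_of_tendsto_ae atTop
    (fun n => ((M.measurable_walk_spin n).div_const _).aestronglyMeasurable)
    M.tendsto_walk_walkLimit

theorem integrable_walkLimit (M : Model P p νX νξ X ε U ξ) :
    Integrable (walkLimit X ε U ξ (p * ∫ x, x ∂νξ)) P := by
  obtain ⟨C, -, hC⟩ := M.exists_lintegral_limit_le
  refine integrable_of_eLpNorm_le M.aestronglyMeasurable_walkLimit
    (hC (fun _ x => |x|) (fun _ => ∫ x, |x| ∂νX) _ (walk X ε U ξ) _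
      (fun _ => measurable_norm) (fun _ x => abs_nonneg x) (fun _ => mean_abs_nonneg)
      (fun _ => M.lintegral_abs_spin.le) (M.sum_div_growth_le mean_abs_nonneg)
      (fun n => (M.measurable_walk_spin n).aestronglyMeasurable) ?_ M.tendsto_walk_walkLimit)
  filter_upwards [M.regular] with ω hω n
  exact hω.abs_walk_le (fun _ _ => le_rfl) n

theorem tendsto_sum_mul_subtreeWeight (M : Model P p νX νξ X ε U ξ) (Z : ℕ → Ω → ℝ)
    (s : Finset ℕ) :
    ∀ᵐ ω ∂P, Tendsto (fun n : ℕ => (∑ r ∈ s, Z r ω * subtreeWeight ε U ξ r n ω) /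
      (n : ℝ) ^ (p * ∫ x, x ∂νξ)) atTop
      (𝓝 (∑ r ∈ s, Z r ω * subtreeLimit ε U ξ (p * ∫ x, x ∂νξ) r ω)) := by
  have h : ∀ᵐ ω ∂P, ∀ r, _ := ae_all_iff.2 fun r => M.tendsto_subtreeWeight r
  filter_upwards [h] with ω hω
  simp only [Finset.sum_div, mul_div_assoc]
  exact tendsto_finsetSum _ fun r _ => (hω r).const_mul _

/-- Each partial sum of |X_r| L_r is the limit of a walk driven by finitely many of the |X_r|, hence
dominated by the walk with all of them. Fatou bounds the means uniformly in the number of terms. -/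
theorem summable_spin_mul_subtreeLimit (M : Model P p νX νξ X ε U ξ) :
    ∀ᵐ ω ∂P, Summable
      (fun r : ℕ => |X (r + 1) ω * subtreeLimit ε U ξ (p * ∫ x, x ∂νξ) (r + 1) ω|) := by
  set L := subtreeLimit ε U ξ (p * ∫ x, x ∂νξ) with hL
  obtain ⟨C, -, hC⟩ := M.exists_lintegral_limit_le
  have hm : ∀ r, AEMeasurable (fun ω => ‖X (r + 1) ω * L (r + 1) ω‖ₑ) P := fun r =>
    ((M.measurable_spin_succ r).aestronglyMeasurable.mul
      (M.aestronglyMeasurable_subtreeLimit (r + 1))).enorm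
  have hnn : ∀ᵐ ω ∂P, ∀ r, 0 ≤ L r ω := ae_all_iff.2 fun r => M.subtreeLimit_nonneg r
  have hfin : ∫⁻ ω, ∑' r : ℕ, ‖X (r + 1) ω * L (r + 1) ω‖ₑ ∂P ≠ ⊤ := by
    rw [lintegral_tsum hm]
    refine ne_top_of_le_ne_top (ENNReal.ofReal_ne_top (r := C * ((∫ x, |x| ∂νX) *
      ∑' k, (growth (p * ∫ x, x ∂νξ) k)⁻¹))) (ENNReal.tsum_le_of_sum_range_le fun R => ?_)
    have h := hC (fun _ x => |x|) (fun _ => ∫ x, |x| ∂νX) _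
      (fun n ω => ∑ r ∈ (Finset.range R).map (addRightEmbedding 1),
        |X r ω| * subtreeWeight ε U ξ r n ω)
      (fun ω => ∑ r ∈ (Finset.range R).map (addRightEmbedding 1), |X r ω| * L r ω)
      (fun _ => measurable_norm) (fun _ x => abs_nonneg x) (fun _ => mean_abs_nonneg)
      (fun _ => M.lintegral_abs_spin.le) (M.sum_div_growth_le mean_abs_nonneg) ?_ ?_
      (M.tendsto_sum_mul_subtreeWeight (fun n ω => |X n ω|) _)
    · refine le_trans (le_of_eq ?_) h
      rw [← lintegral_finsetSum' _ fun r _ => hm r, eLpNorm_one_eq_lintegral_enorm]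
      refine lintegral_congr_ae ?_
      filter_upwards [hnn] with ω hω
      rw [Finset.sum_map, Real.enorm_of_nonneg (Finset.sum_nonneg fun r _ =>
        mul_nonneg (abs_nonneg _) (hω _)), ENNReal.ofReal_sum_of_nonneg fun r _ =>
        mul_nonneg (abs_nonneg _) (hω _)]
      refine Finset.sum_congr rfl fun r _ => ?_
      rw [← ofReal_norm, norm_mul, Real.norm_eq_abs, Real.norm_of_nonneg (hω _)]
      rfl
    · intro n
      refine Finset.aestronglyMeasurable_fun_sum _ fun r hr => ?_
      obtain ⟨k, -, rfl⟩ := Finset.mem_map.1 hr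
      exact (M.measurable_spin_succ k).norm.aestronglyMeasurable.mul
        (M.aestronglyMeasurable_subtreeWeight _ n)
    · filter_upwards [M.regular] with ω hω n
      rw [hω.sum_mul_subtreeWeight (Z := fun n ω => |X n ω|)]
      refine hω.abs_walk_le (fun k _ => ?_) n
      split_ifs <;> simp
  filter_upwards [ae_lt_top' (AEMeasurable.tsum hm) hfin] with ω hω
  have := ENNReal.summable_toReal hω.ne
  simpa [Real.norm_eq_abs] using this

/-- The limit of the normalised walk is the sum of the random series. -/
theorem walkLimit_eq_limitSeries (M : Model P p νX νξ X ε U ξ) :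
    ∀ᵐ ω ∂P, walkLimit X ε U ξ (p * ∫ x, x ∂νξ) ω = limitSeries X ε U ξ (p * ∫ x, x ∂νξ) ω := by
  set a := p * ∫ x, x ∂νξ with ha_def
  set L := subtreeLimit ε U ξ a with hL
  have ha : 0 ≤ a := M.exponent_nonneg
  obtain ⟨C, hC0, hC⟩ := M.exists_lintegral_limit_le
  have hm : ∀ r, AEStronglyMeasurable (fun ω => X (r + 1) ω * L (r + 1) ω) P := fun r =>
    (M.measurable_spin_succ r).aestronglyMeasurable.mul
      (M.aestronglyMeasurable_subtreeLimit (r + 1))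
  set m := ∫ x, |x| ∂νX with hm_def
  have hm0 : 0 ≤ m := mean_abs_nonneg
  have hinv : ∀ k, 0 ≤ (growth a k)⁻¹ := fun k => (inv_pos.2 (growth_pos ha k)).le
  have hsummable : Summable fun k => m * (growth a k)⁻¹ :=
    (summable_inv_growth M.super).mul_left m
  -- The tail, beyond time R, of the series that bounds the mean of the normalised walk.
  set B : ℕ → ℝ := fun R => ∑' k, if R < k then m * (growth a k)⁻¹ else 0 with hB_def
  have hterm0 : ∀ R k, 0 ≤ if R < k then m * (growth a k)⁻¹ else 0 := fun R k => by
    split_ifs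
    · exact mul_nonneg hm0 (hinv k)
    · exact le_rfl
  have hterm : ∀ R k, (if R < k then m * (growth a k)⁻¹ else 0) ≤ m * (growth a k)⁻¹ :=
    fun R k => by
      split_ifs
      · exact le_rfl
      · exact mul_nonneg hm0 (hinv k)
  have hB : Tendsto B atTop (𝓝 0) := by
    have := tendsto_tsum_of_dominated_convergence (𝓕 := atTop)
      (f := fun R k => if R < k then m * (growth a k)⁻¹ else 0) (g := fun _ => (0 : ℝ))
      hsummable (fun k => ?_) (Eventually.of_forall fun R k => ?_)
    · simpa using this
    · refine tendsto_const_nhds.congr' ?_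
      filter_upwards [eventually_ge_atTop k] with R hR
      rw [if_neg (by omega)]
    · rw [Real.norm_of_nonneg (hterm0 R k)]
      exact hterm R k
  -- Before the limit, the difference is the walk with spins erased up to time R, so its mean is
  -- controlled by the tail.
  have hbound : ∀ R, eLpNorm (fun ω => walkLimit X ε U ξ a ω -
      ∑ r ∈ Finset.range R, X (r + 1) ω * L (r + 1) ω) 1 P ≤ ENNReal.ofReal (C * B R) := by
    intro R
    refine hC (fun n x => if R < n then |x| else 0) (fun n => if R < n then m else 0) _
      (fun n ω => walk X ε U ξ n ω - ∑ r ∈ (Finset.range R).map (addRightEmbedding 1),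
        X r ω * subtreeWeight ε U ξ r n ω) _ ?_ ?_ ?_ ?_ ?_ ?_ ?_ ?_
    · intro n
      split_ifs
      · exact measurable_norm
      · exact measurable_const
    · intro n x
      split_ifs <;> positivity
    · intro n
      split_ifs <;> positivity
    · intro n
      split_ifs
      · exact M.lintegral_abs_spin.le
      · simp
    · intro n
      refine le_trans (Finset.sum_le_sum fun k _ => ?_)
        (Summable.sum_le_tsum (Finset.Icc 1 n) (fun k _ => hterm0 R k)
          (Summable.of_nonneg_of_le (hterm0 R) (hterm R) hsummable))
      split_ifs
      · rw [div_eq_mul_inv]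
      · simp
    · intro n
      refine (M.measurable_walk_spin n).aestronglyMeasurable.sub
        (Finset.aestronglyMeasurable_fun_sum _ fun r hr => ?_)
      obtain ⟨k, -, rfl⟩ := Finset.mem_map.1 hr
      exact (M.measurable_spin_succ k).aestronglyMeasurable.mul
        (M.aestronglyMeasurable_subtreeWeight _ n)
    · filter_upwards [M.regular] with ω hω n
      rw [hω.sum_mul_subtreeWeight, ← hω.walk_sub]
      refine hω.abs_walk_le (fun k hk => ?_) n
      by_cases h : R < k
      · rw [if_pos h]
        split_ifs with h'
        · simp
        · simp
      · rw [if_neg h, if_pos, sub_self, abs_zero]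
        simp only [Finset.mem_map, Finset.mem_range, addRightEmbedding_apply]
        exact ⟨k - 1, by omega, by omega⟩
    · filter_upwards [M.tendsto_walk_walkLimit, M.tendsto_sum_mul_subtreeWeight X
        ((Finset.range R).map (addRightEmbedding 1))] with ω h1 h2
      have h3 := h1.sub h2
      simp only [← sub_div] at h3
      rw [Finset.sum_map] at h3
      exact h3
  have hlim : ∀ᵐ ω ∂P, Tendsto (fun R => walkLimit X ε U ξ a ω -
      ∑ r ∈ Finset.range R, X (r + 1) ω * L (r + 1) ω) atTop
      (𝓝 (walkLimit X ε U ξ a ω - limitSeries X ε U ξ a ω)) := by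
    filter_upwards [M.summable_spin_mul_subtreeLimit] with ω hω
    exact tendsto_const_nhds.sub (Summable.of_abs hω).hasSum.tendsto_sum_nat
  have hmeas : ∀ R, AEStronglyMeasurable (fun ω => walkLimit X ε U ξ a ω -
      ∑ r ∈ Finset.range R, X (r + 1) ω * L (r + 1) ω) P := fun R =>
    M.aestronglyMeasurable_walkLimit.sub (Finset.aestronglyMeasurable_fun_sum _ fun r _ => hm r)
  -- A second use of Fatou, now as R tends to infinity.
  have hzero : eLpNorm (fun ω => walkLimit X ε U ξ a ω - limitSeries X ε U ξ a ω) 1 P = 0 := by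
    refine le_antisymm ?_ zero_le
    refine (Lp.eLpNorm_lim_le_liminf_eLpNorm hmeas _ hlim).trans ?_
    have h0 : Tendsto (fun R => ENNReal.ofReal (C * B R)) atTop (𝓝 0) := by
      have := ENNReal.tendsto_ofReal (hB.const_mul C)
      simpa using this
    refine (liminf_le_liminf (Eventually.of_forall hbound)).trans ?_
    exact h0.liminf_eq.le
  have hae := (eLpNorm_eq_zero_iff (aestronglyMeasurable_of_tendsto_ae atTop hmeas hlim)
    one_ne_zero).1 hzero
  filter_upwards [hae] with ω hω
  exact sub_eq_zero.1 hω

end Model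

end RWES

namespace RWES

/-! ### Degeneracy of the components: analytic estimates -/

set_option linter.unusedSectionVars false

/-! ### Moments of the echo law in the degenerate regime. -/

section Echo

variable {ν : Measure ℝ} [IsProbabilityMeasure ν] {q : ℝ}

theorem abs_mul_log_le (hq : 0 < q) {y : ℝ} (hy : 0 ≤ y) :
    |y * Real.log y| ≤ 1 + y ^ (1 + q) / q := by
  rcases hy.eq_or_lt with rfl | hy
  · simp; positivity
  have h1 : y * Real.log y ≤ y ^ (1 + q) / q := by
    have := Real.log_le_rpow_div hy.le hq
    calc y * Real.log y ≤ y * (y ^ q / q) := by gcongr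
      _ = y ^ (1 + q) / q := by rw [Real.rpow_add hy, Real.rpow_one]; ring
  have h2 : -1 ≤ y * Real.log y := by
    have := Real.one_sub_inv_le_log_of_pos hy
    have h3 : y * (1 - y⁻¹) ≤ y * Real.log y := by gcongr
    rw [mul_sub, mul_inv_cancel₀ hy.ne'] at h3
    linarith
  have h3 : 0 ≤ y ^ (1 + q) / q := by positivity
  rw [abs_le]
  constructor <;> linarith

theorem integrable_mul_log (hq : 0 < q) (hν : ∀ᵐ y ∂ν, 0 ≤ y)
    (hint : Integrable (fun y : ℝ => y ^ (1 + q)) ν) :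
    Integrable (fun y => y * Real.log y) ν := by
  refine ((integrable_const (1 : ℝ)).add (hint.div_const q)).mono'
    (measurable_id.mul Real.measurable_log).aestronglyMeasurable ?_
  filter_upwards [hν] with y hy
  exact abs_mul_log_le hq hy

/-- Tangent line at exponent 1 of the convex function s ↦ y^s, via 1 + u ≤ exp u with u = q log y.
-/
theorem add_mul_log_le_rpow {y : ℝ} (hy : 0 ≤ y) : y + q * (y * Real.log y) ≤ y ^ (1 + q) := by
  rcases hy.eq_or_lt with rfl | hy
  · simpa using Real.zero_rpow_nonneg _
  · rw [Real.rpow_add hy, Real.rpow_one, Real.rpow_def_of_pos hy]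
    have := Real.add_one_le_exp (Real.log y * q)
    nlinarith

theorem add_mul_log_lt_rpow (hq : 0 < q) {y : ℝ} (hy : 0 < y) (h1 : y ≠ 1) :
    y + q * (y * Real.log y) < y ^ (1 + q) := by
  rw [Real.rpow_add hy, Real.rpow_one, Real.rpow_def_of_pos hy]
  have := Real.add_one_lt_exp (x := Real.log y * q)
    (mul_ne_zero (Real.log_ne_zero_of_pos_of_ne_one hy h1) hq.ne')
  nlinarith

/-- Integrate the tangent inequality. Equality would exclude values y > 1, where the inequality is
strict, and so contradict a mean above 1. -/
theorem lt_integral_rpow (hq : 0 < q) (hν : ∀ᵐ y ∂ν, 0 ≤ y) (hid : Integrable (fun y : ℝ => y) ν)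
    (hint : Integrable (fun y : ℝ => y ^ (1 + q)) ν) (hm : 1 < ∫ y, y ∂ν)
    (hlog : ∫ y, y ∂ν ≤ ∫ y, y * Real.log y ∂ν) :
    (1 + q) * ∫ y, y ∂ν < ∫ y, y ^ (1 + q) ∂ν := by
  have hli := integrable_mul_log hq hν hint
  have hle : (fun y => y + q * (y * Real.log y)) ≤ᵐ[ν] fun y => y ^ (1 + q) := by
    filter_upwards [hν] with y hy
    exact add_mul_log_le_rpow hy
  have hi : Integrable (fun y => y + q * (y * Real.log y)) ν := hid.add (hli.const_mul q)
  have h1 : ∫ y, (y + q * (y * Real.log y)) ∂ν = ∫ y, y ∂ν + q * ∫ y, y * Real.log y ∂ν := by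
    rw [integral_add hid (hli.const_mul q), integral_const_mul]
  have h2 := integral_mono_ae hi hint hle
  rcases h2.eq_or_lt with h | h
  · exfalso
    have hae := (integral_eq_iff_of_ae_le hi hint hle).1 h
    have : ∀ᵐ y ∂ν, y ≤ 1 := by
      filter_upwards [hae, hν] with y hy h0
      by_contra! hy1
      exact (add_mul_log_lt_rpow hq (by linarith) hy1.ne').ne hy
    have := integral_mono_ae hid (integrable_const (1 : ℝ)) this
    simp at this
    linarith
  · rw [h1] at h
    nlinarith

/-- By dominated convergence, capping the power at β costs arbitrarily little. The cap is what makes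
the power drift compatible with killing. -/
theorem exists_truncation (hq : 0 < q) (hν : ∀ᵐ y ∂ν, 0 ≤ y)
    (hint : Integrable (fun y : ℝ => y ^ (1 + q)) ν) {b : ℝ} (hb : b < ∫ y, y ^ (1 + q) ∂ν) :
    ∃ β : ℝ, 1 ≤ β ∧ b < ∫ y, y * (min y β) ^ q ∂ν := by
  have hlim : Tendsto (fun n : ℕ => ∫ y, y * (min y n) ^ q ∂ν) atTop
      (𝓝 (∫ y, y ^ (1 + q) ∂ν)) := by
    refine tendsto_integral_of_dominated_convergence (fun y => y ^ (1 + q)) (fun n => ?_) hint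
      (fun n => ?_) ?_
    · exact (measurable_id.mul ((measurable_id.min measurable_const).pow_const q)).aestronglyMeasurable
    · filter_upwards [hν] with y hy
      have h0 : 0 ≤ min y (n : ℝ) := le_min hy (by positivity)
      rw [Real.norm_of_nonneg (by positivity)]
      rcases hy.eq_or_lt with rfl | hy
      · simpa using Real.zero_rpow_nonneg _
      · rw [Real.rpow_add hy, Real.rpow_one]
        gcongr
        exact min_le_left _ _
    · filter_upwards [hν] with y hy
      refine tendsto_const_nhds.congr' ?_
      filter_upwards [eventually_ge_atTop ⌈y⌉₊] with n hn
      rw [min_eq_left (Nat.ceil_le.1 hn)]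
      rcases hy.eq_or_lt with rfl | hy
      · rw [Real.zero_rpow (by linarith), zero_mul]
      · rw [Real.rpow_add hy, Real.rpow_one]
  obtain ⟨n, hn1, hn⟩ := ((eventually_ge_atTop 1).and (hlim.eventually_const_lt hb)).exists
  exact ⟨n, by exact_mod_cast hn1, hn⟩

end Echo

/-! ### One-step drift inequalities for the three functionals. -/

section Drift

variable {ν : Measure ℝ} [IsProbabilityMeasure ν] {p q t x s : ℝ}

/-- One step of the killed mass. -/
theorem mass_drift (hs : 0 ≤ s) (hν : ∀ᵐ y ∂ν, 0 ≤ y) (hid : Integrable (fun y : ℝ => y) ν)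
    (ht : 0 ≤ t) (hx : x = t * (1 + s * ∫ y, y ∂ν)) :
    t + s * ∫ y, (if t * y ≤ 1 then t * y else 0) ∂ν ≤ x := by
  -- In the application s = p / n, t is a weight divided by the threshold of time n + 1, and x the
  -- same weight divided by that of time n. Killing only loses mass.
  have : ∫ y, (if t * y ≤ 1 then t * y else 0) ∂ν ≤ ∫ y, t * y ∂ν := by
    refine integral_mono_of_nonneg ?_ (hid.const_mul t) ?_
    · filter_upwards [hν] with y hy
      simp only [Pi.zero_apply]
      split_ifs <;> positivity
    · filter_upwards [hν] with y hy
      split_ifs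
      · exact le_rfl
      · positivity
  rw [integral_const_mul] at this
  rw [hx]
  nlinarith

/-- One step of the functional whose decrease controls the mass close to the threshold. -/
theorem power_drift (hs : 0 ≤ s) (hq : 0 < q) (hν : ∀ᵐ y ∂ν, 0 ≤ y)
    (hid : Integrable (fun y : ℝ => y) ν) (ht : 0 ≤ t) (ht1 : t ≤ 1) {β : ℝ} (hβ : 1 ≤ β)
    (hint : Integrable (fun y : ℝ => y * (min y β) ^ q) ν) :
    t * (β ^ q - t ^ q) + s * ∫ y, (if t * y ≤ 1 then t * y * (β ^ q - (t * y) ^ q) else 0) ∂ν ≤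
      t * (1 + s * ∫ y, y ∂ν) * β ^ q
        - t * t ^ q * (1 + s * ∫ y, y * (min y β) ^ q ∂ν) := by
  -- A killed child counts 0, whereas the uncapped difference β^q - (t y)^q may be negative. With y
  -- capped at β it stays nonnegative since t ≤ 1, so killed children are dominated too.
  have h : ∫ y, (if t * y ≤ 1 then t * y * (β ^ q - (t * y) ^ q) else 0) ∂ν ≤
      ∫ y, (t * β ^ q * y - t * t ^ q * (y * (min y β) ^ q)) ∂ν := by
    refine integral_mono_of_nonneg ?_ ((hid.const_mul _).sub (hint.const_mul _)) ?_
    · filter_upwards [hν] with y hy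
      simp only [Pi.zero_apply]
      split_ifs with h
      · have h1 : (t * y) ^ q ≤ β ^ q :=
          Real.rpow_le_rpow (by positivity) (h.trans hβ) hq.le
        exact mul_nonneg (by positivity) (by linarith)
      · exact le_rfl
    · filter_upwards [hν] with y hy
      have h0 : 0 ≤ min y β := le_min hy (by linarith)
      split_ifs with h
      · have h1 : (t * min y β) ^ q ≤ (t * y) ^ q :=
          Real.rpow_le_rpow (by positivity) (by gcongr; exact min_le_left _ _) hq.le
        rw [Real.mul_rpow ht h0] at h1
        have : 0 ≤ t * y := by positivity
        nlinarith
      · have h1 : (t * min y β) ^ q ≤ β ^ q := by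
          refine Real.rpow_le_rpow (by positivity) ?_ hq.le
          calc t * min y β ≤ 1 * β := by
                gcongr
                exact min_le_right _ _
            _ = β := one_mul _
        rw [Real.mul_rpow ht h0] at h1
        have : 0 ≤ t * y := by positivity
        nlinarith
  rw [integral_sub (hid.const_mul _) (hint.const_mul _), integral_const_mul,
    integral_const_mul] at h
  nlinarith

/-- One step of the logarithmic functional. -/
theorem log_drift (hs : 0 ≤ s) (hq : 0 < q) (hν : ∀ᵐ y ∂ν, 0 ≤ y)
    (hid : Integrable (fun y : ℝ => y) ν) (hint : Integrable (fun y : ℝ => y ^ (1 + q)) ν)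
    (hlog : ∫ y, y ∂ν ≤ ∫ y, y * Real.log y ∂ν) (ht : 0 ≤ t) :
    Real.negMulLog t +
      s * ∫ y, (if t * y ≤ 1 then Real.negMulLog (t * y) else 0) ∂ν ≤
      -(t * (1 + s * ∫ y, y ∂ν)) * Real.log t - t * (s * ∫ y, y ∂ν)
        + s * (t ^ (1 + q) * ((∫ y, y ^ (1 + q) ∂ν) / q)) := by
  rcases ht.eq_or_lt with rfl | ht
  · simp [Real.zero_rpow (by positivity : 1 + q ≠ 0)]
  have hli := integrable_mul_log hq hν hint
  -- For t y > 1 the function -t y log(t y) is negative; adding (t y)^{1+q} / q restores an upper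
  -- bound for the value 0 of killed children.
  have h : ∫ y, (if t * y ≤ 1 then Real.negMulLog (t * y) else 0) ∂ν ≤
      ∫ y, (-(t * Real.log t) * y - t * (y * Real.log y) + t ^ (1 + q) / q * y ^ (1 + q)) ∂ν := by
    refine integral_mono_of_nonneg ?_
      (((hid.const_mul _).sub (hli.const_mul _)).add (hint.const_mul _)) ?_
    · filter_upwards [hν] with y hy
      simp only [Pi.zero_apply]
      split_ifs with h
      · exact Real.negMulLog_nonneg (by positivity) h
      · exact le_rfl
    · filter_upwards [hν] with y hy
      rcases hy.eq_or_lt with rfl | hy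
      · simp
        positivity
      have h1 : -(t * Real.log t) * y - t * (y * Real.log y) = Real.negMulLog (t * y) := by
        rw [Real.negMulLog, Real.log_mul ht.ne' hy.ne']
        ring
      have h2 : t ^ (1 + q) / q * y ^ (1 + q) = (t * y) ^ (1 + q) / q := by
        rw [Real.mul_rpow ht.le hy.le]
        ring
      rw [h1, h2]
      split_ifs with h
      · have : 0 ≤ (t * y) ^ (1 + q) / q := by positivity
        linarith
      · have h3 := Real.log_le_rpow_div (by positivity : 0 ≤ t * y) hq
        have h4 : t * y * Real.log (t * y) ≤ t * y * ((t * y) ^ q / q) := by gcongr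
        rw [Real.negMulLog, Real.rpow_add (by positivity), Real.rpow_one]
        linarith [mul_div_assoc (t * y) ((t * y) ^ q) q]
  have hi : Integrable (fun y => -(t * Real.log t) * y - t * (y * Real.log y)) ν :=
    (hid.const_mul _).sub (hli.const_mul _)
  rw [integral_add hi (hint.const_mul _), integral_sub (hid.const_mul _) (hli.const_mul _), integral_const_mul, integral_const_mul,
    integral_const_mul] at h
  have h5 : s * ∫ y, (if t * y ≤ 1 then Real.negMulLog (t * y) else 0) ∂ν ≤
      s * (-(t * Real.log t) * (∫ y, y ∂ν) - t * (∫ y, y ∂ν)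
        + t ^ (1 + q) / q * ∫ y, y ^ (1 + q) ∂ν) := by
    refine mul_le_mul_of_nonneg_left (h.trans ?_) hs
    -- The hypothesis E[ξ log ξ] ≥ m₁ enters here. The resulting term -t s m₁ matches, to first
    -- order, the effect of raising the threshold.
    have : t * ∫ y, y ∂ν ≤ t * ∫ y, y * Real.log y ∂ν := by gcongr
    linarith
  rw [Real.negMulLog]
  refine (add_le_add_right h5 _).trans (le_of_eq ?_)
  ring

end Drift

/-! ### Passing from drift inequalities to a limit. -/

section Sequences

/-- The factor by which the power functional decreases. -/
theorem eventually_power_factor {a q c : ℝ} (ha : 0 ≤ a) (hq : 0 ≤ q) (hq1 : q ≤ 1) (hc : 0 < c) :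
    ∀ᶠ n : ℕ in atTop, (1 + c / 2 / n) * (1 + a / n) ^ (1 + q) ≤ 1 + ((1 + q) * a + c) / n := by
  have hlim := tendsto_const_div_atTop_nhds_zero_nat (a ^ 2 + c * a + c / 2 * a ^ 2)
  -- Half of the slack c is kept in the factor 1 + c / (2 n); the other half absorbs all terms of
  -- order n⁻², whose coefficients are collected in the limit.
  filter_upwards [eventually_ge_atTop 1, hlim.eventually_lt_const (half_pos hc)] with n hn hlt
  have hn' : (1 : ℝ) ≤ n := by exact_mod_cast hn
  have hu : 0 ≤ a / n := by positivity
  have h1 : (1 + a / n) ^ (1 + q) ≤ (1 + a / n) * (1 + q * (a / n)) := by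
    rw [Real.rpow_add (by positivity), Real.rpow_one]
    gcongr
    exact rpow_one_add_le_one_add_mul_self (by linarith) hq hq1
  refine (mul_le_mul_of_nonneg_left h1 (by positivity)).trans ?_
  rw [div_lt_iff₀ (by positivity)] at hlt
  have h2 : q * a ^ 2 ≤ a ^ 2 := by nlinarith [sq_nonneg a]
  have h3 : q * (c * a) ≤ c * a := by nlinarith [mul_nonneg hc.le ha]
  have hexp : (1 + c / 2 / n) * ((1 + a / n) * (1 + q * (a / n))) =
      1 + ((1 + q) * a + c / 2 + (q * a ^ 2 + c / 2 * a + q * (c * a) / 2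
        + c / 2 * (q * a ^ 2) / n) / n) / n := by
    field_simp
    ring
  rw [hexp]
  have h4 : c / 2 * (q * a ^ 2) / n ≤ c / 2 * a ^ 2 := by
    rw [div_le_iff₀ (by positivity)]
    have : c / 2 * (q * a ^ 2) ≤ c / 2 * a ^ 2 := by gcongr
    nlinarith [mul_nonneg (half_pos hc).le (sq_nonneg a)]
  have h5 : (q * a ^ 2 + c / 2 * a + q * (c * a) / 2 + c / 2 * (q * a ^ 2) / n) / n ≤ c / 2 := by
    rw [div_le_iff₀ (by positivity)]
    linarith
  rw [add_le_add_iff_left]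
  exact div_le_div_of_nonneg_right (by linarith) (by positivity)

/-- A sequence argument: mass cannot survive if its part close to the threshold is summable and
its logarithmic moment is bounded. -/
theorem tendsto_zero_of_drift {m A Q H : ℕ → ℝ} {N : ℕ} {c b C q : ℝ} (hN : 1 ≤ N) (hc : 0 < c)
    (hb : 0 ≤ b) (hC : 0 ≤ C)
    (hm0 : ∀ n, 0 ≤ m n) (hA0 : ∀ n, 0 ≤ A n) (hQ0 : ∀ n, 0 ≤ Q n) (hH0 : ∀ n, 0 ≤ H n)
    (hm : ∀ n, N ≤ n → m (n + 1) ≤ m n)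
    (hQ : ∀ n, N ≤ n → Q (n + 1) + c / n * A n ≤ Q n)
    (hH : ∀ n, N ≤ n → H (n + 1) ≤ H n + b / (n : ℝ) ^ 2 * m n + C / n * A n)
    (hsplit : ∀ n, N ≤ n → ∀ R : ℝ, 0 < R → m n ≤ Real.exp (q * R) * A n + H n / R) :
    Tendsto m atTop (𝓝 0) := by
  have hanti : Antitone fun k => m (N + k) :=
    antitone_nat_of_succ_le fun k => by simpa only [Nat.add_assoc] using hm (N + k) (by omega)
  obtain ⟨δ, hδ⟩ : ∃ δ, Tendsto (fun k => m (N + k)) atTop (𝓝 δ) :=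
    ⟨_, tendsto_atTop_ciInf hanti ⟨0, by rintro _ ⟨k, rfl⟩; exact hm0 _⟩⟩
  have hδ0 : 0 ≤ δ := ge_of_tendsto' hδ fun k => hm0 _
  have hδle : ∀ k, δ ≤ m (N + k) := fun k => hanti.le_of_tendsto hδ k
  rcases hδ0.eq_or_lt with rfl | hδpos
  · exact (tendsto_add_atTop_iff_nat N).1 (by simpa only [add_comm] using hδ)
  exfalso
  -- Telescoping the decrease of Q: the total of A n / n is at most Q N / c.
  have hsA : ∀ K, ∑ k ∈ Finset.range K, A (N + k) / (N + k : ℕ) ≤ (Q N - Q (N + K)) / c := by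
    intro K
    induction K with
    | zero => simp
    | succ K ih =>
      rw [Finset.sum_range_succ]
      have h := hQ (N + K) (by omega)
      have h1 : A (N + K) / (N + K : ℕ) ≤ (Q (N + K) - Q (N + K + 1)) / c := by
        rw [le_div_iff₀ hc]
        calc A (N + K) / (N + K : ℕ) * c = c / (N + K : ℕ) * A (N + K) := by ring
          _ ≤ _ := by linarith
      calc _ ≤ (Q N - Q (N + K)) / c + (Q (N + K) - Q (N + K + 1)) / c := add_le_add ih h1
        _ = _ := by rw [← add_assoc]; ring
  have hsummA : Summable fun k => A (N + k) / (N + k : ℕ) :=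
    summable_of_sum_range_le (c := Q N / c) (fun k => div_nonneg (hA0 _) (Nat.cast_nonneg _))
      fun K => (hsA K).trans (by gcongr; linarith [hQ0 (N + K)])
  have hsq : Summable fun k : ℕ => 1 / ((N + k : ℕ) : ℝ) ^ 2 := by
    have := (summable_nat_add_iff N).2 (Real.summable_one_div_nat_pow.2 one_lt_two)
    simpa only [add_comm] using this
  set T1 := ∑' k : ℕ, 1 / ((N + k : ℕ) : ℝ) ^ 2
  set T2 := ∑' k, A (N + k) / (N + k : ℕ)
  -- Both sources of growth of H are now summable, so H stays bounded. The 1 added in `Hmax` below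
  -- only ensures positivity.
  have hHb : ∀ K, H (N + K) ≤ H N + b * m N * ∑ k ∈ Finset.range K, 1 / ((N + k : ℕ) : ℝ) ^ 2
      + C * ∑ k ∈ Finset.range K, A (N + k) / (N + k : ℕ) := by
    intro K
    induction K with
    | zero => simp
    | succ K ih =>
      rw [Finset.sum_range_succ, Finset.sum_range_succ]
      have h := hH (N + K) (by omega)
      have h1 : b / ((N + K : ℕ) : ℝ) ^ 2 * m (N + K) ≤ b / ((N + K : ℕ) : ℝ) ^ 2 * m N := by
        gcongr
        exact hanti (Nat.zero_le K)
      calc H (N + (K + 1)) ≤ _ := h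
        _ ≤ (H N + b * m N * ∑ k ∈ Finset.range K, 1 / ((N + k : ℕ) : ℝ) ^ 2
            + C * ∑ k ∈ Finset.range K, A (N + k) / (N + k : ℕ))
            + b / ((N + K : ℕ) : ℝ) ^ 2 * m N + C / (N + K : ℕ) * A (N + K) := by gcongr
        _ = _ := by ring
  set Hmax := H N + b * m N * T1 + C * T2 + 1 with hHmax
  have hHle : ∀ K, H (N + K) ≤ Hmax := by
    intro K
    refine (hHb K).trans ?_
    have h1 := hsq.sum_le_tsum (Finset.range K) fun k _ => by positivity
    have h2 := hsummA.sum_le_tsum (Finset.range K)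
      fun k _ => div_nonneg (hA0 _) (Nat.cast_nonneg _)
    have h3 : b * m N * ∑ k ∈ Finset.range K, 1 / ((N + k : ℕ) : ℝ) ^ 2 ≤ b * m N * T1 :=
      mul_le_mul_of_nonneg_left h1 (mul_nonneg hb (hm0 N))
    have h4 := mul_le_mul_of_nonneg_left h2 hC
    linarith
  have hHmax0 : 0 < Hmax := by
    have h1 : 0 ≤ T1 := tsum_nonneg fun k => by positivity
    have h2 : 0 ≤ T2 := tsum_nonneg fun k => div_nonneg (hA0 _) (Nat.cast_nonneg _)
    have h3 := mul_nonneg (mul_nonneg hb (hm0 N)) h1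
    have h4 := mul_nonneg hC h2
    linarith [hH0 N]
  -- With this R the logarithmic part of the splitting is at most δ / 2, so A carries the rest of
  -- the mass and is bounded below.
  set R := 2 * Hmax / δ with hR
  have hR0 : 0 < R := by positivity
  have hlow : ∀ k, Real.exp (-(q * R)) * (δ / 2) ≤ A (N + k) := by
    intro k
    have h1 := hsplit (N + k) (by omega) R hR0
    have h2 : H (N + k) / R ≤ δ / 2 := by
      rw [div_le_iff₀ hR0, hR]
      calc H (N + k) ≤ Hmax := hHle k
        _ = δ / 2 * (2 * Hmax / δ) := by field_simp
    have h3 : δ / 2 ≤ Real.exp (q * R) * A (N + k) := by linarith [hδle k]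
    calc Real.exp (-(q * R)) * (δ / 2) ≤ Real.exp (-(q * R)) * (Real.exp (q * R) * A (N + k)) := by
          gcongr
      _ = A (N + k) := by rw [← mul_assoc, ← Real.exp_add]; simp
  have hd : 0 < Real.exp (-(q * R)) * (δ / 2) := by positivity
  -- A lower bound on A turns the convergence of the sum of A n / n into that of the harmonic
  -- series.
  have hharm : Summable fun k => Real.exp (-(q * R)) * (δ / 2) * (1 / ((N + k : ℕ) : ℝ)) := by
    refine Summable.of_nonneg_of_le (fun k => by positivity) (fun k => ?_) hsummA
    rw [mul_one_div]
    gcongr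
    exact hlow k
  rw [summable_mul_left_iff hd.ne'] at hharm
  refine Real.not_summable_one_div_natCast ((summable_nat_add_iff N).1 ?_)
  simpa only [add_comm] using hharm

end Sequences

end RWES

namespace RWES

/-! ### Degeneracy of the components: the killed tree -/

/-- Killing of the vertices whose weight exceeds `K * growth a n`. -/
noncomputable def kill (K a : ℝ) (n : ℕ) (w : ℝ) : ℝ := if w ≤ K * growth a n then w else 0

theorem measurable_kill (K a : ℝ) (n : ℕ) : Measurable (kill K a n) :=
  Measurable.ite measurableSet_Iic measurable_id measurable_const

/-- The weights of the component rooted at `r` with killing. -/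
noncomputable def killedWeight {Ω : Type*} (K a : ℝ) (r : ℕ) (ε : ℕ → Ω → ℝ) (U : ℕ → Ω → ℕ)
    (ξ : ℕ → Ω → ℝ) (ω : Ω) (n : ℕ) : ℝ :=
  filteredStep (kill K a) (fun n _ => indicatorSpin r n) ε U ξ ω n

/-- Test functions: measurable, nonnegative and bounded on `[0, 1]`. -/
structure IsTest (φ : ℝ → ℝ) : Prop where
  measurable : Measurable φ
  nonneg : ∀ x, 0 ≤ x → x ≤ 1 → 0 ≤ φ x
  bounded : ∃ C, ∀ x, 0 ≤ x → x ≤ 1 → φ x ≤ C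

theorem IsTest.add {φ ψ : ℝ → ℝ} (hφ : IsTest φ) (hψ : IsTest ψ) :
    IsTest (fun x => φ x + ψ x) where
  measurable := hφ.measurable.add hψ.measurable
  nonneg x h0 h1 := add_nonneg (hφ.nonneg x h0 h1) (hψ.nonneg x h0 h1)
  bounded := by
    obtain ⟨C, hC⟩ := hφ.bounded
    obtain ⟨D, hD⟩ := hψ.bounded
    exact ⟨C + D, fun x h0 h1 => add_le_add (hC x h0 h1) (hD x h0 h1)⟩

theorem IsTest.const_mul {φ : ℝ → ℝ} (hφ : IsTest φ) {c : ℝ} (hc : 0 ≤ c) :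
    IsTest (fun x => c * φ x) where
  measurable := hφ.measurable.const_mul c
  nonneg x h0 h1 := mul_nonneg hc (hφ.nonneg x h0 h1)
  bounded := by
    obtain ⟨C, hC⟩ := hφ.bounded
    exact ⟨c * C, fun x h0 h1 => mul_le_mul_of_nonneg_left (hC x h0 h1) hc⟩

theorem isTest_id : IsTest (fun x => x) where
  measurable := measurable_id
  nonneg _ h0 _ := h0
  bounded := ⟨1, fun _ _ h1 => h1⟩

theorem isTest_mul_rpow {q : ℝ} (hq : 0 ≤ q) : IsTest (fun x => x * x ^ q) where
  measurable := measurable_id.mul (measurable_id.pow_const q)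
  nonneg x h0 _ := by positivity
  bounded := ⟨1, fun x h0 h1 => mul_le_one₀ h1 (by positivity) (Real.rpow_le_one h0 h1 hq)⟩

theorem isTest_power {q β : ℝ} (hq : 0 ≤ q) (hβ : 1 ≤ β) :
    IsTest (fun x => x * (β ^ q - x ^ q)) where
  measurable := measurable_id.mul (measurable_const.sub (measurable_id.pow_const q))
  nonneg x h0 h1 := mul_nonneg h0
    (sub_nonneg.2 (Real.rpow_le_rpow h0 (h1.trans hβ) hq))
  bounded := ⟨β ^ q, fun x h0 h1 => by
    have h2 : 0 ≤ x ^ q := by positivity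
    have h3 : 0 ≤ β ^ q := by positivity
    nlinarith [mul_nonneg h0 h2]⟩

theorem isTest_negMulLog : IsTest Real.negMulLog where
  measurable := Real.continuous_negMulLog.measurable
  nonneg x h0 h1 := Real.negMulLog_nonneg h0 h1
  bounded := by
    obtain ⟨C, hC⟩ := isCompact_Icc.bddAbove_image
      (Real.continuous_negMulLog.continuousOn (s := Set.Icc (0 : ℝ) 1))
    exact ⟨C, fun x h0 h1 => hC ⟨x, ⟨h0, h1⟩, rfl⟩⟩

variable {Ω : Type*} [MeasurableSpace Ω]

set_option linter.unusedSectionVars false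

variable {P : Measure Ω} [IsProbabilityMeasure P] {p : ℝ} {νX νξ : Measure ℝ}
  {X ε : ℕ → Ω → ℝ} {U : ℕ → Ω → ℕ} {ξ : ℕ → Ω → ℝ} {K a : ℝ} {r : ℕ}

/-- The mean of the test function `φ` over the killed component, with weights normalised by the
threshold. -/
noncomputable def profile (P : Measure Ω) (K a : ℝ) (r : ℕ) (ε : ℕ → Ω → ℝ) (U : ℕ → Ω → ℕ)
    (ξ : ℕ → Ω → ℝ) (n : ℕ) (φ : ℝ → ℝ) : ℝ :=
  ∫ ω, ∑ k ∈ Finset.Icc 1 n, φ (killedWeight K a r ε U ξ ω k / (K * growth a n)) ∂P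

theorem Regular.killedWeight_nonneg {ω : Ω} (h : Regular ε U ξ ω) {n : ℕ} (hn : 1 ≤ n) :
    0 ≤ killedWeight K a r ε U ξ ω n := by
  have hkill : ∀ n w, 0 ≤ w → 0 ≤ kill K a n w := fun n w hw => by
    unfold kill; split_ifs <;> first | exact hw | exact le_rfl
  refine h.induction (motive := fun n => 0 ≤ killedWeight K a r ε U ξ ω n) ?_ ?_ ?_ hn
  · rw [killedWeight, filteredStep_one]
    exact hkill _ _ (indicatorSpin_nonneg r 1)
  · intro n h2 h0
    rw [killedWeight, filteredStep_of_eq_zero h2 h0]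
    exact hkill _ _ (indicatorSpin_nonneg r n)
  · intro n h2 h1 _ hU hx ih
    rw [killedWeight, filteredStep_of_eq_one h2 h1 hU]
    exact hkill _ _ (mul_nonneg hx ih)

theorem Regular.killedWeight_le {ω : Ω} (hK : 0 < K) (ha : 0 ≤ a) (h : Regular ε U ξ ω) {n : ℕ}
    (hn : 1 ≤ n) : killedWeight K a r ε U ξ ω n ≤ K * growth a n := by
  have hkill : ∀ n w, kill K a n w ≤ K * growth a n := fun n w => by
    have := growth_pos ha n
    unfold kill; split_ifs with h
    · exact h
    · positivity
  refine h.induction (motive := fun n => killedWeight K a r ε U ξ ω n ≤ K * growth a n) ?_ ?_ ?_ hn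
  · rw [killedWeight, filteredStep_one]
    exact hkill _ _
  · intro n h2 h0
    rw [killedWeight, filteredStep_of_eq_zero h2 h0]
    exact hkill _ _
  · intro n h2 h1 _ hU hx ih
    rw [killedWeight, filteredStep_of_eq_one h2 h1 hU]
    exact hkill _ _

theorem Regular.killedWeight_div_mem {ω : Ω} (hK : 0 < K) (ha : 0 ≤ a) (h : Regular ε U ξ ω)
    {n k : ℕ} (hk : k ∈ Finset.Icc 1 n) :
    0 ≤ killedWeight K a r ε U ξ ω k / (K * growth a n) ∧
      killedWeight K a r ε U ξ ω k / (K * growth a n) ≤ 1 := by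
  rw [Finset.mem_Icc] at hk
  have hG := growth_pos ha n
  refine ⟨div_nonneg (h.killedWeight_nonneg hk.1) (by positivity), ?_⟩
  rw [div_le_one (by positivity)]
  refine (h.killedWeight_le hK ha hk.1).trans ?_
  gcongr
  exact growth_mono ha hk.2

/-- If no true weight ever exceeds the threshold, no vertex is killed. This transfers the vanishing
of the killed mass to the actual component. -/
theorem Regular.killedWeight_eq {ω : Ω} (h : Regular ε U ξ ω)
    (hle : ∀ n, 1 ≤ n → step (fun n _ => indicatorSpin r n) ε U ξ ω n ≤ K * growth a n)
    {n : ℕ} (hn : 1 ≤ n) :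
    killedWeight K a r ε U ξ ω n = step (fun n _ => indicatorSpin r n) ε U ξ ω n := by
  refine h.induction (motive := fun n => killedWeight K a r ε U ξ ω n =
    step (fun n _ => indicatorSpin r n) ε U ξ ω n) ?_ ?_ ?_ hn
  · have := hle 1 le_rfl
    rw [step_one] at this
    rw [killedWeight, filteredStep_one, step_one, kill, if_pos this]
  · intro n h2 h0
    have := hle n (by omega)
    rw [step_of_eq_zero h2 h0] at this
    rw [killedWeight, filteredStep_of_eq_zero h2 h0, step_of_eq_zero h2 h0, kill, if_pos this]
  · intro n h2 h1 _ hU hx ih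
    have := hle n (by omega)
    rw [step_of_eq_one h2 h1 hU, ← ih] at this
    rw [killedWeight, filteredStep_of_eq_one h2 h1 hU, step_of_eq_one h2 h1 hU, ← ih, kill]
    exact if_pos this

namespace Model

theorem measurable_killedWeight (M : Model P p νX νξ X ε U ξ) {n N : ℕ} (hn : n ≤ N) :
    Measurable[M.history N] (fun ω => killedWeight K a r ε U ξ ω n) :=
  M.measurable_filteredStep (g := fun n _ => indicatorSpin r n) (measurable_kill K a)
    (fun _ => measurable_const) hn

theorem measurable_killedWeight_ambient (M : Model P p νX νξ X ε U ξ) (n : ℕ) :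
    Measurable (fun ω => killedWeight K a r ε U ξ ω n) :=
  (M.measurable_killedWeight le_rfl).mono (M.sigma_le _) le_rfl

theorem measurable_profile_term (M : Model P p νX νξ X ε U ξ) {φ : ℝ → ℝ} (hφ : IsTest φ)
    (k n : ℕ) : Measurable (fun ω => φ (killedWeight K a r ε U ξ ω k / (K * growth a n))) :=
  hφ.measurable.comp ((M.measurable_killedWeight_ambient k).div_const _)

theorem integrable_profile_term (M : Model P p νX νξ X ε U ξ) (hK : 0 < K) (ha : 0 ≤ a)
    {φ : ℝ → ℝ} (hφ : IsTest φ) {k n : ℕ} (hk : k ∈ Finset.Icc 1 n) :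
    Integrable (fun ω => φ (killedWeight K a r ε U ξ ω k / (K * growth a n))) P := by
  obtain ⟨C, hC⟩ := hφ.bounded
  refine Integrable.of_bound (M.measurable_profile_term hφ k n).aestronglyMeasurable C ?_
  filter_upwards [M.regular] with ω hω
  obtain ⟨h0, h1⟩ := hω.killedWeight_div_mem (r := r) hK ha hk
  rw [Real.norm_of_nonneg (hφ.nonneg _ h0 h1)]
  exact hC _ h0 h1

theorem integrable_profile (M : Model P p νX νξ X ε U ξ) (hK : 0 < K) (ha : 0 ≤ a)
    {φ : ℝ → ℝ} (hφ : IsTest φ) (n : ℕ) : Integrable (fun ω => ∑ k ∈ Finset.Icc 1 n,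
      φ (killedWeight K a r ε U ξ ω k / (K * growth a n))) P :=
  integrable_finsetSum _ fun _ hk => M.integrable_profile_term hK ha hφ hk

theorem profile_nonneg (M : Model P p νX νξ X ε U ξ) (hK : 0 < K) (ha : 0 ≤ a)
    {φ : ℝ → ℝ} (hφ : IsTest φ) (n : ℕ) : 0 ≤ profile P K a r ε U ξ n φ := by
  refine integral_nonneg_of_ae ?_
  filter_upwards [M.regular] with ω hω
  refine Finset.sum_nonneg fun k hk => ?_
  obtain ⟨h0, h1⟩ := hω.killedWeight_div_mem (r := r) hK ha hk
  exact hφ.nonneg _ h0 h1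

theorem ofReal_profile (M : Model P p νX νξ X ε U ξ) (hK : 0 < K) (ha : 0 ≤ a)
    {φ : ℝ → ℝ} (hφ : IsTest φ) (n : ℕ) :
    ENNReal.ofReal (profile P K a r ε U ξ n φ) = ∑ k ∈ Finset.Icc 1 n, ∫⁻ ω,
      ENNReal.ofReal (φ (killedWeight K a r ε U ξ ω k / (K * growth a n))) ∂P := by
  have hnn : ∀ᵐ ω ∂P, ∀ k ∈ Finset.Icc 1 n,
      0 ≤ φ (killedWeight K a r ε U ξ ω k / (K * growth a n)) := by
    filter_upwards [M.regular] with ω hω k hk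
    obtain ⟨h0, h1⟩ := hω.killedWeight_div_mem (r := r) hK ha hk
    exact hφ.nonneg _ h0 h1
  rw [profile, integral_finsetSum _ fun k hk => M.integrable_profile_term hK ha hφ hk,
    ENNReal.ofReal_sum_of_nonneg]
  · refine Finset.sum_congr rfl fun k hk => ?_
    rw [ofReal_integral_eq_lintegral_ofReal (M.integrable_profile_term hK ha hφ hk)]
    filter_upwards [hnn] with ω hω using hω k hk
  · intro k hk
    refine integral_nonneg_of_ae ?_
    filter_upwards [hnn] with ω hω using hω k hk

theorem profile_add (M : Model P p νX νξ X ε U ξ) (hK : 0 < K) (ha : 0 ≤ a)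
    {φ ψ : ℝ → ℝ} (hφ : IsTest φ) (hψ : IsTest ψ) (n : ℕ) :
    profile P K a r ε U ξ n (fun x => φ x + ψ x) =
      profile P K a r ε U ξ n φ + profile P K a r ε U ξ n ψ := by
  simp only [profile, Finset.sum_add_distrib]
  exact integral_add (M.integrable_profile hK ha hφ n) (M.integrable_profile hK ha hψ n)

theorem profile_const_mul (c : ℝ) (φ : ℝ → ℝ) (n : ℕ) :
    profile P K a r ε U ξ n (fun x => c * φ x) = c * profile P K a r ε U ξ n φ := by
  simp only [profile, ← Finset.mul_sum]
  exact integral_const_mul _ _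

theorem profile_mono (M : Model P p νX νξ X ε U ξ) (hK : 0 < K) (ha : 0 ≤ a)
    {φ ψ : ℝ → ℝ} (hφ : IsTest φ) (hψ : IsTest ψ) (h : ∀ x, 0 ≤ x → x ≤ 1 → φ x ≤ ψ x) (n : ℕ) :
    profile P K a r ε U ξ n φ ≤ profile P K a r ε U ξ n ψ := by
  refine integral_mono_ae (M.integrable_profile hK ha hφ n) (M.integrable_profile hK ha hψ n) ?_
  filter_upwards [M.regular] with ω hω
  refine Finset.sum_le_sum fun k hk => ?_
  obtain ⟨h0, h1⟩ := hω.killedWeight_div_mem (r := r) hK ha hk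
  exact h _ h0 h1

/-- Comparison of the profiles at consecutive times. -/
theorem profile_succ_le (M : Model P p νX νξ X ε U ξ) (hK : 0 < K) (ha : 0 ≤ a)
    {φ ψ γ : ℝ → ℝ} (hφ : IsTest φ) (hψ : IsTest ψ) (hγ : IsTest γ) (hφ0 : φ 0 = 0)
    {n : ℕ} (hn : 1 ≤ n) (hr : r ≤ n)
    (h : ∀ t, 0 ≤ t → t * (1 + a / n) ≤ 1 →
      φ t + p / n * ∫ y, (if t * y ≤ 1 then φ (t * y) else 0) ∂νξ + γ (t * (1 + a / n)) ≤
        ψ (t * (1 + a / n))) :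
    profile P K a r ε U ξ (n + 1) φ + profile P K a r ε U ξ n γ ≤ profile P K a r ε U ξ n ψ := by
  have hprob := M.isProbabilityMeasure_echo
  have hp := M.p_pos
  have hG := growth_pos ha n
  have hG' := growth_pos ha (n + 1)
  have hρ : 0 < 1 + a / n := by positivity
  rw [← ENNReal.ofReal_le_ofReal_iff (M.profile_nonneg hK ha hψ n),
    ENNReal.ofReal_add (M.profile_nonneg hK ha hφ _) (M.profile_nonneg hK ha hγ n),
    M.ofReal_profile hK ha hφ, M.ofReal_profile hK ha hψ, M.ofReal_profile hK ha hγ,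
    Finset.sum_Icc_succ_top (by omega)]
  -- Since n + 1 > r, a vertex with a cut edge starts with weight 0 and φ vanishes there; only
  -- copies of earlier vertices contribute.
  have hnew : ∫⁻ ω, ENNReal.ofReal
      (φ (killedWeight K a r ε U ξ ω (n + 1) / (K * growth a (n + 1)))) ∂P =
      ENNReal.ofReal (p / n) * ∑ k ∈ Finset.Icc 1 n, ∫⁻ ω, ∫⁻ y, ENNReal.ofReal
        (φ (kill K a (n + 1) (y * killedWeight K a r ε U ξ ω k) / (K * growth a (n + 1)))) ∂νξ ∂P := by
    have h1 := M.lintegral_filteredStep_succ M.p_pos M.p_lt_one M.echo_nonneg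
      (measurable_kill K a) (g := fun n _ => indicatorSpin r n) (fun _ => measurable_const) hn
      (V := fun _ => ()) measurable_const
      (F := fun z : Unit × ℝ => ENNReal.ofReal (φ (z.2 / (K * growth a (n + 1)))))
      (hφ.measurable.comp (measurable_snd.div_const _)).ennreal_ofReal
    have h2 : φ (kill K a (n + 1) (indicatorSpin r (n + 1)) / (K * growth a (n + 1))) = 0 := by
      rw [indicatorSpin, if_neg (by omega), kill, ite_self, zero_div, hφ0]
    simp only [h2, ENNReal.ofReal_zero, lintegral_zero, mul_zero, zero_add] at h1
    exact h1
  -- The comparison is made vertex by vertex: the vertex k seen against the new threshold, plus its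
  -- share of the new child, against k seen at the old threshold.
  have hterm : ∀ᵐ ω ∂P, ∀ k ∈ Finset.Icc 1 n,
      ENNReal.ofReal (φ (killedWeight K a r ε U ξ ω k / (K * growth a (n + 1)))) +
      ENNReal.ofReal (p / n) * ∫⁻ y, ENNReal.ofReal
        (φ (kill K a (n + 1) (y * killedWeight K a r ε U ξ ω k) / (K * growth a (n + 1)))) ∂νξ +
      ENNReal.ofReal (γ (killedWeight K a r ε U ξ ω k / (K * growth a n))) ≤
      ENNReal.ofReal (ψ (killedWeight K a r ε U ξ ω k / (K * growth a n))) := by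
    filter_upwards [M.regular] with ω hω k hk
    obtain ⟨h0, h1⟩ := hω.killedWeight_div_mem (r := r) hK ha hk
    set w := killedWeight K a r ε U ξ ω k
    set t := w / (K * growth a (n + 1)) with ht
    have hx : w / (K * growth a n) = t * (1 + a / n) := by
      rw [ht, growth_succ hn]
      field_simp
    have hw : 0 ≤ w := hω.killedWeight_nonneg (Finset.mem_Icc.1 hk).1
    have ht0 : 0 ≤ t := div_nonneg hw (by positivity)
    rw [hx] at h1 ⊢
    have ht1 : t ≤ 1 := by
      refine le_trans ?_ h1
      refine le_mul_of_one_le_right ht0 ?_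
      have : 0 ≤ a / n := by positivity
      linarith
    have hkill : ∀ y, φ (kill K a (n + 1) (y * w) / (K * growth a (n + 1))) =
        if t * y ≤ 1 then φ (t * y) else 0 := by
      intro y
      have h1 : t * y = y * w / (K * growth a (n + 1)) := by rw [ht]; ring
      have h2 : t * y ≤ 1 ↔ y * w ≤ K * growth a (n + 1) := by
        rw [h1, div_le_one (by positivity)]
      rw [kill]
      by_cases h3 : t * y ≤ 1
      · rw [if_pos h3, if_pos (h2.1 h3), h1]
      · rw [if_neg h3, if_neg (mt h2.2 h3), zero_div, hφ0]
    simp only [hkill]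
    have hnn : 0 ≤ᵐ[νξ] fun y => if t * y ≤ 1 then φ (t * y) else 0 := by
      filter_upwards [M.echo_nonneg] with y hy
      simp only [Pi.zero_apply]
      split_ifs with h3
      · exact hφ.nonneg _ (by positivity) h3
      · exact le_rfl
    have hint : Integrable (fun y => if t * y ≤ 1 then φ (t * y) else 0) νξ := by
      obtain ⟨C, hC⟩ := hφ.bounded
      have hC0 : 0 ≤ C := (hφ.nonneg 0 le_rfl zero_le_one).trans (hC 0 le_rfl zero_le_one)
      refine Integrable.of_bound (Measurable.ite (measurableSet_le (by fun_prop) (by fun_prop))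
        (hφ.measurable.comp (by fun_prop)) measurable_const).aestronglyMeasurable C ?_
      filter_upwards [M.echo_nonneg, hnn] with y hy hy'
      rw [Real.norm_of_nonneg hy']
      split_ifs with h3
      · exact hC _ (by positivity) h3
      · exact hC0
    rw [← ofReal_integral_eq_lintegral_ofReal hint hnn, ← ENNReal.ofReal_mul (by positivity),
      ← ENNReal.ofReal_add (hφ.nonneg _ ht0 ht1)
        (mul_nonneg (by positivity) (integral_nonneg_of_ae hnn)),
      ← ENNReal.ofReal_add (add_nonneg (hφ.nonneg _ ht0 ht1)
        (mul_nonneg (by positivity) (integral_nonneg_of_ae hnn)))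
        (hγ.nonneg _ (by positivity) h1)]
    exact ENNReal.ofReal_le_ofReal (h t ht0 h1)
  rw [hnew, Finset.mul_sum, ← Finset.sum_add_distrib, ← Finset.sum_add_distrib]
  refine Finset.sum_le_sum fun k hk => ?_
  have hm1 : Measurable fun ω => ENNReal.ofReal
      (φ (killedWeight K a r ε U ξ ω k / (K * growth a (n + 1)))) :=
    (M.measurable_profile_term hφ k (n + 1)).ennreal_ofReal
  have hm2 : Measurable fun ω => ∫⁻ y, ENNReal.ofReal
      (φ (kill K a (n + 1) (y * killedWeight K a r ε U ξ ω k) / (K * growth a (n + 1)))) ∂νξ := by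
    refine Measurable.lintegral_prod_right' (f := fun z : Ω × ℝ => ENNReal.ofReal
      (φ (kill K a (n + 1) (z.2 * killedWeight K a r ε U ξ z.1 k) / (K * growth a (n + 1))))) ?_
    exact (hφ.measurable.comp (((measurable_kill K a _).comp (measurable_snd.mul
      ((M.measurable_killedWeight_ambient k).comp measurable_fst))).div_const _)).ennreal_ofReal
  rw [← lintegral_const_mul _ hm2, ← lintegral_add_left hm1,
    ← lintegral_add_right _ (M.measurable_profile_term hγ k n).ennreal_ofReal]
  refine lintegral_mono_ae ?_
  filter_upwards [hterm] with ω hω using hω k hk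

/-- The killed mass tends to zero when `m₁ ≤ E[ξ log ξ]`. -/
theorem tendsto_profile_id (M : Model P p νX νξ X ε U ξ) (hK : 0 < K) {q : ℝ} (hq : 0 < q)
    (hq1 : q ≤ 1) (hint : Integrable (fun y : ℝ => y ^ (1 + q)) νξ)
    (hlog : ∫ y, y ∂νξ ≤ ∫ y, y * Real.log y ∂νξ) :
    Tendsto (fun n => profile P K (p * ∫ y, y ∂νξ) r ε U ξ n (fun x => x)) atTop (𝓝 0) := by
  have hprob := M.isProbabilityMeasure_echo
  have hp := M.p_pos
  have ha := M.exponent_nonneg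
  have hν := M.echo_nonneg
  have hid := M.echo_integrable
  set m₁ := ∫ y, y ∂νξ with hm₁
  set a := p * m₁ with ha_def
  -- Since p < 1, supercriticality forces m₁ > 1, which the strict convexity bound requires.
  have hm1 : 1 < m₁ := by
    have h1 := M.super
    have h2 := M.p_lt_one
    rw [← hm₁] at h1
    by_contra! h
    nlinarith
  obtain ⟨β, hβ1, hβ⟩ := exists_truncation hq hν hint (lt_integral_rpow hq hν hid hint hm1 hlog)
  have hβint : Integrable (fun y : ℝ => y * (min y β) ^ q) νξ := by
    refine hint.mono' (measurable_id.mul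
      ((measurable_id.min measurable_const).pow_const q)).aestronglyMeasurable ?_
    filter_upwards [hν] with y hy
    have h0 : 0 ≤ min y β := le_min hy (by linarith)
    rw [Real.norm_of_nonneg (by positivity)]
    rcases hy.eq_or_lt with rfl | hy
    · simpa using Real.zero_rpow_nonneg _
    · rw [Real.rpow_add hy, Real.rpow_one]
      gcongr
      exact min_le_left _ _
  set I := ∫ y, y * (min y β) ^ q ∂νξ with hI
  -- The excess of the truncated moment over (1 + q) m₁, multiplied by p; it drives the decrease of
  -- the power functional.
  set c := p * I - (1 + q) * a with hc_def
  have hc : 0 < c := by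
    rw [hc_def, ha_def]
    nlinarith
  set D := p * ((∫ y, y ^ (1 + q) ∂νξ) / q) with hD
  have hD0 : 0 ≤ D := by
    have : 0 ≤ ∫ y, y ^ (1 + q) ∂νξ := by
      refine integral_nonneg_of_ae ?_
      filter_upwards [hν] with y hy
      simp only [Pi.zero_apply]
      positivity
    positivity
  obtain ⟨N₀, hN₀⟩ := eventually_atTop.1 (eventually_power_factor ha hq.le hq1 hc)
  have hTA := isTest_mul_rpow hq.le
  have hTQ := isTest_power hq.le hβ1
  have hTz : IsTest (fun _ => (0 : ℝ)) :=
    ⟨measurable_const, fun _ _ _ => le_rfl, 0, fun _ _ _ => le_rfl⟩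
  have hz : ∀ n, profile P K a r ε U ξ n (fun _ => 0) = 0 := fun n => by simp [profile]
  -- The start N is at least r so that no new root of the component appears, at least N₀ for the
  -- power factor, and at least 1. The value b = a² is the second-order error of the logarithmic
  -- drift.
  refine tendsto_zero_of_drift (N := max N₀ (max r 1)) (c := c / 2) (b := a ^ 2) (C := D) (q := q)
    (A := fun n => profile P K a r ε U ξ n (fun x => x * x ^ q))
    (Q := fun n => profile P K a r ε U ξ n (fun x => x * (β ^ q - x ^ q)))
    (H := fun n => profile P K a r ε U ξ n Real.negMulLog)
    (by simp) (by positivity) (by positivity) hD0 (fun n => M.profile_nonneg hK ha isTest_id n)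
    (fun n => M.profile_nonneg hK ha hTA n) (fun n => M.profile_nonneg hK ha hTQ n)
    (fun n => M.profile_nonneg hK ha isTest_negMulLog n) ?_ ?_ ?_ ?_
  · intro n hn
    simp only [max_le_iff] at hn
    have h := M.profile_succ_le (r := r) hK ha isTest_id isTest_id hTz rfl hn.2.2 hn.2.1 ?_
    · rw [hz] at h
      linarith
    · intro t ht _
      have := mass_drift (s := p / n) (t := t) (x := t * (1 + a / n)) (by positivity) hν hid ht
        (by rw [ha_def]; ring)
      linarith
  · intro n hn
    simp only [max_le_iff] at hn
    have h := M.profile_succ_le (r := r) hK ha hTQ hTQ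
      (hTA.const_mul (c := c / 2 / n) (by positivity)) (by simp) hn.2.2 hn.2.1 ?_
    · rwa [profile_const_mul] at h
    · intro t ht htx
      have hu : 0 ≤ a / n := by positivity
      have ht1 : t ≤ 1 := le_trans (le_mul_of_one_le_right ht (by linarith)) htx
      have h1 := power_drift (s := p / n) (t := t) (by positivity) hq hν hid ht ht1 hβ1 hβint
      have h2 : p / n * ∫ y, y ∂νξ = a / n := by rw [ha_def, hm₁]; ring
      rw [h2, ← hI] at h1
      have h3 := hN₀ n hn.1
      have h4 : (t * (1 + a / n)) ^ q = t ^ q * (1 + a / n) ^ q := Real.mul_rpow ht (by positivity)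
      have h5 : (1 + a / n) ^ (1 + q) = (1 + a / n) * (1 + a / n) ^ q := by
        rw [Real.rpow_add (by positivity), Real.rpow_one]
      have h6 : ((1 + q) * a + c) / n = p / n * I := by rw [hc_def]; ring
      rw [h5, h6] at h3
      -- The factor inequality scaled by t^{1+q}: the gain p I / n in the power term exceeds the
      -- cost of rescaling by c / (2 n) times x^{1+q}.
      have h7 := mul_le_mul_of_nonneg_left h3 (by positivity : 0 ≤ t * t ^ q)
      rw [h4]
      calc _ ≤ t * (1 + a / n) * β ^ q - t * t ^ q * (1 + p / n * I)
            + c / 2 / n * (t * (1 + a / n) * (t ^ q * (1 + a / n) ^ q)) := by gcongr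
        _ ≤ t * (1 + a / n) * β ^ q - t * t ^ q * ((1 + c / 2 / n) *
              ((1 + a / n) * (1 + a / n) ^ q))
            + c / 2 / n * (t * (1 + a / n) * (t ^ q * (1 + a / n) ^ q)) := by gcongr
        _ = _ := by ring
  · intro n hn
    simp only [max_le_iff] at hn
    have hT1 := isTest_id.const_mul (c := a ^ 2 / (n : ℝ) ^ 2) (by positivity)
    have hT2 := hTA.const_mul (c := D / n) (by positivity)
    have h := M.profile_succ_le (r := r) hK ha isTest_negMulLog
      ((isTest_negMulLog.add hT1).add hT2) hTz (by simp) hn.2.2 hn.2.1 ?_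
    · rw [hz, M.profile_add hK ha (isTest_negMulLog.add hT1) hT2,
        M.profile_add hK ha isTest_negMulLog hT1, profile_const_mul, profile_const_mul] at h
      linarith
    · intro t ht htx
      have hn' : (1 : ℝ) ≤ n := by exact_mod_cast hn.2.2
      have hu : 0 ≤ a / n := by positivity
      have h1 := log_drift (s := p / n) (t := t) (by positivity) hq hν hid hint hlog ht
      have h2 : p / n * ∫ y, y ∂νξ = a / n := by rw [ha_def, hm₁]; ring
      rw [h2] at h1
      rcases ht.eq_or_lt with rfl | ht
      · simp
      have hx : t ≤ t * (1 + a / n) := le_mul_of_one_le_right ht.le (by linarith)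
      have h3 : Real.log (1 + a / n) ≤ a / n := by
        have := Real.log_le_sub_one_of_pos (by positivity : 0 < 1 + a / n)
        linarith
      have h4 : t ^ (1 + q) ≤ t * (1 + a / n) * (t * (1 + a / n)) ^ q := by
        rw [Real.rpow_add ht, Real.rpow_one]
        gcongr
      have h5 : p / n * (t ^ (1 + q) * ((∫ y, y ^ (1 + q) ∂νξ) / q)) =
          D / n * t ^ (1 + q) := by rw [hD]; ring
      rw [h5] at h1
      have h6 : D / n * t ^ (1 + q) ≤ D / n * (t * (1 + a / n) * (t * (1 + a / n)) ^ q) := by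
        gcongr
      have h7 : Real.negMulLog (t * (1 + a / n)) = -(t * (1 + a / n)) * Real.log t
          - t * (1 + a / n) * Real.log (1 + a / n) := by
        rw [Real.negMulLog, Real.log_mul ht.ne' (by positivity)]
        ring
      have h8 : t * (1 + a / n) * Real.log (1 + a / n) ≤ t * (1 + a / n) * (a / n) := by gcongr
      -- With u = a / n, the mismatch t (1 + u) u - t u equals t u², a summable multiple of the
      -- mass.
      have h9 : t * (1 + a / n) * (a / n) - t * (a / n)
          ≤ a ^ 2 / (n : ℝ) ^ 2 * (t * (1 + a / n)) := by
        have : t * (1 + a / n) * (a / n) - t * (a / n) = a ^ 2 / (n : ℝ) ^ 2 * t := by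
          field_simp
          ring
        rw [this]
        gcongr
      rw [h7]
      linarith
  · intro n _ R hR
    have hT1 := hTA.const_mul (c := Real.exp (q * R)) (by positivity)
    have hT2 := isTest_negMulLog.const_mul (c := 1 / R) (by positivity)
    have h := M.profile_mono (r := r) hK ha isTest_id (hT1.add hT2) (fun x h0 h1 => ?_) n
    · rw [M.profile_add hK ha hT1 hT2, profile_const_mul, profile_const_mul] at h
      calc _ ≤ _ := h
        _ = _ := by ring
    · rcases h0.eq_or_lt with rfl | h0
      · simp
      have h2 := Real.negMulLog_nonneg h0.le h1
      -- Weights above e^{-R} are controlled by the power functional, smaller ones by the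
      -- logarithmic functional through Markov's inequality.
      rcases le_total (-Real.log x) R with h3 | h3
      · have h4 : 1 ≤ Real.exp (q * R) * x ^ q := by
          rw [Real.rpow_def_of_pos h0, ← Real.exp_add]
          refine Real.one_le_exp ?_
          nlinarith
        have h5 : 0 ≤ 1 / R * Real.negMulLog x := by positivity
        nlinarith
      · have h4 : x ≤ 1 / R * Real.negMulLog x := by
          rw [Real.negMulLog, one_div, ← div_eq_inv_mul, le_div_iff₀ hR]
          nlinarith
        have h5 : 0 ≤ Real.exp (q * R) * (x * x ^ q) := by positivity
        linarith

/-- The components are degenerate when `m₁ ≤ E[ξ log ξ]`. -/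
theorem subtreeLimit_eq_zero (M : Model P p νX νξ X ε U ξ) {q : ℝ} (hq : 0 < q)
    (hq1 : q ≤ 1) (hint : Integrable (fun y : ℝ => y ^ (1 + q)) νξ)
    (hlog : ∫ y, y ∂νξ ≤ ∫ y, y * Real.log y ∂νξ) (r : ℕ) :
    ∀ᵐ ω ∂P, subtreeLimit ε U ξ (p * ∫ y, y ∂νξ) r ω = 0 := by
  have ha := M.exponent_nonneg
  have ha1 := M.super
  set a := p * ∫ y, y ∂νξ with ha_def
  obtain ⟨C, hC0, hC⟩ := exists_growth_le (by linarith : 0 < a)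
  obtain ⟨C', hC0', hC'⟩ := exists_le_growth (by linarith : 0 < a)
  -- Integer thresholds give a single null set for all K. Fatou converts the vanishing mean into a
  -- vanishing lower limit, which suffices because the true ratio converges.
  have hK : ∀ K : ℕ, ∀ᵐ ω ∂P, liminf (fun n : ℕ => ENNReal.ofReal
      ((∑ k ∈ Finset.Icc 1 n, killedWeight (K + 1 : ℝ) a r ε U ξ ω k) / (n : ℝ) ^ a)) atTop = 0 := by
    intro K
    have hK0 : (0 : ℝ) < K + 1 := by positivity
    have hmeas : ∀ n : ℕ, Measurable fun ω => ENNReal.ofReal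
        ((∑ k ∈ Finset.Icc 1 n, killedWeight (K + 1 : ℝ) a r ε U ξ ω k) / (n : ℝ) ^ a) := fun n =>
      ((Finset.measurable_sum _ fun k _ =>
        M.measurable_killedWeight_ambient k).div_const _).ennreal_ofReal
    refine (lintegral_eq_zero_iff (Measurable.liminf hmeas)).1 (le_antisymm ?_ zero_le)
    refine (lintegral_liminf_le hmeas).trans ?_
    have hlim : Tendsto (fun n => ENNReal.ofReal
        ((K + 1) * C * profile P (K + 1) a r ε U ξ n (fun x => x))) atTop (𝓝 0) := by
      have := ENNReal.tendsto_ofReal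
        ((M.tendsto_profile_id (r := r) hK0 hq hq1 hint hlog).const_mul ((K + 1) * C))
      simpa using this
    refine le_trans (liminf_le_liminf ?_) hlim.liminf_eq.le
    filter_upwards [eventually_ge_atTop 1] with n hn
    have hpos : (0 : ℝ) < (n : ℝ) ^ a := by positivity
    have hG := growth_pos ha n
    rw [ENNReal.ofReal_mul (by positivity), profile,
      ofReal_integral_eq_lintegral_ofReal (M.integrable_profile hK0 ha isTest_id n),
      ← lintegral_const_mul' _ _ ENNReal.ofReal_ne_top]
    · refine lintegral_mono_ae ?_
      filter_upwards [M.regular] with ω hω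
      rw [← ENNReal.ofReal_mul (by positivity)]
      refine ENNReal.ofReal_le_ofReal ?_
      have hS : 0 ≤ ∑ k ∈ Finset.Icc 1 n, killedWeight (K + 1 : ℝ) a r ε U ξ ω k :=
        Finset.sum_nonneg fun k hk => hω.killedWeight_nonneg (Finset.mem_Icc.1 hk).1
      rw [← Finset.sum_div]
      have h1 : ((K : ℝ) + 1) * C * ((∑ k ∈ Finset.Icc 1 n, killedWeight (K + 1 : ℝ) a r ε U ξ ω k) /
          ((K + 1) * growth a n)) = (∑ k ∈ Finset.Icc 1 n, killedWeight (K + 1 : ℝ) a r ε U ξ ω k) *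
          (C / growth a n) := by
        field_simp
      rw [h1, div_eq_mul_inv]
      refine mul_le_mul_of_nonneg_left ?_ hS
      rw [inv_le_comm₀ hpos (by positivity), inv_div, div_le_iff₀ hC0, mul_comm _ C]
      exact hC n hn
    · filter_upwards [M.regular] with ω hω
      exact Finset.sum_nonneg fun k hk => (hω.killedWeight_div_mem hK0 ha hk).1
  filter_upwards [M.regular, ae_all_iff.2 hK, M.tendsto_subtreeWeight r] with ω hω hliminf hlim
  have hZ : ∀ n, 1 ≤ n → 0 ≤ (fun n (_ : Ω) => indicatorSpin r n) n ω := fun n _ =>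
    indicatorSpin_nonneg r n
  -- On a fixed path the normalised component weight converges, hence is bounded; this selects a K
  -- for which no vertex is killed.
  obtain ⟨D, hD⟩ := hlim.bddAbove_range
  obtain ⟨K, hKD⟩ := exists_nat_ge (max D 0 * C')
  have hle : ∀ n, 1 ≤ n →
      step (fun n _ => indicatorSpin r n) ε U ξ ω n ≤ (K + 1 : ℝ) * growth a n := by
    intro n hn
    have h1 := hD ⟨n, rfl⟩
    have hpos : (0 : ℝ) < (n : ℝ) ^ a := by positivity
    have hG := growth_pos ha n
    dsimp only at h1
    rw [div_le_iff₀ hpos, hω.subtreeWeight_eq] at h1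
    calc step (fun n _ => indicatorSpin r n) ε U ξ ω n
        ≤ walk (fun n _ => indicatorSpin r n) ε U ξ n ω :=
          Finset.single_le_sum (f := fun k => step (fun n _ => indicatorSpin r n) ε U ξ ω k)
            (fun k _ => hω.step_nonneg hZ k) (Finset.mem_Icc.2 ⟨hn, le_rfl⟩)
      _ ≤ D * (n : ℝ) ^ a := h1
      _ ≤ max D 0 * (C' * growth a n) := by
          gcongr
          · exact le_max_left _ _
          · exact hC' n hn
      _ = max D 0 * C' * growth a n := by ring
      _ ≤ (K + 1 : ℝ) * growth a n := by
          gcongr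
          linarith
  have heq : ∀ n : ℕ, (∑ k ∈ Finset.Icc 1 n, killedWeight (K + 1 : ℝ) a r ε U ξ ω k) / (n : ℝ) ^ a =
      subtreeWeight ε U ξ r n ω / (n : ℝ) ^ a := by
    intro n
    rw [hω.subtreeWeight_eq, walk]
    congr 1
    exact Finset.sum_congr rfl fun k hk => hω.killedWeight_eq hle (Finset.mem_Icc.1 hk).1
  have h1 := hliminf K
  simp only [heq] at h1
  rw [(ENNReal.tendsto_ofReal hlim).liminf_eq] at h1
  refine le_antisymm (ENNReal.ofReal_eq_zero.1 h1) ?_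
  exact ge_of_tendsto' hlim fun n => div_nonneg (hω.subtreeWeight_nonneg r n) (by positivity)

end Model

end RWES

namespace RWES

/-! ### Non-degeneracy -/

set_option linter.unusedSectionVars false

/-- Write (s + x)^q = (s + x) (s + x)^{q-1} with 0 ≤ q - 1 ≤ 1. Bernoulli's inequality handles the
factor s and subadditivity the factor x; the cross terms add up to q s^{q-1} x. -/
theorem rpow_add_le_taylor {s x q : ℝ} (hs : 0 ≤ s) (hx : 0 ≤ x) (hq1 : 1 ≤ q) (hq2 : q ≤ 2) :
    (s + x) ^ q ≤ s ^ q + q * (s ^ (q - 1) * x) + x ^ q := by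
  rcases hs.eq_or_lt with rfl | hs
  · have : 0 ≤ q * ((0 : ℝ) ^ (q - 1) * x) := by positivity
    have h0 : (0 : ℝ) ^ q = 0 := Real.zero_rpow (by linarith)
    rw [zero_add, h0]
    linarith
  rcases hx.eq_or_lt with rfl | hx
  · simp [Real.zero_rpow (by linarith : q ≠ 0)]
  have hsplit : ∀ y : ℝ, 0 < y → y ^ q = y * y ^ (q - 1) := fun y hy => by
    rw [← Real.rpow_one_add' hy.le (by linarith)]
    congr 1
    ring
  have h1 : (s + x) ^ (q - 1) ≤ s ^ (q - 1) + x ^ (q - 1) :=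
    Real.rpow_add_le_add_rpow hs.le hx.le (by linarith) (by linarith)
  have h2 : s * (s + x) ^ (q - 1) ≤ s * s ^ (q - 1) + (q - 1) * (s ^ (q - 1) * x) := by
    have hu : 0 ≤ x / s := by positivity
    have h3 := rpow_one_add_le_one_add_mul_self (s := x / s) (by linarith)
      (by linarith : 0 ≤ q - 1) (by linarith)
    have h4 : s + x = s * (1 + x / s) := by field_simp
    rw [h4, Real.mul_rpow hs.le (by positivity)]
    calc s * (s ^ (q - 1) * (1 + x / s) ^ (q - 1))
        ≤ s * (s ^ (q - 1) * (1 + (q - 1) * (x / s))) := by gcongr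
      _ = _ := by field_simp
  rw [hsplit _ (by positivity), hsplit s hs, hsplit x hx]
  nlinarith

/-- Bounds a moment of order at most one by the first moment, without loss of scale when b is of the
size of w. -/
theorem rpow_le_mul_one_add_div {w b θ : ℝ} (hw : 0 ≤ w) (hb : 0 < b) (hθ0 : 0 ≤ θ) (hθ1 : θ ≤ 1) :
    w ^ θ ≤ b ^ θ * (1 + w / b) := by
  have h : (w / b) ^ θ ≤ 1 + w / b := by
    have hu : 0 ≤ w / b := by positivity
    calc (w / b) ^ θ ≤ (1 + w / b) ^ θ := Real.rpow_le_rpow hu (by linarith) hθ0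
      _ ≤ (1 + w / b) ^ (1 : ℝ) := Real.rpow_le_rpow_of_exponent_le (by linarith) hθ1
      _ = 1 + w / b := Real.rpow_one _
  calc w ^ θ = b ^ θ * (w / b) ^ θ := by
        rw [← Real.mul_rpow hb.le (by positivity), mul_div_cancel₀ _ hb.ne']
    _ ≤ _ := by gcongr

section Echo

variable {ν : Measure ℝ} [IsProbabilityMeasure ν]

/-- If `E[ξ log ξ] < E ξ`, then `E[ξ ^ q] < q E ξ` for some `q > 1` close to `1`. -/
theorem exists_integral_rpow_lt {q : ℝ} (hq : 0 < q) (hν : ∀ᵐ y ∂ν, 0 ≤ y)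
    (hid : Integrable (fun y : ℝ => y) ν) (hint : Integrable (fun y : ℝ => y ^ (1 + q)) ν)
    (hlog : ∫ y, y * Real.log y ∂ν < ∫ y, y ∂ν) :
    ∃ s, 0 < s ∧ s ≤ q ∧ Integrable (fun y : ℝ => y ^ (1 + s)) ν ∧
      ∫ y, y ^ (1 + s) ∂ν < (1 + s) * ∫ y, y ∂ν := by
  set u : ℕ → ℝ := fun n => q / (n + 1) with hu
  have hu0 : ∀ n, 0 < u n := fun n => by positivity
  have huq : ∀ n, u n ≤ q := fun n => by
    rw [hu]
    exact div_le_self hq.le (by linarith [Nat.cast_nonneg (α := ℝ) n])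
  have hint' : ∀ s, 0 < s → s ≤ q → Integrable (fun y : ℝ => y ^ (1 + s)) ν := by
    intro s hs hsq
    refine (hid.add hint).mono' (measurable_id.pow_const _).aestronglyMeasurable ?_
    filter_upwards [hν] with y hy
    rw [Real.norm_of_nonneg (by positivity), Pi.add_apply]
    rcases le_total y 1 with h1 | h1
    · have h2 : y ^ (1 + s) ≤ y ^ (1 : ℝ) := by
        rcases hy.eq_or_lt with rfl | hy
        · rw [Real.zero_rpow (by linarith), Real.zero_rpow one_ne_zero]
        · exact Real.rpow_le_rpow_of_exponent_ge hy h1 (by linarith)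
      rw [Real.rpow_one] at h2
      have : 0 ≤ y ^ (1 + q) := by positivity
      linarith
    · have := Real.rpow_le_rpow_of_exponent_le h1 (by linarith : 1 + s ≤ 1 + q)
      linarith
  -- The difference quotients at s = 0 of s ↦ E ξ^{1+s} converge to E[ξ log ξ] < m₁; a quotient
  -- below m₁ is exactly the inequality sought.
  have hlim : Tendsto (fun n => ∫ y, (y ^ (1 + u n) - y) / u n ∂ν) atTop
      (𝓝 (∫ y, y * Real.log y ∂ν)) := by
    refine tendsto_integral_of_dominated_convergence
      (fun y => |y * Real.log y| + (y ^ (1 + q) + y) / q) (fun n => ?_) ?_ (fun n => ?_) ?_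
    · exact (((measurable_id.pow_const _).sub measurable_id).div_const _).aestronglyMeasurable
    · exact (integrable_mul_log hq hν hint).abs.add ((hint.add hid).div_const q)
    · filter_upwards [hν] with y hy
      have h1 := add_mul_log_le_rpow (q := u n) hy
      have h2 : y * Real.log y ≤ (y ^ (1 + u n) - y) / u n := by
        rw [le_div_iff₀ (hu0 n)]
        linarith
      -- Convexity in the exponent: the quotient for u n is at most the one for q, by Bernoulli's
      -- inequality applied to y^q. The tangent bound above gives the other side of the domination.
      have h3 : (y ^ (1 + u n) - y) / u n ≤ (y ^ (1 + q) + y) / q := by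
        rcases hy.eq_or_lt with rfl | hy
        · rw [Real.zero_rpow (by linarith [hu0 n]), Real.zero_rpow (by linarith)]
          simp
        · have h4 : y ^ u n ≤ 1 + u n / q * (y ^ q - 1) := by
            have := rpow_one_add_le_one_add_mul_self (s := y ^ q - 1) (p := u n / q)
              (by linarith [Real.rpow_pos_of_pos hy q]) (div_nonneg (hu0 n).le hq.le)
              ((div_le_one hq).2 (huq n))
            rw [add_sub_cancel, ← Real.rpow_mul hy.le, mul_div_cancel₀ _ hq.ne'] at this
            exact this
          rw [div_le_iff₀ (hu0 n), Real.rpow_add hy, Real.rpow_add hy, Real.rpow_one]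
          calc y * y ^ u n - y ≤ y * (1 + u n / q * (y ^ q - 1)) - y := by gcongr
            _ = (y * y ^ q - y) / q * u n := by field_simp; ring
            _ ≤ (y * y ^ q + y) / q * u n := by
                have := hu0 n
                gcongr
                linarith
      have h5 : 0 ≤ (y ^ (1 + q) + y) / q := by positivity
      have h6 := neg_abs_le (y * Real.log y)
      have h7 := abs_nonneg (y * Real.log y)
      rw [Real.norm_eq_abs, abs_le]
      constructor <;> linarith
    · filter_upwards [hν] with y hy
      rcases hy.eq_or_lt with rfl | hy
      · refine tendsto_const_nhds.congr fun n => ?_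
        rw [Real.zero_rpow (by linarith [hu0 n])]
        simp
      · have hd := hasDerivAt_iff_tendsto_slope_zero.1
          (Real.hasStrictDerivAt_const_rpow hy 0).hasDerivAt
        simp only [Real.rpow_zero, one_mul, zero_add, smul_eq_mul] at hd
        have hu' : Tendsto u atTop (𝓝[≠] 0) := by
          refine tendsto_nhdsWithin_iff.2 ⟨?_, Eventually.of_forall fun n => (hu0 n).ne'⟩
          have := (tendsto_one_div_add_atTop_nhds_zero_nat (𝕜 := ℝ)).const_mul q
          simpa [hu, div_eq_mul_inv] using this
        refine ((hd.comp hu').const_mul y).congr fun n => ?_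
        rw [Function.comp_apply, Real.rpow_add hy, Real.rpow_one]
        ring
  obtain ⟨n, hn⟩ := (hlim.eventually_lt_const hlog).exists
  refine ⟨u n, hu0 n, huq n, hint' _ (hu0 n) (huq n), ?_⟩
  rw [integral_div, integral_sub (hint' _ (hu0 n) (huq n)) hid, div_lt_iff₀ (hu0 n)] at hn
  linarith

end Echo

variable {Ω : Type*} [MeasurableSpace Ω]

variable {P : Measure Ω} [IsProbabilityMeasure P] {p : ℝ} {νX νξ : Measure ℝ}
  {X ε : ℕ → Ω → ℝ} {U : ℕ → Ω → ℕ} {ξ : ℕ → Ω → ℝ}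

namespace Model

/-- Growth of the moments of the steps. -/
theorem exists_lintegral_step_rpow_le (M : Model P p νX νξ X ε U ξ) {q κ : ℝ}
    (hXq : Integrable (fun x : ℝ => |x| ^ q) νX) (hξq : Integrable (fun y : ℝ => y ^ q) νξ)
    (hκ : p * ∫ y, y ^ q ∂νξ ≤ κ) (hκ1 : 1 < κ) :
    ∃ D, 0 ≤ D ∧ ∀ n : ℕ, 1 ≤ n →
      ∫⁻ ω, ENNReal.ofReal ((step (fun n ω => |X n ω|) ε U ξ ω (n + 1)) ^ q) ∂P ≤
        ENNReal.ofReal (D * (1 + growth κ n / n)) := by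
  have hprobX := M.isProbabilityMeasure_spin
  have hp := M.p_pos
  have hp1 := M.p_lt_one
  set g : ℕ → ℝ → ℝ := fun _ x => |x| with hg_def
  have hg : ∀ n, Measurable (g n) := fun _ => measurable_norm
  have hYm := M.measurable_step_ambient hg
  set y : ℕ → ℝ≥0∞ := fun n =>
    ∫⁻ ω, ENNReal.ofReal ((step (fun n ω => g n (X n ω)) ε U ξ ω n) ^ q) ∂P with hy
  set Mq := ∫ y, y ^ q ∂νξ with hMq
  set c := ∫ x, |x| ^ q ∂νX with hc
  have hMq0 : 0 ≤ Mq := by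
    refine integral_nonneg_of_ae ?_
    filter_upwards [M.echo_nonneg] with y hy
    simp only [Pi.zero_apply]
    positivity
  have hc0 : 0 ≤ c := integral_nonneg fun x => by positivity
  have hXl : ∫⁻ x, ENNReal.ofReal (|x| ^ q) ∂νX = ENNReal.ofReal c :=
    (ofReal_integral_eq_lintegral_ofReal hXq (ae_of_all _ fun x => by positivity)).symm
  have hξl : ∫⁻ x, ENNReal.ofReal (x ^ q) ∂νξ = ENNReal.ofReal Mq := by
    refine (ofReal_integral_eq_lintegral_ofReal hξq ?_).symm
    filter_upwards [M.echo_nonneg] with y hy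
    simp only [Pi.zero_apply]
    positivity
  -- A step is either a fresh spin or a single product, so its q-th power factorises and the q-th
  -- moments satisfy a closed linear recursion.
  have hstep : ∀ n, 1 ≤ n → y (n + 1) = ENNReal.ofReal (1 - p) * ENNReal.ofReal c +
      ENNReal.ofReal (p * Mq / n) * ∑ k ∈ Finset.Icc 1 n, y k := by
    intro n hn
    have h := M.lintegral_filteredStep_succ M.p_pos M.p_lt_one M.echo_nonneg
      (τ := fun _ x => x) (fun _ => measurable_id) hg hn (V := fun _ => ()) measurable_const
      (F := fun z : Unit × ℝ => ENNReal.ofReal (z.2 ^ q)) (by fun_prop)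
    simp only [← step_eq_filteredStep] at h
    rw [hy]
    refine h.trans ?_
    congr 1
    · congr 1
      simp [g, hXl]
    · rw [show p * Mq / n = p / n * Mq by ring, ENNReal.ofReal_mul (by positivity), mul_assoc]
      congr 1
      rw [Finset.mul_sum]
      refine Finset.sum_congr rfl fun k _ => ?_
      rw [← lintegral_const_mul _ ((hYm k).pow_const q).ennreal_ofReal]
      refine lintegral_congr_ae ?_
      filter_upwards [M.regular] with ω hω
      have hY := hω.step_nonneg (Z := fun n ω => g n (X n ω)) (fun n _ => abs_nonneg _) k
      rw [← hξl, ← lintegral_mul_const _ (by fun_prop)]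
      refine lintegral_congr_ae ?_
      filter_upwards [M.echo_nonneg] with y hy
      rw [Real.mul_rpow hy hY, ENNReal.ofReal_mul (by positivity)]
  have hy1 : y 1 = ENNReal.ofReal c := by
    rw [hy]
    simp only [step_one]
    rw [← hXl, ← M.law_spin 1 le_rfl, lintegral_map (by fun_prop) (M.measurable_spin 1 le_rfl)]
  -- The exact rate p E ξ^q may be at most 1; enlarging it to κ > 1 makes the constant source term
  -- summable.
  obtain ⟨C, hC0, hC⟩ := growth_bound (κ := κ) (by linarith)
    (v := fun n => ∑ k ∈ Finset.Icc 1 n, y k) (d := fun _ => c)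
    (by simp [hy1]) (fun _ => hc0)
    (by
      simp only [div_eq_mul_inv]
      exact ((summable_nat_add_iff 1).2 (summable_inv_growth hκ1)).mul_left c)
    (by
      intro n hn
      rw [Finset.sum_Icc_succ_top (by omega), hstep n hn, ENNReal.ofReal_add zero_le_one
        (by positivity), ENNReal.ofReal_one, add_mul, one_mul]
      have h1 : ENNReal.ofReal (1 - p) * ENNReal.ofReal c ≤ ENNReal.ofReal c := by
        rw [← ENNReal.ofReal_mul (by linarith)]
        exact ENNReal.ofReal_le_ofReal (by nlinarith)
      have h2 : ENNReal.ofReal (p * Mq / n) ≤ ENNReal.ofReal (κ / n) :=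
        ENNReal.ofReal_le_ofReal (by gcongr)
      rw [add_assoc, add_comm (ENNReal.ofReal (κ / n) * _)]
      gcongr)
  refine ⟨max c (κ * C), le_max_of_le_left hc0, fun n hn => ?_⟩
  refine (hstep n hn).le.trans ?_
  have hG := growth_pos (by linarith : 0 ≤ κ) n
  have h1 : ENNReal.ofReal (1 - p) * ENNReal.ofReal c ≤ ENNReal.ofReal c := by
    rw [← ENNReal.ofReal_mul (by linarith)]
    exact ENNReal.ofReal_le_ofReal (by nlinarith)
  refine (add_le_add h1 (mul_le_mul_right (hC n hn) _)).trans ?_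
  rw [← ENNReal.ofReal_mul (by positivity), ← ENNReal.ofReal_add hc0 (by positivity)]
  refine ENNReal.ofReal_le_ofReal ?_
  have h2 : p * Mq / n * (C * growth κ n) ≤ κ * C * (growth κ n / n) := by
    calc p * Mq / n * (C * growth κ n) ≤ κ / n * (C * growth κ n) := by gcongr
      _ = _ := by ring
  have h3 : 0 ≤ growth κ n / n := by positivity
  have h4 : κ * C * (growth κ n / n) ≤ max c (κ * C) * (growth κ n / n) := by
    gcongr
    exact le_max_right _ _
  have h5 := le_max_left c (κ * C)
  linarith

/-- The normalised walk with spins `|X|` is bounded in `L^q` for some `q > 1`. -/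
theorem exists_lintegral_walk_rpow_le (M : Model P p νX νξ X ε U ξ) {q : ℝ} (hq1 : 1 < q)
    (hq2 : q ≤ 2) (hXq : Integrable (fun x : ℝ => |x| ^ q) νX)
    (hξq : Integrable (fun y : ℝ => y ^ q) νξ)
    (hlt : ∫ y, y ^ q ∂νξ < q * ∫ y, y ∂νξ) :
    ∃ D, 0 ≤ D ∧ ∀ n : ℕ, 1 ≤ n →
      ∫⁻ ω, ENNReal.ofReal ((walk (fun n ω => |X n ω|) ε U ξ n ω) ^ q) ∂P ≤
        ENNReal.ofReal (D * ((n : ℝ) ^ (p * ∫ y, y ∂νξ)) ^ q) := by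
  have hp := M.p_pos
  have hp1 := M.p_lt_one
  have ha1 := M.super
  have ha := M.exponent_nonneg
  set a := p * ∫ y, y ∂νξ with ha_def
  -- κ > 1 serves the step moments, and κ < q a makes them negligible at scale n^{qa}. The interval
  -- is nonempty because E ξ^q < q m₁ and a > 1.
  obtain ⟨κ, hκ, hκqa⟩ : ∃ κ, max (p * ∫ y, y ^ q ∂νξ) 1 < κ ∧ κ < q * a := by
    refine exists_between (max_lt ?_ (by nlinarith))
    rw [ha_def]
    nlinarith
  obtain ⟨hκ', hκ1⟩ := max_lt_iff.1 hκ
  have hqa : 1 < q * a := by linarith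
  set g : ℕ → ℝ → ℝ := fun _ x => |x| with hg_def
  have hg : ∀ n, Measurable (g n) := fun _ => measurable_norm
  have hg0 : ∀ n x, 0 ≤ g n x := fun _ x => abs_nonneg x
  set W : ℕ → Ω → ℝ := walk (fun n ω => g n (X n ω)) ε U ξ with hW
  have hWm : ∀ n, Measurable (W n) := M.measurable_walk_ambient hg
  have hYm := M.measurable_step_ambient hg
  set m := ∫ x, |x| ∂νX with hm
  have hm0 : 0 ≤ m := mean_abs_nonneg
  have hEX : ∀ n, ∫⁻ x, ENNReal.ofReal (g n x) ∂νX = ENNReal.ofReal m := fun _ =>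
    M.lintegral_abs_spin
  set B := m * ∑' k, (growth a k)⁻¹ with hB
  have hB0 : 0 ≤ B := mul_nonneg hm0 (tsum_nonneg fun k => (inv_pos.2 (growth_pos ha k)).le)
  obtain ⟨D, hD0, hD⟩ := M.exists_lintegral_step_rpow_le hXq hξq hκ'.le hκ1
  -- Since q - 1 ≤ 1, the moment of order q - 1 follows from the mean bound already known.
  have hlow : ∀ n, ∫⁻ ω, ENNReal.ofReal ((W n ω) ^ (q - 1)) ∂P ≤
      ENNReal.ofReal ((growth a n) ^ (q - 1) * (1 + B)) := by
    intro n
    have hG := growth_pos ha n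
    calc ∫⁻ ω, ENNReal.ofReal ((W n ω) ^ (q - 1)) ∂P
        ≤ ∫⁻ ω, (ENNReal.ofReal ((growth a n) ^ (q - 1)) +
            ENNReal.ofReal ((growth a n) ^ (q - 1) / growth a n) * ENNReal.ofReal (W n ω)) ∂P := by
          refine lintegral_mono_ae ?_
          filter_upwards [M.regular] with ω hω
          have hw : 0 ≤ W n ω := hω.walk_nonneg (fun n _ => hg0 n _) n
          rw [← ENNReal.ofReal_mul (by positivity), ← ENNReal.ofReal_add (by positivity)
            (by positivity)]
          refine ENNReal.ofReal_le_ofReal ((rpow_le_mul_one_add_div hw hG (by linarith)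
            (by linarith)).trans (le_of_eq ?_))
          ring
      _ = ENNReal.ofReal ((growth a n) ^ (q - 1)) +
            ENNReal.ofReal ((growth a n) ^ (q - 1) / growth a n) *
              ∫⁻ ω, ENNReal.ofReal (W n ω) ∂P := by
          rw [lintegral_add_left measurable_const, lintegral_const, measure_univ, mul_one,
            lintegral_const_mul _ (hWm n).ennreal_ofReal]
      _ ≤ ENNReal.ofReal ((growth a n) ^ (q - 1)) +
            ENNReal.ofReal ((growth a n) ^ (q - 1) / growth a n) *
              ENNReal.ofReal (growth a n * B) := by
          gcongr
          exact M.lintegral_walk_le_const hg hg0 hm0 (fun n => (hEX n).le) n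
      _ = _ := by
          rw [← ENNReal.ofReal_mul (by positivity), ← ENNReal.ofReal_add (by positivity)
            (by positivity)]
          congr 1
          field_simp
  set d : ℕ → ℝ := fun n => q * m * ((growth a n) ^ (q - 1) * (1 + B)) +
    D * (1 + growth κ n / n) with hd
  have hd0 : ∀ n, 0 ≤ d n := fun n => by
    have h1 := growth_pos ha n
    have h2 := growth_pos (by linarith : 0 ≤ κ) n
    positivity
  -- In the Taylor bound the mixed term has conditional mean a / n times the q-th power of the walk,
  -- plus a fresh-spin contribution; this yields the factor 1 + q a / n.
  have hrec : ∀ n, 1 ≤ n → ∫⁻ ω, ENNReal.ofReal ((W (n + 1) ω) ^ q) ∂P ≤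
      ENNReal.ofReal (1 + q * a / n) * ∫⁻ ω, ENNReal.ofReal ((W n ω) ^ q) ∂P +
        ENNReal.ofReal (d n) := by
    intro n hn
    set Y : Ω → ℝ := fun ω => step (fun n ω => g n (X n ω)) ε U ξ ω (n + 1) with hY
    have hYm' : Measurable Y := hYm (n + 1)
    have hV : Measurable[M.history n] fun ω => ENNReal.ofReal ((W n ω) ^ (q - 1)) :=
      ((M.measurable_walk hg le_rfl).pow_const _).ennreal_ofReal
    have hmix := M.lintegral_mul_step_succ hg hg0 hn hV
    rw [hEX (n + 1), ← ha_def] at hmix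
    have hmul : ∫⁻ ω, ENNReal.ofReal ((W n ω) ^ (q - 1)) * ENNReal.ofReal (W n ω) ∂P =
        ∫⁻ ω, ENNReal.ofReal ((W n ω) ^ q) ∂P := by
      refine lintegral_congr_ae ?_
      filter_upwards [M.regular] with ω hω
      have hw : 0 ≤ W n ω := hω.walk_nonneg (fun n _ => hg0 n _) n
      rw [← ENNReal.ofReal_mul (by positivity)]
      congr 1
      conv_lhs => rw [← Real.rpow_add_one' hw (by linarith), sub_add_cancel]
    rw [hmul] at hmix
    calc ∫⁻ ω, ENNReal.ofReal ((W (n + 1) ω) ^ q) ∂P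
        ≤ ∫⁻ ω, (ENNReal.ofReal ((W n ω) ^ q) + ENNReal.ofReal q *
            (ENNReal.ofReal ((W n ω) ^ (q - 1)) * ENNReal.ofReal (Y ω)) +
            ENNReal.ofReal ((Y ω) ^ q)) ∂P := by
          refine lintegral_mono_ae ?_
          filter_upwards [M.regular] with ω hω
          have hw : 0 ≤ W n ω := hω.walk_nonneg (fun n _ => hg0 n _) n
          have hy : 0 ≤ Y ω := hω.step_nonneg (Z := fun n ω => g n (X n ω)) (fun n _ => hg0 n _) _
          have hsucc : W (n + 1) ω = W n ω + Y ω := by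
            simp only [hW, hY, walk]
            rw [Finset.sum_Icc_succ_top (by omega)]
          rw [hsucc, ← ENNReal.ofReal_mul (by positivity), ← ENNReal.ofReal_mul (by positivity),
            ← ENNReal.ofReal_add (by positivity) (by positivity),
            ← ENNReal.ofReal_add (by positivity) (by positivity)]
          exact ENNReal.ofReal_le_ofReal (rpow_add_le_taylor hw hy hq1.le hq2)
      _ = ∫⁻ ω, ENNReal.ofReal ((W n ω) ^ q) ∂P + ENNReal.ofReal q *
            (∫⁻ ω, ENNReal.ofReal ((W n ω) ^ (q - 1)) * ENNReal.ofReal (Y ω) ∂P) +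
            ∫⁻ ω, ENNReal.ofReal ((Y ω) ^ q) ∂P := by
          have h1 : Measurable fun ω => ENNReal.ofReal ((W n ω) ^ q) :=
            ((hWm n).pow_const _).ennreal_ofReal
          have h2 : Measurable fun ω =>
              ENNReal.ofReal ((W n ω) ^ (q - 1)) * ENNReal.ofReal (Y ω) :=
            ((hWm n).pow_const _).ennreal_ofReal.mul hYm'.ennreal_ofReal
          have h3 : Measurable fun ω => ENNReal.ofReal ((Y ω) ^ q) :=
            (hYm'.pow_const _).ennreal_ofReal
          rw [lintegral_add_right _ h3, lintegral_add_left h1, lintegral_const_mul _ h2]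
      _ ≤ ∫⁻ ω, ENNReal.ofReal ((W n ω) ^ q) ∂P + ENNReal.ofReal q *
            (ENNReal.ofReal 1 * (ENNReal.ofReal ((growth a n) ^ (q - 1) * (1 + B)) *
              ENNReal.ofReal m) +
              ENNReal.ofReal (a / n) * ∫⁻ ω, ENNReal.ofReal ((W n ω) ^ q) ∂P) +
            ENNReal.ofReal (D * (1 + growth κ n / n)) := by
          rw [hmix]
          gcongr
          · linarith
          · exact hlow n
          · exact hD n hn
      _ = _ := by
          have h1 := growth_pos ha n
          have h2 := growth_pos (by linarith : 0 ≤ κ) n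
          have e1 : ENNReal.ofReal (q * a / n) = ENNReal.ofReal q * ENNReal.ofReal (a / n) := by
            rw [← ENNReal.ofReal_mul (by positivity), mul_div_assoc]
          have e2 : ENNReal.ofReal (q * m * ((growth a n) ^ (q - 1) * (1 + B))) =
              ENNReal.ofReal q * ENNReal.ofReal m *
                ENNReal.ofReal ((growth a n) ^ (q - 1) * (1 + B)) := by
            rw [ENNReal.ofReal_mul (by positivity), ENNReal.ofReal_mul (by positivity)]
          have e3 : ENNReal.ofReal (d n) = ENNReal.ofReal q * ENNReal.ofReal m *
              ENNReal.ofReal ((growth a n) ^ (q - 1) * (1 + B)) +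
              ENNReal.ofReal (D * (1 + growth κ n / n)) := by
            rw [← e2, ← ENNReal.ofReal_add (by positivity) (by positivity)]
          rw [e3, ENNReal.ofReal_add zero_le_one (by positivity), ENNReal.ofReal_one, one_mul, e1]
          ring
  have hsum : Summable fun n => d n / growth (q * a) (n + 1) := by
    obtain ⟨C₁, hC₁0, hC₁⟩ := exists_growth_le (by linarith : 0 < a)
    obtain ⟨C₂, hC₂0, hC₂⟩ := exists_growth_le (by linarith : 0 < κ)
    obtain ⟨C₃, hC₃0, hC₃⟩ := exists_le_growth (by linarith : 0 < q * a)
    -- After division by n^{qa} the exponents are a (q - 1) - q a = -a, then -q a, and κ - 1 - q a,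
    -- all below -1.
    have hs1 : Summable fun n : ℕ => C₃ * (q * m * (C₁ ^ (q - 1) * (1 + B)) * (n : ℝ) ^ (-a)
        + D * (n : ℝ) ^ (-(q * a)) + D * C₂ * (n : ℝ) ^ (κ - 1 - q * a)) :=
      ((((Real.summable_nat_rpow.2 (by linarith)).mul_left _).add
        ((Real.summable_nat_rpow.2 (by linarith)).mul_left _)).add
        ((Real.summable_nat_rpow.2 (by linarith)).mul_left _)).mul_left _
    refine Summable.of_norm_bounded_eventually_nat hs1 ?_
    filter_upwards [eventually_ge_atTop 1] with n hn
    have hn0 : (0 : ℝ) < n := by exact_mod_cast hn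
    have hG := growth_pos (by linarith : 0 ≤ q * a) n
    have h0 : (n : ℝ) ^ (q * a) ≤ C₃ * growth (q * a) (n + 1) :=
      (hC₃ n hn).trans (by gcongr; exact growth_le_succ (by linarith) n)
    have h1 : 1 / growth (q * a) (n + 1) ≤ C₃ * (n : ℝ) ^ (-(q * a)) := by
      rw [Real.rpow_neg hn0.le, ← div_eq_mul_inv, div_le_div_iff₀ (growth_pos (by linarith) _)
        (by positivity)]
      linarith
    have h2 : (growth a n) ^ (q - 1) ≤ C₁ ^ (q - 1) * (n : ℝ) ^ (a * (q - 1)) := by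
      rw [Real.rpow_mul hn0.le, ← Real.mul_rpow hC₁0.le (by positivity)]
      exact Real.rpow_le_rpow (growth_pos ha n).le (hC₁ n hn) (by linarith)
    have h3 : growth κ n / n ≤ C₂ * (n : ℝ) ^ (κ - 1) := by
      rw [div_le_iff₀ hn0, mul_assoc, ← Real.rpow_add_one hn0.ne', sub_add_cancel]
      exact hC₂ n hn
    have hdn : d n ≤ q * m * (C₁ ^ (q - 1) * (n : ℝ) ^ (a * (q - 1)) * (1 + B)) +
        D * (1 + C₂ * (n : ℝ) ^ (κ - 1)) := by
      rw [hd]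
      dsimp only
      gcongr
    rw [Real.norm_of_nonneg (div_nonneg (hd0 n) (growth_pos (by linarith) _).le)]
    calc d n / growth (q * a) (n + 1) = d n * (1 / growth (q * a) (n + 1)) := by ring
      _ ≤ (q * m * (C₁ ^ (q - 1) * (n : ℝ) ^ (a * (q - 1)) * (1 + B)) +
        D * (1 + C₂ * (n : ℝ) ^ (κ - 1))) * (C₃ * (n : ℝ) ^ (-(q * a))) := by
          refine mul_le_mul hdn h1 (one_div_nonneg.2 (growth_pos (by linarith) _).le) ?_
          positivity
      _ = _ := by
          have e1 : (n : ℝ) ^ (-a) = (n : ℝ) ^ (a * (q - 1)) * (n : ℝ) ^ (-(q * a)) := by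
            rw [← Real.rpow_add hn0]
            congr 1
            ring
          have e2 : (n : ℝ) ^ (κ - 1 - q * a) = (n : ℝ) ^ (κ - 1) * (n : ℝ) ^ (-(q * a)) := by
            rw [← Real.rpow_add hn0]
            congr 1
          rw [e1, e2]
          ring
  have hv1 : ∫⁻ ω, ENNReal.ofReal ((W 1 ω) ^ q) ∂P ≠ ⊤ := by
    have h1 : ∫⁻ ω, ENNReal.ofReal ((W 1 ω) ^ q) ∂P = ∫⁻ x, ENNReal.ofReal (|x| ^ q) ∂νX := by
      rw [← M.law_spin 1 le_rfl, lintegral_map (by fun_prop) (M.measurable_spin 1 le_rfl)]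
      simp [hW, walk, step_one, g]
    rw [h1, ← ofReal_integral_eq_lintegral_ofReal hXq (ae_of_all _ fun x => by positivity)]
    exact ENNReal.ofReal_ne_top
  obtain ⟨C, hC0, hC⟩ := growth_bound (κ := q * a) (by linarith)
    (v := fun n => ∫⁻ ω, ENNReal.ofReal ((W n ω) ^ q) ∂P) hv1 hd0 hsum hrec
  obtain ⟨C₁, hC₁0, hC₁⟩ := exists_growth_le (by linarith : 0 < q * a)
  refine ⟨C * C₁, by positivity, fun n hn => (hC n hn).trans (ENNReal.ofReal_le_ofReal ?_)⟩
  rw [← Real.rpow_mul (Nat.cast_nonneg n), mul_comm a q, mul_assoc]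
  exact mul_le_mul_of_nonneg_left (hC₁ n hn) hC0

end Model

end RWES

/-! ### Uniform integrability and exclusion of a constant limit. -/

namespace RWES

set_option linter.unusedSectionVars false

variable {Ω : Type*} [MeasurableSpace Ω]

variable {P : Measure Ω} [IsProbabilityMeasure P] {p : ℝ} {νX νξ : Measure ℝ}
  {X ε : ℕ → Ω → ℝ} {U : ℕ → Ω → ℕ} {ξ : ℕ → Ω → ℝ}

namespace Model

theorem integrable_walk_spin (M : Model P p νX νξ X ε U ξ) (n : ℕ) :
    Integrable (walk X ε U ξ n) P := by
  refine (M.integrable_walk (g := fun _ x => |x|) (fun _ => measurable_norm)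
    (fun _ x => abs_nonneg x) mean_abs_nonneg (fun _ => M.lintegral_abs_spin.le) n).mono'
    (M.measurable_walk_spin n).aestronglyMeasurable ?_
  filter_upwards [M.regular] with ω hω
  exact hω.abs_walk_le (fun _ _ => le_rfl) n

theorem setIntegral_walk_spin_succ (M : Model P p νX νξ X ε U ξ) {n : ℕ} (hn : 1 ≤ n)
    {s : Set Ω} (hs : MeasurableSet[M.history n] s) :
    ∫ ω in s, walk X ε U ξ (n + 1) ω ∂P =
      (1 + p * (∫ x, x ∂νξ) / n) * ∫ ω in s, walk X ε U ξ n ω ∂P +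
      (1 - p) * P.real s * ∫ x, x ∂νX := by
  have hg1 : ∀ _ : ℕ, Measurable fun x : ℝ => max x 0 := fun _ =>
    measurable_id.max measurable_const
  have hg2 : ∀ _ : ℕ, Measurable fun x : ℝ => max (-x) 0 := fun _ =>
    measurable_id.neg.max measurable_const
  have hz1 : ∀ _ : ℕ, ∫⁻ x, ENNReal.ofReal (max x 0) ∂νX ≤ ENNReal.ofReal (∫ x, |x| ∂νX) :=
    fun _ => M.lintegral_le_abs_spin fun x => max_le (le_abs_self x) (abs_nonneg x)
  have hz2 : ∀ _ : ℕ, ∫⁻ x, ENNReal.ofReal (max (-x) 0) ∂νX ≤ ENNReal.ofReal (∫ x, |x| ∂νX) :=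
    fun _ => M.lintegral_le_abs_spin fun x => max_le (neg_le_abs x) (abs_nonneg x)
  have h1 := M.setIntegral_walk_succ hg1 (fun _ x => le_max_right _ _) mean_abs_nonneg hz1 hn hs
  have h2 := M.setIntegral_walk_succ hg2 (fun _ x => le_max_right _ _) mean_abs_nonneg hz2 hn hs
  have i1 := M.integrable_walk hg1 (fun _ x => le_max_right _ _) mean_abs_nonneg hz1
  have i2 := M.integrable_walk hg2 (fun _ x => le_max_right _ _) mean_abs_nonneg hz2
  have hX : X = fun n ω => max (X n ω) 0 - max (-X n ω) 0 := by
    funext n ω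
    exact (max_zero_sub_max_neg_zero_eq_self _).symm
  have hdec : ∀ n, ∫ ω in s, walk X ε U ξ n ω ∂P =
      ∫ ω in s, walk (fun n ω => max (X n ω) 0) ε U ξ n ω ∂P -
      ∫ ω in s, walk (fun n ω => max (-X n ω) 0) ε U ξ n ω ∂P := by
    intro n
    rw [← integral_sub (i1 n).integrableOn (i2 n).integrableOn]
    refine integral_congr_ae (ae_restrict_of_ae ?_)
    filter_upwards [M.regular] with ω hω
    conv_lhs => rw [hX]
    exact hω.walk_sub n
  have hmean : ∫ x, x ∂νX = ∫ x, max x 0 ∂νX - ∫ x, max (-x) 0 ∂νX := by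
    rw [← integral_sub M.spin_integrable.pos_part M.spin_integrable.neg_part]
    refine integral_congr_ae (ae_of_all _ fun x => ?_)
    exact (max_zero_sub_max_neg_zero_eq_self x).symm
  rw [hdec, hdec, h1, h2, hmean]
  ring

/-- Where the normalised walk has modulus z ≥ C, one has z ≤ C^{1-q} z^q, so the L^q bound makes the
large values uniformly small in L¹. -/
theorem unifIntegrable_walk (M : Model P p νX νξ X ε U ξ) {q : ℝ} (hq1 : 1 < q) {D : ℝ}
    (hD : ∀ n : ℕ, 1 ≤ n →
      ∫⁻ ω, ENNReal.ofReal ((walk (fun n ω => |X n ω|) ε U ξ n ω) ^ q) ∂P ≤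
        ENNReal.ofReal (D * ((n : ℝ) ^ (p * ∫ y, y ∂νξ)) ^ q)) :
    UnifIntegrable (fun (n : ℕ) ω => walk X ε U ξ n ω / (n : ℝ) ^ (p * ∫ y, y ∂νξ)) 1 P := by
  set a := p * ∫ y, y ∂νξ
  refine unifIntegrable_of le_rfl ENNReal.one_ne_top
    (fun n => ((M.measurable_walk_spin n).div_const _).aestronglyMeasurable) fun e he => ?_
  obtain ⟨C, hC0, hC⟩ : ∃ C : ℝ, 0 < C ∧ D * C ^ (1 - q) ≤ e := by
    have h1 : Tendsto (fun C : ℝ => D * C ^ (-(q - 1))) atTop (𝓝 (D * 0)) :=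
      (tendsto_rpow_neg_atTop (by linarith)).const_mul D
    rw [mul_zero] at h1
    obtain ⟨C, hC, hC0⟩ := ((h1.eventually_le_const he).and (eventually_gt_atTop 0)).exists
    exact ⟨C, hC0, by rwa [neg_sub] at hC⟩
  refine ⟨C.toNNReal, fun n => ?_⟩
  rcases Nat.eq_zero_or_pos n with rfl | hn
  · refine le_trans (le_of_eq ?_) zero_le
    have : (fun ω => walk X ε U ξ 0 ω / ((0 : ℕ) : ℝ) ^ a) = 0 := by
      funext ω
      simp [walk]
    rw [this, Set.indicator_zero', eLpNorm_zero]
  have hpos : (0 : ℝ) < (n : ℝ) ^ a := by positivity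
  rw [eLpNorm_one_eq_lintegral_enorm]
  calc _ ≤ ∫⁻ ω, ENNReal.ofReal (C ^ (1 - q) / ((n : ℝ) ^ a) ^ q) *
          ENNReal.ofReal ((walk (fun n ω => |X n ω|) ε U ξ n ω) ^ q) ∂P := by
        refine lintegral_mono_ae ?_
        filter_upwards [M.regular] with ω hω
        have hw : 0 ≤ walk (fun n ω => |X n ω|) ε U ξ n ω :=
          hω.walk_nonneg (fun n _ => abs_nonneg _) n
        by_cases hmem : ω ∈ {x | C.toNNReal ≤ ‖walk X ε U ξ n x / (n : ℝ) ^ a‖₊}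
        · rw [Set.indicator_of_mem hmem, ← ofReal_norm, ← ENNReal.ofReal_mul (by positivity)]
          refine ENNReal.ofReal_le_ofReal ?_
          have hmem' : C ≤ ‖walk X ε U ξ n ω / (n : ℝ) ^ a‖ := Real.toNNReal_le_iff_le_coe.1 hmem
          set z := ‖walk X ε U ξ n ω / (n : ℝ) ^ a‖ with hz
          have hz0 : 0 < z := by linarith
          have hzw : z ≤ walk (fun n ω => |X n ω|) ε U ξ n ω / (n : ℝ) ^ a := by
            rw [hz, norm_div, Real.norm_of_nonneg hpos.le]
            gcongr
            exact hω.abs_walk_le (fun _ _ => le_rfl) n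
          calc z = z ^ (1 - q) * z ^ q := by
                rw [← Real.rpow_add hz0, sub_add_cancel, Real.rpow_one]
            _ ≤ C ^ (1 - q) * (walk (fun n ω => |X n ω|) ε U ξ n ω / (n : ℝ) ^ a) ^ q := by
                have h1 : z ^ (1 - q) ≤ C ^ (1 - q) :=
                  Real.rpow_le_rpow_of_nonpos hC0 hmem' (by linarith)
                gcongr
            _ = _ := by
                rw [Real.div_rpow hw hpos.le]
                ring
        · rw [Set.indicator_of_notMem hmem, enorm_zero]
          exact zero_le
    _ ≤ ENNReal.ofReal (C ^ (1 - q) / ((n : ℝ) ^ a) ^ q) *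
          ENNReal.ofReal (D * ((n : ℝ) ^ a) ^ q) := by
        rw [lintegral_const_mul' _ _ ENNReal.ofReal_ne_top]
        exact mul_le_mul_right (hD n hn) _
    _ ≤ ENNReal.ofReal e := by
        rw [← ENNReal.ofReal_mul (by positivity)]
        refine ENNReal.ofReal_le_ofReal (le_trans (le_of_eq ?_) hC)
        field_simp

/-- If the limit of the normalised walk is constant and holds in `L¹`, then the walk is constant
at every time. -/
theorem walk_ae_eq_const (M : Model P p νX νξ X ε U ξ)
    (hUI : UnifIntegrable (fun (n : ℕ) ω => walk X ε U ξ n ω / (n : ℝ) ^ (p * ∫ y, y ∂νξ)) 1 P)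
    {c : ℝ} (hc : ∀ᵐ ω ∂P, walkLimit X ε U ξ (p * ∫ y, y ∂νξ) ω = c) {m : ℕ} (hm : 1 ≤ m) :
    ∀ᵐ ω ∂P, walk X ε U ξ m ω = ∫ ω, walk X ε U ξ m ω ∂P := by
  have ha := M.exponent_nonneg
  have ha1 := M.super
  set a := p * ∫ y, y ∂νξ with ha_def
  have hlim : ∀ᵐ ω ∂P, Tendsto (fun n : ℕ => walk X ε U ξ n ω / (n : ℝ) ^ a) atTop (𝓝 c) := by
    filter_upwards [M.tendsto_walk_walkLimit, hc] with ω h1 h2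
    rwa [← h2]
  have hint : ∀ n : ℕ, Integrable (fun ω => walk X ε U ξ n ω / (n : ℝ) ^ a) P := fun n =>
    (M.integrable_walk_spin n).div_const _
  have hL1 := tendsto_Lp_finite_of_tendsto_ae le_rfl ENNReal.one_ne_top
    (fun n => (hint n).aestronglyMeasurable) (memLp_const c) hUI hlim
  have hset : ∀ s, Tendsto (fun n : ℕ => (∫ ω in s, walk X ε U ξ n ω ∂P) / (n : ℝ) ^ a) atTop
      (𝓝 (P.real s * c)) := by
    intro s
    have h := tendsto_setIntegral_of_L1' _ aestronglyMeasurable_const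
      (Eventually.of_forall hint) hL1 s
    simpa only [integral_div, setIntegral_const, smul_eq_mul] using h
  have hcov : ∀ s, MeasurableSet[M.history m] s →
      ∫ ω in s, walk X ε U ξ m ω ∂P = P.real s * ∫ ω, walk X ε U ξ m ω ∂P := by
    intro s hs
    -- The covariance of the walk at time n with the indicator of s.
    set I : ℕ → ℝ := fun n =>
      (∫ ω in s, walk X ε U ξ n ω ∂P) - P.real s * ∫ ω, walk X ε U ξ n ω ∂P with hI
    have hI1 : ∀ n, m ≤ n → I n = I m / growth a m * growth a n := by
      intro n hn
      induction n, hn using Nat.le_induction with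
      | base => rw [div_mul_cancel₀ _ (growth_pos ha m).ne']
      | succ n hn ih =>
        have h1 := M.setIntegral_walk_spin_succ (hm.trans hn) (M.history.mono hn s hs)
        have h2 := M.setIntegral_walk_spin_succ (hm.trans hn)
          (@MeasurableSet.univ Ω (M.history n))
        simp only [setIntegral_univ, probReal_univ] at h2
        -- The fresh-spin contribution cancels in the covariance, so it grows exactly like `growth
        -- a`. L¹ convergence to a constant makes it o(n^a), hence it vanishes from time m on.
        have h3 : I (n + 1) = (1 + a / n) * I n := by
          simp only [hI]
          rw [h1, h2, ← ha_def]
          ring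
        rw [h3, ih, growth_succ (hm.trans hn)]
        ring
    have hI0 : Tendsto (fun n : ℕ => I n / (n : ℝ) ^ a) atTop (𝓝 0) := by
      have h1 := hset s
      have h2 := (hset Set.univ).const_mul (P.real s)
      simp only [setIntegral_univ, probReal_univ, one_mul] at h2
      have h3 := h1.sub h2
      rw [sub_self] at h3
      refine h3.congr fun n => ?_
      simp only [hI]
      ring
    have hI2 : Tendsto (fun n : ℕ => I n / (n : ℝ) ^ a) atTop
        (𝓝 (I m / growth a m * (Real.Gamma (a + 1))⁻¹)) := by
      refine ((tendsto_growth_div (by linarith : 0 < a)).const_mul (I m / growth a m)).congr' ?_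
      filter_upwards [eventually_ge_atTop m] with n hn
      rw [hI1 n hn]
      ring
    have h0 := tendsto_nhds_unique hI2 hI0
    have hΓ := Real.Gamma_pos_of_pos (by linarith : 0 < a + 1)
    have hG := growth_pos ha m
    have : I m = 0 := by
      rcases mul_eq_zero.1 h0 with h | h
      · rcases div_eq_zero_iff.1 h with h | h
        · exact h
        · exact absurd h hG.ne'
      · exact absurd h (inv_pos.2 hΓ).ne'
    simp only [hI] at this
    linarith
  have hmeas : Measurable[M.history m] (walk X ε U ξ m) :=
    M.measurable_walk (g := fun _ x => x) (fun _ => measurable_id) le_rfl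
  refine ae_eq_of_forall_setIntegral_eq_of_sigmaFinite' (M.history.le m)
    (fun s _ _ => (M.integrable_walk_spin m).integrableOn)
    (fun s _ _ => (integrable_const _).integrableOn) (fun s hs _ => ?_)
    hmeas.stronglyMeasurable.aestronglyMeasurable
    stronglyMeasurable_const.aestronglyMeasurable
  rw [hcov s hs, setIntegral_const, smul_eq_mul]

/-- The limit of the normalised walk is non-degenerate if the walk is bounded in some `L^q`. -/
theorem nonDegenerate_walkLimit (M : Model P p νX νξ X ε U ξ) (hX0 : νX {0} < 1)
    (hUI : UnifIntegrable (fun (n : ℕ) ω => walk X ε U ξ n ω / (n : ℝ) ^ (p * ∫ y, y ∂νξ)) 1 P) :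
    NonDegenerate P (walkLimit X ε U ξ (p * ∫ y, y ∂νξ)) := by
  rintro ⟨c, hc⟩
  have hprobξ := M.isProbabilityMeasure_echo
  have hprobX := M.isProbabilityMeasure_spin
  have hp := M.p_pos
  have hp1 := M.p_lt_one
  have h1 := M.walk_ae_eq_const hUI hc le_rfl
  have h2 := M.walk_ae_eq_const hUI hc one_le_two
  set x := ∫ ω, walk X ε U ξ 1 ω ∂P
  set κ := ∫ ω, walk X ε U ξ 2 ω ∂P
  have hX1 : ∀ᵐ ω ∂P, X 1 ω = x := by
    filter_upwards [h1] with ω hω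
    simpa [walk, step_one] using hω
  have hνX : ∀ᵐ y ∂νX, y = x := by
    rw [← M.law_spin 1 le_rfl]
    exact (ae_map_iff (M.measurable_spin 1 le_rfl).aemeasurable (measurableSet_singleton x)).2 hX1
  have hX2 : ∀ᵐ ω ∂P, X 2 ω = x := by
    rw [← M.law_spin 2 one_le_two] at hνX
    exact ae_of_ae_map (M.measurable_spin 2 one_le_two).aemeasurable hνX
  have hx0 : x ≠ 0 := by
    rintro hx
    rw [hx] at hνX
    have : νX {0} = 1 := by
      rw [← prob_compl_eq_zero_iff (measurableSet_singleton 0)]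
      exact hνX
    exact hX0.ne this
  have hwalk : ∀ ω, walk X ε U ξ 2 ω = X 1 ω + step X ε U ξ ω 2 := by
    intro ω
    simp [walk, Finset.sum_Icc_succ_top, step_one]
  -- On the positive-probability event `ε 2 = 0`, the walk at time 2 is the sum of two spins, both
  -- equal to x.
  have hκ : κ = x + x := by
    have hpos : P {ω | ε 2 ω = 0} ≠ 0 := by
      rw [(M.law_bernoulli 2 le_rfl).2]
      simpa using hp1
    obtain ⟨ω, hω, h3, h4, h5⟩ := ((frequently_ae_mem_iff.2 hpos).and_eventually
      (h2.and (hX1.and hX2))).exists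
    rw [← h3, hwalk, step_of_eq_zero le_rfl hω, h4, h5]
  -- When `ε 2 = 1` the parent of 2 can only be 1, so constancy of the walk reads ξ x = x with x ≠
  -- 0.
  have hξ2 : ∀ᵐ ω ∂P, ε 2 ω = 1 → ξ 2 ω = 1 := by
    filter_upwards [M.regular, h2, hX1] with ω hω h3 h4 h5
    obtain ⟨-, hU1, hU2, -⟩ := hω 2 le_rfl
    have hU : U 2 ω = 1 := by omega
    rw [hwalk, step_of_eq_one le_rfl h5 hU2, hU, step_one, h4, hκ] at h3
    have h6 : (ξ 2 ω - 1) * x = 0 := by linarith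
    rcases mul_eq_zero.1 h6 with h7 | h7
    · linarith
    · exact absurd h7 hx0
  -- Independence removes the condition `ε 2 = 1`, which has probability p > 0. The echo is then 1
  -- a.s. and m₁ = 1, contradicting p m₁ > 1.
  have hind : P ({ω | ε 2 ω = 1} ∩ {ω | ξ 2 ω ≠ 1}) = P {ω | ε 2 ω = 1} * P {ω | ξ 2 ω ≠ 1} := by
    refine (Indep_iff _ _ P).1 (M.indep_sigma (S := {Sum.inr (Sum.inl 0)})
      (T := {Sum.inr (Sum.inr (Sum.inr 0))}) (by simp)) _ _ ?_ ?_
    · exact measurable_bernoulli_sigma le_rfl (by simp) (measurableSet_singleton 1)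
    · exact measurable_echo_sigma le_rfl (by simp) (measurableSet_singleton (1 : ℝ)).compl
  have hzero : P ({ω | ε 2 ω = 1} ∩ {ω | ξ 2 ω ≠ 1}) = 0 := by
    refine measure_mono_null ?_ (ae_iff.1 hξ2)
    rintro ω ⟨h3, h4⟩ h5
    exact h4 (h5 h3)
  rw [hind, (M.law_bernoulli 2 le_rfl).1] at hzero
  have hξ1 : ∀ᵐ ω ∂P, ξ 2 ω = 1 := by
    rcases mul_eq_zero.1 hzero with h3 | h3
    · rw [ENNReal.ofReal_eq_zero] at h3
      linarith
    · exact h3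
  have hν1 : ∀ᵐ y ∂νξ, y = 1 := by
    rw [← M.law_echo 2 le_rfl]
    exact (ae_map_iff (M.measurable_echo 2 le_rfl).aemeasurable (measurableSet_singleton 1)).2 hξ1
  have hmean : ∫ y, y ∂νξ = 1 := by
    rw [integral_congr_ae hν1]
    simp
  have := M.super
  rw [hmean] at this
  linarith

end Model

end RWES

/-! ### Assembly of the main theorem. -/

theorem mainTheorem8 {Ω : Type*} [MeasurableSpace Ω] (P : Measure Ω) [IsProbabilityMeasure P]
    (p : ℝ) (hp0 : 0 < p) (hp1 : p < 1)
    (νX νξ : Measure ℝ)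
    (X ε : ℕ → Ω → ℝ) (U : ℕ → Ω → ℕ) (ξ : ℕ → Ω → ℝ)
    (hinput : RWES.IsInput P p νX νξ X ε U ξ)
    (hX0 : νX {0} < 1)
    (hξ_nonneg : ∀ᵐ x ∂νξ, 0 ≤ x)
    (hLp : ∃ α : ℝ, 1 < α ∧ MemLp (fun x : ℝ => x) (ENNReal.ofReal α) νX ∧
      MemLp (fun x : ℝ => x) (ENNReal.ofReal α) νξ)
    (m₁ : ℝ) (hm₁ : m₁ = ∫ x, x ∂νξ)
    (hsuper : 1 < p * m₁) :
    (∀ r : ℕ, 1 ≤ r →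
      (∀ᵐ ω ∂P, Tendsto (fun n : ℕ => RWES.subtreeWeight ε U ξ r n ω / (n : ℝ) ^ (p * m₁))
        atTop (𝓝 (RWES.subtreeLimit ε U ξ (p * m₁) r ω))) ∧
      Integrable (RWES.subtreeLimit ε U ξ (p * m₁) r) P) ∧
    IndepFun (fun ω (r : ℕ) => RWES.subtreeLimit ε U ξ (p * m₁) (r + 1) ω)
      (fun ω (r : ℕ) => X (r + 1) ω) P ∧
    (∀ᵐ ω ∂P, Summable
      (fun r : ℕ => |X (r + 1) ω * RWES.subtreeLimit ε U ξ (p * m₁) (r + 1) ω|)) ∧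
    Integrable (RWES.limitSeries X ε U ξ (p * m₁)) P ∧
    (∀ᵐ ω ∂P, Tendsto (fun n : ℕ => RWES.walk X ε U ξ n ω / (n : ℝ) ^ (p * m₁))
      atTop (𝓝 (RWES.limitSeries X ε U ξ (p * m₁) ω))) ∧
    ((∫ x, x * Real.log x ∂νξ) < m₁ →
      RWES.NonDegenerate P (RWES.limitSeries X ε U ξ (p * m₁))) ∧
    (m₁ ≤ (∫ x, x * Real.log x ∂νξ) →
      ∀ᵐ ω ∂P, RWES.limitSeries X ε U ξ (p * m₁) ω = 0) := by
  subst hm₁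
  obtain ⟨α, hα, hXα, hξα⟩ := hLp
  have hα1 : (1 : ENNReal) ≤ ENNReal.ofReal α := by simpa using hα.le
  have hprobX : IsProbabilityMeasure νX := by
    rw [← hinput.law_spin 1 le_rfl]
    exact Measure.isProbabilityMeasure_map (hinput.measurable_spin 1 le_rfl).aemeasurable
  have hprobξ : IsProbabilityMeasure νξ := by
    rw [← hinput.law_echo 2 le_rfl]
    exact Measure.isProbabilityMeasure_map (hinput.measurable_echo 2 le_rfl).aemeasurable
  have M : RWES.Model P p νX νξ X ε U ξ :=
    { hinput with
      p_pos := hp0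
      p_lt_one := hp1
      echo_nonneg := hξ_nonneg
      echo_integrable := hξα.integrable hα1
      spin_integrable := hXα.integrable hα1
      super := hsuper }
  have hmom : ∀ {ν : Measure ℝ} [IsProbabilityMeasure ν] {s : ℝ}, 1 < s → s ≤ α →
      MemLp (fun x : ℝ => x) (ENNReal.ofReal α) ν → Integrable (fun x : ℝ => |x| ^ s) ν := by
    intro ν _ s hs hsα hν
    have h := (hν.mono_exponent (ENNReal.ofReal_le_ofReal hsα)).integrable_norm_rpow
      (by simp; linarith) ENNReal.ofReal_ne_top
    rwa [ENNReal.toReal_ofReal (by linarith)] at h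
  have hecho : ∀ {s : ℝ}, 1 < s → s ≤ α → Integrable (fun x : ℝ => x ^ s) νξ := by
    intro s hs hsα
    refine (hmom hs hsα hξα).congr ?_
    filter_upwards [hξ_nonneg] with x hx
    rw [abs_of_nonneg hx]
  -- The order 1 + q must be at most α for the moments to exist and at most 2 for the Taylor and
  -- Bernoulli bounds.
  set q := min (α - 1) 1 with hq_def
  have hq : 0 < q := lt_min (by linarith) one_pos
  have hq1 : q ≤ 1 := min_le_right _ _
  have hqα : 1 + q ≤ α := by linarith [min_le_left (α - 1) 1]
  have hint := hecho (by linarith : 1 < 1 + q) hqα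
  have heq := M.walkLimit_eq_limitSeries
  refine ⟨fun r _ => ⟨M.tendsto_subtreeWeight r, M.integrable_subtreeLimit r⟩,
    M.indepFun_subtreeLimit, M.summable_spin_mul_subtreeLimit, M.integrable_walkLimit.congr heq,
    ?_, ?_, ?_⟩
  · filter_upwards [M.tendsto_walk_walkLimit, heq] with ω h1 h2
    rwa [← h2]
  · intro hlog
    obtain ⟨s, hs, hsq, hsint, hlt⟩ :=
      RWES.exists_integral_rpow_lt hq hξ_nonneg M.echo_integrable hint hlog
    obtain ⟨D, -, hD⟩ := M.exists_lintegral_walk_rpow_le (q := 1 + s) (by linarith)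
      (by linarith) (hmom (by linarith) (by linarith) hXα) hsint hlt
    rintro ⟨c, hc⟩
    refine M.nonDegenerate_walkLimit hX0 (M.unifIntegrable_walk (by linarith) hD) ⟨c, ?_⟩
    filter_upwards [heq, hc] with ω h1 h2
    rw [h1, h2]
  · intro hlog
    filter_upwards [ae_all_iff.2 (M.subtreeLimit_eq_zero hq hq1 hint hlog)] with ω hω
    simp [RWES.limitSeries, hω]
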